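/- Let $R=\mathbb{Z}[\beta]$. A linearly compact (LC) $R$-module with pseudobasis $\{b_i\}_{i\in I}$ is the module $\prod_{i\in I} R b_i$ of arbitrary $R$-linear combinations of the $b_i$, with the product topology ($R$ discrete); the completed tensor product $\hat\otimes$ of two such modules is the LC-module whose pseudobasis consists of the tensors $b_i\otimes b'_j$. An LC-Hopf algebra is an LC-module $B$ with continuous linear maps $\nabla: B\hat\otimes B\to B$, $\iota: R\to B$, $\Delta: B\to B\hat\otimes B$, $\epsilon: B\to R$ whose adjoints make the free module of which $B$ is the dual into a Hopf algebra. A combinatorial LC-Hopf algebra is a pair $(B,\zeta)$ of an LC-Hopf algebra $B$ and a continuous algebra morphism $\zeta: B\to R[[t]]$ with $\zeta(\cdot)|_{t=0}=\epsilon$. A morphism $(B,\zeta)\to(B',\zeta')$ is a continuous linear map $\phi:B\to B'$ that commutes with products, coproducts, units and counits and satisfies $\zeta=\zeta'\circ\phi$. **Posets.** A labeled poset $(P,\gamma)$ is a finite poset $P$ with an injective map $\gamma:P\to\mathbb{Z}$; write $s\lessdot t$ if $t$ covers $s$. Its set of valleys $\mathrm{Val}(P,\gamma)$ consists of the $v\in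 P$ with $\gamma(x)>\gamma(v)$ whenever $x\lessdot v$ and $\gamma(v)<\gamma(y)$ whenever $v\lessdot y$. For $V\subseteq\mathrm{Val}(P,\gamma)$ and $V'\subseteq\mathrm{Val}(P',\gamma')$, an isomorphism $(P,\gamma,V)\cong(P',\gamma',V')$ is a poset isomorphism $\phi:P\to P'$ with $\phi(V)=V'$ such that, for all $s\lessdot t$ in $P$, $\gamma(s)>\gamma(t)$ if and only if $\gamma'(\phi(s))>\gamma'(\phi(t))$. Let $\mathfrak{m}\mathsf{LPoset}^+$ be the LC-module whose pseudobasis is the set of isomorphism classes $[(P,\gamma,V)]$ with $V\subseteq\mathrm{Val}(P,\gamma)$, with the continuous linear structure maps determined by $$\nabla([(P,\gamma,V)]\otimes[(Q,\delta,W)])=[(P\sqcup Q,\gamma\sqcup\delta,V\sqcup W)],\qquad \Delta([(P,\gamma,V)])=\sum_{(S,T)}\beta^{|S\cap T|}\,[(S,\gamma|_S,V\cap S)]\otimes[(T,\gamma|_T,V\cap T)],$$ where $(\gamma\sqcup\delta)(s)=\gamma(s)-\max\gamma$ for $s\in P$ and $(\gamma\sqcup\delta)(s)=\delta(s)-\min\delta+1$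 for $s\in Q$, and where $(S,T)$ runs over the pairs of a lower set $S$ and an upper set $T$ of $P$ with $S\cup T=P$ and $S\cap T$ an antichain. The unit is $1\mapsto[(\varnothing,\varnothing,\varnothing)]$, and $\epsilon([(P,\gamma,V)])$ is $1$ if $P=\varnothing$ and $0$ otherwise. Let $\zeta_<$ and $\bar\zeta_>$ be the continuous linear maps $\mathfrak{m}\mathsf{LPoset}^+\to R[[t]]$ such that $\zeta_<([(P,\gamma,V)])=t^{|P|}$ if $\gamma(s)<\gamma(t)$ for all $s<t$ in $P$, and $0$ otherwise; and $\bar\zeta_>([(P,\gamma,V)])=t^{|P|}$ if $V=\varnothing$ and $\gamma(s)>\gamma(t)$ for all $s\lessdot t$ in $P$, and $0$ otherwise. Let $\zeta_{>|<}=\nabla_{R[[t]]}\circ(\bar\zeta_>\hat\otimes\zeta_<)\circ\Delta$. **Quasisymmetric functions.** Let $\mathfrak{m}\mathsf{QSym}$ be the LC-module of all quasisymmetric power series in $R[[x_1,x_2,\dots]]$, with pseudobasis the monomial quasisymmetric functions $M_\alpha=\sum_{i_1<\dots<i_l}x_{i_1}^{\alpha_1}\cdots x_{i_l}^{\alpha_l}$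 ($\alpha$ ranging over all compositions), with (the continuous extension of) the multiplication of power series, unit $1$, coproduct $\Delta(M_\alpha)=\sum_{\alpha=\alpha'\alpha''}M_{\alpha'}\otimes M_{\alpha''}$ (deconcatenation), and counit $M_\varnothing\mapsto1$, $M_\alpha\mapsto0$ for $\alpha\ne\varnothing$. Let $\zeta_{\mathsf Q}(f)=f(t,0,0,\dots)$. **Enriched enumerators.** Let $\mathbb{M}=\{1'<1<2'<2<\cdots\}$ and $|i'|=|i|=i$. For a labeled poset $(P,\gamma)$ and $V\subseteq\mathrm{Val}(P,\gamma)$, let $\mathcal{E}(P,\gamma,V)$ be the set of maps $\sigma$ from $P$ to the finite nonempty subsets of $\mathbb{M}$ such that, for all $s\lessdot t$ in $P$, $\max\sigma(s)\le\min\sigma(t)$, $\sigma(s)\cap\sigma(t)\subseteq\{1,2,\dots\}$ if $\gamma(s)<\gamma(t)$, and $\sigma(s)\cap\sigma(t)\subseteq\{1',2',\dots\}$ if $\gamma(s)>\gamma(t)$; and such that $\sigma(v)\subseteq\{1,2,\dots\}$ for all $v\in V$. Put $$\Omega^{(\beta)}(P,\gamma,V)=\sum_{\sigma\in\mathcal{E}(P,\gamma,V)}\beta^{|\sigma|-|P|}\prod_{s\in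 P}\prod_{i\in\sigma(s)}x_{|i|},\qquad |\sigma|=\sum_{s\in P}|\sigma(s)|.$$ **Theorem.** The pairs $(\mathfrak{m}\mathsf{LPoset}^+,\zeta_{>|<})$ and $(\mathfrak{m}\mathsf{QSym},\zeta_{\mathsf Q})$ are combinatorial LC-Hopf algebras. There is a unique continuous linear map $\mathfrak{m}\mathsf{LPoset}^+\to\mathfrak{m}\mathsf{QSym}$ with $[(P,\gamma,V)]\mapsto\Omega^{(\beta)}(P,\gamma,V)$ for each labeled poset $(P,\gamma)$ and each subset $V\subseteq\mathrm{Val}(P,\gamma)$, and it is the unique morphism of combinatorial LC-Hopf algebras $$(\mathfrak{m}\mathsf{LPoset}^+,\zeta_{>|<})\to(\mathfrak{m}\mathsf{QSym},\zeta_{\mathsf Q}).$$ -/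

import Mathlib

/-! ### Linearly compact modules -/

/-- A linearly compact `R`-module `B` with pseudobasis indexed by `I`: every element of `B` is an
arbitrary (possibly infinite) `R`-linear combination of the pseudobasis, `coord b i` being the
coefficient of the `i`-th pseudobasis element in `b`.  Equivalently `B` is the dual of the free
module on `I` with respect to the form `⟨a, b⟩ = ∑ i, a i * coord b i`. -/
class LCModule (R : Type*) [CommRing R] (I : outParam Type*) (B : Type*)
    [AddCommGroup B] [Module R B] where
  coord : B ≃ₗ[R] (I → R)

/-- The `R`-module of arbitrary `R`-linear combinations of the elements of `I`. -/
instance LCModule.pi (R : Type*) [CommRing R] (I : Type*) : LCModule R I (I → R) where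
  coord := LinearEquiv.refl R (I → R)

/-- Formal power series, with pseudobasis `1, t, t², …`. -/
noncomputable instance LCModule.powerSeries (R : Type*) [CommRing R] : LCModule R ℕ (PowerSeries R) where
  coord :=
    { toFun := fun f n => PowerSeries.coeff n f
      invFun := fun g => PowerSeries.mk g
      left_inv := fun f => by ext n; simp
      right_inv := fun g => by funext n; simp
      map_add' := fun f g => by funext n; simp
      map_smul' := fun r f => by funext n; simp }

section LC

variable {R : Type*} [CommRing R]
variable {I J K L : Type*}
variable {B B' C C' : Type*} [AddCommGroup B] [Module R B] [LCModule R I B]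
  [AddCommGroup B'] [Module R B'] [LCModule R J B']
  [AddCommGroup C] [Module R C] [LCModule R K C]
  [AddCommGroup C'] [Module R C'] [LCModule R L C']

/-- The coordinates of an element with respect to the pseudobasis. -/
def LCModule.coordinates (R : Type*) [CommRing R] {I B : Type*} [AddCommGroup B] [Module R B]
    [LCModule R I B] : B ≃ₗ[R] (I → R) :=
  LCModule.coord

open Classical in
/-- The `i`-th pseudobasis element. -/
noncomputable def LCModule.pseudobasis (R : Type*) [CommRing R] {I : Type*} (B : Type*)
    [AddCommGroup B] [Module R B] [LCModule R I B] (i : I) : B :=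
  (LCModule.coordinates R).symm (Pi.single i 1)

open Classical in
theorem LCModule.coordinates_pseudobasis (i j : I) :
    LCModule.coordinates R (LCModule.pseudobasis R B i) j = if j = i then 1 else 0 := by
  rw [LCModule.pseudobasis, LinearEquiv.apply_symm_apply, Pi.single_apply]

/-- The linearly compact topology: the product topology on the coordinates, each copy of `R` being
discrete. -/
@[reducible]
def LCModule.topology (R : Type*) [CommRing R] {I : Type*} (B : Type*)
    [AddCommGroup B] [Module R B] [LCModule R I B] : TopologicalSpace B :=
  TopologicalSpace.induced (LCModule.coordinates R : B → I → R)
    (@Pi.topologicalSpace I (fun _ => R) (fun _ => ⊥))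

/-- Continuity of a linear map between linearly compact modules. -/
def LCContinuous (f : B →ₗ[R] B') : Prop :=
  @Continuous B B' (LCModule.topology R B) (LCModule.topology R B') f

/-- The completed tensor product of linearly compact modules with pseudobases indexed by `I` and
`J`: the linearly compact module with pseudobasis `I × J`. -/
abbrev CompletedTensor (R : Type*) (I J : Type*) : Type _ := I × J → R

/-- The pure tensor `b ⊗ b'` in the completed tensor product. -/
def ctmul (R : Type*) [CommRing R] {I J B B' : Type*} [AddCommGroup B] [Module R B]
    [LCModule R I B] [AddCommGroup B'] [Module R B'] [LCModule R J B'] (b : B) (b' : B') :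
    CompletedTensor R I J :=
  fun p => LCModule.coordinates R b p.1 * LCModule.coordinates R b' p.2

/-- The completed tensor product `f ⊗̂ g` of (continuous) linear maps: apply `g` in the second
tensor factor, and then `f` in the first one. -/
def cmap (f : B →ₗ[R] C) (g : B' →ₗ[R] C') :
    CompletedTensor R I J →ₗ[R] CompletedTensor R K L where
  toFun T := fun p => LCModule.coordinates R
    (f ((LCModule.coordinates R).symm fun i => LCModule.coordinates R
      (g ((LCModule.coordinates R).symm fun j => T (i, j))) p.2)) p.1
  map_add' S T := by
    funext p
    have h : (fun i => LCModule.coordinates R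
          (g ((LCModule.coordinates R).symm fun j => (S + T) (i, j))) p.2) =
        (fun i => LCModule.coordinates R (g ((LCModule.coordinates R).symm fun j => S (i, j))) p.2)
        + fun i => LCModule.coordinates R
          (g ((LCModule.coordinates R).symm fun j => T (i, j))) p.2 := by
      funext i
      have h1 : (fun j => (S + T) (i, j)) = (fun j => S (i, j)) + fun j => T (i, j) := rfl
      rw [h1, map_add, map_add, map_add]
      rfl
    rw [h, map_add, map_add, map_add]
    rfl
  map_smul' r T := by
    funext p
    have h : (fun i => LCModule.coordinates R
          (g ((LCModule.coordinates R).symm fun j => (r • T) (i, j))) p.2) =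
        r • fun i => LCModule.coordinates R
          (g ((LCModule.coordinates R).symm fun j => T (i, j))) p.2 := by
      funext i
      have h1 : (fun j => (r • T) (i, j)) = r • fun j => T (i, j) := rfl
      rw [h1, map_smul, map_smul, map_smul]
      rfl
    rw [h, map_smul, map_smul, map_smul]
    rfl

/-- `f ⊗̂ g` has the expected values on pure tensors. -/
theorem cmap_ctmul (f : B →ₗ[R] C) (g : B' →ₗ[R] C') (b : B) (b' : B') :
    cmap f g (ctmul R b b') = ctmul R (f b) (g b') := by
  funext p
  have h : (fun i => LCModule.coordinates R
        (g ((LCModule.coordinates R).symm fun j => ctmul R b b' (i, j))) p.2) =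
      LCModule.coordinates R (g b') p.2 • LCModule.coordinates R b := by
    funext i
    have h1 : (fun j => ctmul R b b' (i, j))
        = LCModule.coordinates R b i • LCModule.coordinates R b' := rfl
    rw [h1, map_smul, LinearEquiv.symm_apply_apply, map_smul, map_smul]
    simp [mul_comm]
  change LCModule.coordinates R (f ((LCModule.coordinates R).symm fun i => _)) p.1 = _
  rw [h, map_smul, LinearEquiv.symm_apply_apply, map_smul, map_smul]
  simp [ctmul, mul_comm]

/-- The continuous linear map with prescribed values `v i` on the pseudobasis. It exists provided
each coordinate is nonzero on only finitely many `v i`. -/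
noncomputable def lcExtend (v : I → C)
    (hv : ∀ k, {i | LCModule.coordinates R (v i) k ≠ 0}.Finite) : B →ₗ[R] C where
  toFun b := (LCModule.coordinates R).symm fun k =>
    ∑ᶠ i, LCModule.coordinates R b i * LCModule.coordinates R (v i) k
  map_add' b b' := by
    rw [← map_add]
    congr 1
    funext k
    have hf : ∀ b : B, (Function.support fun i =>
        LCModule.coordinates R b i * LCModule.coordinates R (v i) k).Finite := fun b =>
      (hv k).subset fun i hi h => hi (by simp [h])
    simp only [map_add, Pi.add_apply, add_mul]
    exact finsum_add_distrib (hf b) (hf b')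
  map_smul' r b := by
    rw [RingHom.id_apply, ← map_smul]
    congr 1
    funext k
    have hf : (Function.support fun i =>
        LCModule.coordinates R b i * LCModule.coordinates R (v i) k).Finite :=
      (hv k).subset fun i hi h => hi (by simp [h])
    simp only [map_smul, Pi.smul_apply, smul_eq_mul, mul_assoc]
    exact (mul_finsum' _ r hf).symm

theorem coordinates_lcExtend (v : I → C)
    (hv : ∀ k, {i | LCModule.coordinates R (v i) k ≠ 0}.Finite) (b : B) (k : K) :
    LCModule.coordinates R (lcExtend v hv b) k =
      ∑ᶠ i, LCModule.coordinates R b i * LCModule.coordinates R (v i) k := by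
  simp [lcExtend]

theorem lcExtend_pseudobasis (v : I → C)
    (hv : ∀ k, {i | LCModule.coordinates R (v i) k ≠ 0}.Finite) (i : I) :
    lcExtend v hv (LCModule.pseudobasis R B i) = v i := by
  classical
  apply (LCModule.coordinates R : C ≃ₗ[R] (K → R)).injective
  funext k
  rw [coordinates_lcExtend, finsum_eq_single _ i]
  · simp [LCModule.pseudobasis]
  · intro j hj
    simp [LCModule.pseudobasis, hj]

theorem lcExtend_continuous (v : I → C)
    (hv : ∀ k, {i | LCModule.coordinates R (v i) k ≠ 0}.Finite) :
    LCContinuous (lcExtend v hv : B →ₗ[R] C) := by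
  let tR : TopologicalSpace R := ⊥
  have : DiscreteTopology R := ⟨rfl⟩
  let tB : TopologicalSpace B := LCModule.topology R B
  let tC : TopologicalSpace C := LCModule.topology R C
  change Continuous _
  refine continuous_induced_rng.2 (continuous_pi fun k => ?_)
  have h : (fun b : B => LCModule.coordinates R (lcExtend v hv b) k) =
      fun b => ∑ i ∈ (hv k).toFinset,
        LCModule.coordinates R b i * LCModule.coordinates R (v i) k := by
    funext b
    rw [coordinates_lcExtend]
    refine finsum_eq_sum_of_support_subset _ fun i hi => ?_
    simp only [Set.Finite.coe_toFinset, Set.mem_ofPred_eq]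
    exact fun h => hi (by simp [h])
  change Continuous fun b : B => LCModule.coordinates R (lcExtend v hv b) k
  rw [h]
  have hc : Continuous (LCModule.coordinates R : B → I → R) := continuous_induced_dom
  exact continuous_finsetSum _ fun i _ => ((continuous_apply i).comp hc).mul continuous_const

end LC

/-! ### LC-Hopf algebras -/

/-- Structure maps on a linearly compact module. -/
structure LCHopfData (R : Type*) [CommRing R] (I B : Type*) [AddCommGroup B] [Module R B]
    [LCModule R I B] where
  mul : CompletedTensor R I I →ₗ[R] B
  unit : R →ₗ[R] B
  comul : B →ₗ[R] CompletedTensor R I I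
  counit : B →ₗ[R] R

/-- The pairing of the free module `A` with basis `e` with the linearly compact module in which `e`
indexes the dual pseudobasis. -/
noncomputable def lcPairing {R : Type*} [CommRing R] {I : Type*} {A B : Type*} [AddCommGroup A]
    [Module R A] (e : Module.Basis I R A) [AddCommGroup B] [Module R B] [LCModule R I B]
    (a : A) (b : B) : R :=
  (e.repr a).sum fun i r => r * LCModule.coordinates R b i

open scoped TensorProduct in
/-- The structure maps make `B` into an LC-Hopf algebra: they are the adjoints of the structure maps
of a Hopf algebra `A` to which `B` is dual.  (Being adjoints, they are continuous.) -/
def LCHopfData.IsLCHopfAlgebra.{u, v, w} {R : Type u} [CommRing R] {I : Type v} {B : Type w} [AddCommGroup B]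
    [Module R B] [LCModule R I B] (H : LCHopfData R I B) : Prop :=
  ∃ (A : Type (max u v)) (_ : Ring A) (_ : HopfAlgebra R A) (e : Module.Basis I R A),
    (∀ (a : A) (T : CompletedTensor R I I),
      lcPairing e a (H.mul T) = lcPairing (e.tensorProduct e) (Coalgebra.comul (R := R) a) T) ∧
    (∀ (a : A) (r : R), lcPairing e a (H.unit r) = Coalgebra.counit (R := R) a * r) ∧
    (∀ (a a' : A) (b : B),
      lcPairing (e.tensorProduct e) (a ⊗ₜ[R] a') (H.comul b) = lcPairing e (a * a') b) ∧
    (∀ b : B, H.counit b = lcPairing e (1 : A) b)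

/-- The multiplication `R⟦t⟧ ⊗̂ R⟦t⟧ → R⟦t⟧`, the continuous linear map with
`tⁱ ⊗ tʲ ↦ tⁱ⁺ʲ`. -/
noncomputable def powerSeriesMul (R : Type*) [CommRing R] : CompletedTensor R ℕ ℕ →ₗ[R] PowerSeries R where
  toFun T := PowerSeries.mk fun n => ∑ p ∈ Finset.HasAntidiagonal.antidiagonal n, T p
  map_add' S T := by ext n; simp [Finset.sum_add_distrib]
  map_smul' r T := by ext n; simp [Finset.mul_sum]

theorem powerSeriesMul_ctmul (R : Type*) [CommRing R] (f g : PowerSeries R) :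
    powerSeriesMul R (ctmul R f g) = f * g := by
  ext n
  simp [powerSeriesMul, PowerSeries.coeff_mul, ctmul, LCModule.coordinates, LCModule.coord]

section Combinatorial

variable {R : Type*} [CommRing R] {I J : Type*}
  {B : Type*} [AddCommGroup B] [Module R B] [LCModule R I B]
  {B' : Type*} [AddCommGroup B'] [Module R B'] [LCModule R J B']

/-- `ζ` is a continuous algebra morphism `B → R⟦t⟧` with `ζ(·)|_{t=0} = ε`. -/
structure LCHopfData.IsCharacter (H : LCHopfData R I B) (ζ : B →ₗ[R] PowerSeries R) : Prop where
  continuous : LCContinuous ζ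
  map_mul : ζ ∘ₗ H.mul = powerSeriesMul R ∘ₗ cmap ζ ζ
  map_unit : ∀ r, ζ (H.unit r) = algebraMap R (PowerSeries R) r
  constantCoeff : ∀ b, PowerSeries.constantCoeff (ζ b) = H.counit b

/-- The convolution product `ζ * ζ' = ∇ ∘ (ζ ⊗̂ ζ') ∘ Δ`. -/
noncomputable def LCHopfData.convolution (H : LCHopfData R I B) (ζ ζ' : B →ₗ[R] PowerSeries R) :
    B →ₗ[R] PowerSeries R :=
  powerSeriesMul R ∘ₗ cmap ζ ζ' ∘ₗ H.comul

/-- `(B, ζ)` is a combinatorial LC-Hopf algebra. -/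
def IsCombinatorialLCHopfAlgebra (H : LCHopfData R I B) (ζ : B →ₗ[R] PowerSeries R) : Prop :=
  H.IsLCHopfAlgebra ∧ H.IsCharacter ζ

/-- `φ` is a morphism `(B, ζ) → (B', ζ')` of combinatorial LC-Hopf algebras: a continuous linear map
commuting with (co)products and (co)units such that `ζ = ζ' ∘ φ`. -/
structure IsCombinatorialLCHopfMorphism (H : LCHopfData R I B) (ζ : B →ₗ[R] PowerSeries R)
    (H' : LCHopfData R J B') (ζ' : B' →ₗ[R] PowerSeries R) (φ : B →ₗ[R] B') : Prop where
  continuous : LCContinuous φ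
  map_mul : φ ∘ₗ H.mul = H'.mul ∘ₗ cmap φ φ
  map_unit : φ ∘ₗ H.unit = H'.unit
  map_comul : H'.comul ∘ₗ φ = cmap φ φ ∘ₗ H.comul
  map_counit : H'.counit ∘ₗ φ = H.counit
  comp_zeta : ζ' ∘ₗ φ = ζ

end Combinatorial

/-! ### Quasisymmetric power series -/

/-- The exponent of the monomial `x_{i_1}^{a_1} ⋯ x_{i_k}^{a_k}`. -/
noncomputable def monomialExponent {k : ℕ} (a i : Fin k → ℕ+) : ℕ+ →₀ ℕ :=
  ∑ j, Finsupp.single (i j) (a j : ℕ)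

/-- A power series in `x_1, x_2, …` is quasisymmetric if, for all positive `a_1, …, a_k`, the
coefficients of `x_1^{a_1} ⋯ x_k^{a_k}` and `x_{i_1}^{a_1} ⋯ x_{i_k}^{a_k}` agree whenever
`i_1 < ⋯ < i_k`. -/
def IsQuasisymmetric {R : Type*} [CommRing R] (f : MvPowerSeries ℕ+ R) : Prop :=
  ∀ (k : ℕ) (a i : Fin k → ℕ+), StrictMono i →
    MvPowerSeries.coeff (monomialExponent a i) f =
      MvPowerSeries.coeff (monomialExponent a fun j => Nat.succPNat j) f

/-- The module of all quasisymmetric power series (of possibly unbounded degree). -/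
def MQSym (R : Type*) [CommRing R] : Submodule R (MvPowerSeries ℕ+ R) where
  carrier := {f | IsQuasisymmetric f}
  add_mem' hf hg k a i hi := by simp [hf k a i hi, hg k a i hi]
  zero_mem' k a i hi := by simp
  smul_mem' r f hf k a i hi := by simp [hf k a i hi]

/-- The exponent of `x_1^{α_1} ⋯ x_l^{α_l}`. A composition is a list of positive integers. -/
noncomputable def compositionExponent (α : List ℕ+) : ℕ+ →₀ ℕ :=
  monomialExponent α.get fun j => Nat.succPNat j

/-- The composition formed by the nonzero exponents of a monomial, in order. -/
noncomputable def pack {σ : Type*} [LinearOrder σ] (u : σ →₀ ℕ) : List ℕ+ :=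
  (u.support.sort (· ≤ ·)).map fun i => (u i).toPNat'

theorem pack_embDomain {σ τ : Type*} [LinearOrder σ] [LinearOrder τ] (i : σ ↪o τ) (u : σ →₀ ℕ) :
    pack (u.embDomain i.toEmbedding) = pack u := by
  have h : (u.embDomain i.toEmbedding).support.sort (· ≤ ·) =
      (u.support.sort (· ≤ ·)).map i := by
    have h1 : ((u.support.sort (· ≤ ·)).map i).toFinset =
        (u.embDomain i.toEmbedding).support := by
      ext x; simp [Finsupp.support_embDomain]
    rw [← h1, List.toFinset_sort]
    · rw [List.pairwise_map]
      exact (Finset.pairwise_sort _ _).imp fun h => i.monotone h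
    · exact (Finset.sort_nodup _ _).map i.injective
  rw [pack, h, List.map_map, pack]
  refine List.map_congr_left fun x _ => ?_
  have : (u.embDomain i.toEmbedding) (i x) = u x := Finsupp.embDomain_apply_self i.toEmbedding u x
  simp [this]

theorem monomialExponent_eq_embDomain {k : ℕ} (a i : Fin k → ℕ+) (hi : StrictMono i) :
    monomialExponent a i = (Finsupp.equivFunOnFinite.symm fun j => (a j : ℕ)).embDomain
      (OrderEmbedding.ofStrictMono i hi).toEmbedding := by
  rw [← Finsupp.univ_sum_single (Finsupp.equivFunOnFinite.symm fun j => (a j : ℕ))]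
  change _ = Finsupp.embDomain.addMonoidHom _ _
  rw [map_sum]
  refine Finset.sum_congr rfl fun j _ => ?_
  change _ = Finsupp.embDomain _ _
  rw [Finsupp.embDomain_single]
  rfl

theorem pack_monomialExponent {k : ℕ} (a i : Fin k → ℕ+) (hi : StrictMono i) :
    pack (monomialExponent a i) = List.ofFn a := by
  rw [monomialExponent_eq_embDomain a i hi, pack_embDomain, pack]
  have h : (Finsupp.equivFunOnFinite.symm fun j => (a j : ℕ)).support = Finset.univ := by
    ext j; simp
  rw [h, Fin.sort_univ]
  rw [List.ofFn_eq_map]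
  refine List.map_congr_left fun j _ => ?_
  apply PNat.eq
  simp

theorem strictMono_succPNat (k : ℕ) : StrictMono fun j : Fin k => Nat.succPNat j :=
  fun _ _ h => Nat.succPNat_strictMono h

theorem pack_compositionExponent (α : List ℕ+) : pack (compositionExponent α) = α := by
  rw [compositionExponent, pack_monomialExponent _ _ (strictMono_succPNat _), List.ofFn_get]

theorem exists_eq_monomialExponent (u : ℕ+ →₀ ℕ) :
    ∃ (k : ℕ) (a i : Fin k → ℕ+), StrictMono i ∧ u = monomialExponent a i := by
  let i := u.support.orderEmbOfFin rfl
  refine ⟨u.support.card, fun j => (u (i j)).toPNat', i, i.strictMono, ?_⟩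
  have h : ∀ j, ((u (i j)).toPNat' : ℕ) = u (i j) := fun j => by
    have h0 : u (i j) ≠ 0 := by
      have := u.support.orderEmbOfFin_mem rfl j
      exact Finsupp.mem_support_iff.1 this
    simp [Nat.pos_of_ne_zero h0]
  simp only [monomialExponent, h]
  conv_lhs => rw [← Finsupp.sum_single u]
  rw [Finsupp.sum]
  have h2 : u.support = Finset.univ.map i.toEmbedding := by
    simp [i]
  conv_lhs => rw [h2]
  rw [Finset.sum_map]
  rfl

theorem coeff_eq_of_mem_MQSym {R : Type*} [CommRing R] {f : MvPowerSeries ℕ+ R} (hf : f ∈ MQSym R)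
    (u : ℕ+ →₀ ℕ) :
    MvPowerSeries.coeff u f = MvPowerSeries.coeff (compositionExponent (pack u)) f := by
  obtain ⟨k, a, i, hi, rfl⟩ := exists_eq_monomialExponent u
  rw [pack_monomialExponent a i hi, hf k a i hi]
  have h := hf (List.ofFn a).length (List.ofFn a).get _ (strictMono_succPNat _)
  congr 2
  rw [compositionExponent, monomialExponent, monomialExponent]
  exact Fintype.sum_equiv (finCongr (List.length_ofFn (f := a)).symm) _ _ fun j => by simp

/-- A power series whose coefficients only depend on the packed exponents is quasisymmetric. -/
theorem mem_MQSym_of_pack {R : Type*} [CommRing R] {f : MvPowerSeries ℕ+ R} (g : List ℕ+ → R)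
    (hf : ∀ u, MvPowerSeries.coeff u f = g (pack u)) : f ∈ MQSym R := by
  intro k a i hi
  rw [hf, hf, pack_monomialExponent a i hi, pack_monomialExponent a _ (strictMono_succPNat k)]

/-- The linearly compact structure on quasisymmetric power series: the coordinate of `f` at a
composition `α` is its coefficient at `x_1^{α_1} ⋯ x_l^{α_l}`, so that the pseudobasis consists of
the monomial quasisymmetric functions. -/
noncomputable instance LCModule.mqsym (R : Type*) [CommRing R] :
    LCModule R (List ℕ+) (MQSym R) where
  coord :=
    { toFun := fun f α => MvPowerSeries.coeff (compositionExponent α) (f : MvPowerSeries ℕ+ R)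
      invFun := fun g => ⟨fun u => g (pack u), mem_MQSym_of_pack g fun _ => rfl⟩
      left_inv := fun f => by
        ext u
        exact (coeff_eq_of_mem_MQSym f.2 u).symm
      right_inv := fun g => by
        funext α
        change g (pack (compositionExponent α)) = g α
        rw [pack_compositionExponent]
      map_add' := fun f g => by funext n; simp
      map_smul' := fun r f => by funext n; simp }

open Classical in
/-- The monomial quasisymmetric function `M_α = ∑_{i_1 < ⋯ < i_l} x_{i_1}^{α_1} ⋯ x_{i_l}^{α_l}`. -/
noncomputable def monomialQSym (R : Type*) [CommRing R] (α : List ℕ+) : MvPowerSeries ℕ+ R :=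
  fun u => if ∃ i : Fin α.length → ℕ+, StrictMono i ∧ u = monomialExponent α.get i then 1 else 0

theorem pseudobasis_mqsym (R : Type*) [CommRing R] (α : List ℕ+) :
    (LCModule.pseudobasis R (MQSym R) α : MvPowerSeries ℕ+ R) = monomialQSym R α := by
  classical
  funext u
  have h : (LCModule.pseudobasis R (MQSym R) α : MvPowerSeries ℕ+ R) u =
      if pack u = α then 1 else 0 := by
    have h1 := LCModule.coordinates_pseudobasis (R := R) (B := MQSym R) α (pack u)
    refine Eq.trans ?_ (h1.trans (by congr))
    exact coeff_eq_of_mem_MQSym (LCModule.pseudobasis R (MQSym R) α).2 u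
  rw [h, monomialQSym]
  congr 1
  apply propext
  constructor
  · intro h
    obtain ⟨k, a, i, hi, rfl⟩ := exists_eq_monomialExponent u
    rw [pack_monomialExponent a i hi] at h
    subst h
    let e := finCongr (List.length_ofFn (f := a))
    refine ⟨fun j => i (e j), fun _ _ h => hi h, ?_⟩
    exact (Fintype.sum_equiv e _ _ fun j => by simp [e]; rfl).symm
  · rintro ⟨i, hi, rfl⟩
    rw [pack_monomialExponent _ i hi, List.ofFn_get]

/-- The product `M_α ⊗ M_β ↦ M_α M_β`, extended continuously: regard an element of the completed
tensor product as a power series in two alphabets and identify these. -/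
noncomputable def mqsymMul (R : Type*) [CommRing R] :
    CompletedTensor R (List ℕ+) (List ℕ+) →ₗ[R] MQSym R where
  toFun T := ⟨fun u => ∑ p ∈ Finset.HasAntidiagonal.antidiagonal u, T (pack p.1, pack p.2), by
    have key : ∀ {k : ℕ} (a i : Fin k → ℕ+), StrictMono i →
        ∑ p ∈ Finset.HasAntidiagonal.antidiagonal (monomialExponent a i), T (pack p.1, pack p.2) =
        ∑ p ∈ Finset.HasAntidiagonal.antidiagonal (Finsupp.equivFunOnFinite.symm fun j => (a j : ℕ)),
          T (pack p.1, pack p.2) := by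
      intro k a i hi
      rw [monomialExponent_eq_embDomain a i hi]
      symm
      refine Finset.sum_bij (fun p _ =>
        (p.1.embDomain (OrderEmbedding.ofStrictMono i hi).toEmbedding,
          p.2.embDomain (OrderEmbedding.ofStrictMono i hi).toEmbedding)) ?_ ?_ ?_ ?_
      · intro p hp
        rw [Finset.HasAntidiagonal.mem_antidiagonal] at hp ⊢
        rw [← hp, Finsupp.embDomain_add]
      · intro p _ q _ h
        simp only [Prod.mk.injEq] at h
        exact Prod.ext (Finsupp.embDomain_injective _ h.1) (Finsupp.embDomain_injective _ h.2)
      · intro q hq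
        rw [Finset.HasAntidiagonal.mem_antidiagonal] at hq
        have hr : ∀ v w : ℕ+ →₀ ℕ, v + w = (Finsupp.equivFunOnFinite.symm
            fun j => (a j : ℕ)).embDomain (OrderEmbedding.ofStrictMono i hi).toEmbedding →
            (v.support : Set ℕ+) ⊆ Set.range (OrderEmbedding.ofStrictMono i hi).toEmbedding := by
          intro v w h x hx
          by_contra hn
          have := DFunLike.congr_fun h x
          rw [Finsupp.embDomain_of_notMem_range _ _ _ hn, Finsupp.add_apply] at this
          simp only [Finset.mem_coe, Finsupp.mem_support_iff] at hx
          omega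
        have h1 := Finsupp.embDomain_comapDomain (hr q.1 q.2 hq)
        have h2 := Finsupp.embDomain_comapDomain (hr q.2 q.1 (by rw [add_comm]; exact hq))
        refine ⟨(q.1.comapDomain _ (Function.Embedding.injective _).injOn,
          q.2.comapDomain _ (Function.Embedding.injective _).injOn), ?_, Prod.ext h1 h2⟩
        rw [Finset.HasAntidiagonal.mem_antidiagonal]
        apply Finsupp.embDomain_injective (OrderEmbedding.ofStrictMono i hi).toEmbedding
        rw [Finsupp.embDomain_add, h1, h2, hq]
      · intro p _
        rw [pack_embDomain, pack_embDomain]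
    intro k a i hi
    exact (key a i hi).trans (key a _ (strictMono_succPNat k)).symm⟩
  map_add' S T := by
    ext u
    exact Finset.sum_add_distrib ..
  map_smul' r T := by
    ext u
    exact (Finset.mul_sum _ _ _).symm

/-- On pure tensors, the product is the multiplication of power series. -/
theorem mqsymMul_ctmul (R : Type*) [CommRing R] (f g : MQSym R) :
    (mqsymMul R (ctmul R f g) : MvPowerSeries ℕ+ R) = f * g := by
  ext u
  rw [MvPowerSeries.coeff_mul]
  refine Finset.sum_congr rfl fun p _ => ?_
  rw [coeff_eq_of_mem_MQSym f.2 p.1, coeff_eq_of_mem_MQSym g.2 p.2]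
  rfl

/-- The constant power series `1 = M_∅`. -/
theorem one_mem_MQSym (R : Type*) [CommRing R] : (1 : MvPowerSeries ℕ+ R) ∈ MQSym R := by
  classical
  refine mem_MQSym_of_pack (fun α => if α = [] then 1 else 0) fun u => ?_
  rw [MvPowerSeries.coeff_one]
  congr 1
  rw [pack, List.map_eq_nil_iff]
  apply propext
  constructor
  · rintro rfl; simp
  · intro h
    have := congrArg List.length h
    simpa using this

/-- The Hopf structure maps on quasisymmetric power series: multiplication of power series, the unit
`1`, the deconcatenation coproduct `Δ(M_α) = ∑_{α = α'α''} M_{α'} ⊗ M_{α''}`, and the counit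
`M_∅ ↦ 1`, `M_α ↦ 0` for `α ≠ ∅`. -/
noncomputable def mqsymHopf (R : Type*) [CommRing R] : LCHopfData R (List ℕ+) (MQSym R) where
  mul := mqsymMul R
  unit := LinearMap.toSpanSingleton R (MQSym R) ⟨1, one_mem_MQSym R⟩
  comul :=
    { toFun := fun f p => LCModule.coordinates R f (p.1 ++ p.2)
      map_add' := fun f g => by funext p; simp
      map_smul' := fun r f => by funext p; simp }
  counit :=
    { toFun := fun f => LCModule.coordinates R f []
      map_add' := fun f g => by simp
      map_smul' := fun r f => by simp }

/-- The universal zeta function `f ↦ f(t, 0, 0, …)`. -/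
noncomputable def zetaQ (R : Type*) [CommRing R] : MQSym R →ₗ[R] PowerSeries R where
  toFun f := PowerSeries.mk fun n =>
    MvPowerSeries.coeff (Finsupp.single 1 n) (f : MvPowerSeries ℕ+ R)
  map_add' f g := by ext n; simp
  map_smul' r f := by ext n; simp


/-! ### Labeled posets with marked valleys -/

/-- The ring of scalars `ℤ[β]`. -/
abbrev Zbeta : Type := Polynomial ℤ

/-- The indeterminate `β`. -/
noncomputable def beta : Zbeta := Polynomial.X

/-- The valleys of a labeled poset. -/
def valleys {P : Type*} [PartialOrder P] (γ : P → ℤ) : Set P :=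
  {v | (∀ x, x ⋖ v → γ v < γ x) ∧ ∀ y, v ⋖ y → γ v < γ y}

/-- A triple `(P, γ, V)` consisting of a finite poset `P`, an injective labeling `γ` of `P` and a
set `V` of valleys of `(P, γ)`. -/
structure MarkedPoset where
  carrier : Type
  [order : PartialOrder carrier]
  [finite : Finite carrier]
  label : carrier → ℤ
  label_injective : Function.Injective label
  marked : Set carrier
  marked_subset : marked ⊆ valleys label

attribute [instance] MarkedPoset.order MarkedPoset.finite

namespace MarkedPoset

/-- An isomorphism of triples: a poset isomorphism `φ` such that `γ` and `δ ∘ φ` are equivalent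
labelings (they have the same descents along covering relations) and which takes `V` to `V'`. -/
def IsIso (X Y : MarkedPoset) (φ : X.carrier ≃o Y.carrier) : Prop :=
  (∀ s t, s ⋖ t → (X.label s > X.label t ↔ Y.label (φ s) > Y.label (φ t))) ∧
    φ '' X.marked = Y.marked

theorem IsIso.symm {X Y : MarkedPoset} {φ : X.carrier ≃o Y.carrier} (h : IsIso X Y φ) :
    IsIso Y X φ.symm := by
  refine ⟨fun s t hst => ?_, ?_⟩
  · have h1 : φ.symm s ⋖ φ.symm t := (apply_covBy_apply_iff φ.symm).2 hst
    simpa using (h.1 _ _ h1).symm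
  · rw [← h.2, ← Set.image_comp]
    simp

theorem IsIso.trans {X Y Z : MarkedPoset} {φ : X.carrier ≃o Y.carrier} {ψ : Y.carrier ≃o Z.carrier}
    (h : IsIso X Y φ) (h' : IsIso Y Z ψ) : IsIso X Z (φ.trans ψ) := by
  refine ⟨fun s t hst => ?_, ?_⟩
  · exact (h.1 s t hst).trans (h'.1 _ _ ((apply_covBy_apply_iff φ).2 hst))
  · rw [← h'.2, ← h.2, ← Set.image_comp]
    rfl

/-- Isomorphism of triples. -/
instance setoid : Setoid MarkedPoset where
  r X Y := ∃ φ, IsIso X Y φ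
  iseqv :=
    { refl := fun X => ⟨OrderIso.refl _, fun _ _ _ => Iff.rfl, by simp⟩
      symm := fun ⟨φ, h⟩ => ⟨φ.symm, h.symm⟩
      trans := fun ⟨φ, h⟩ ⟨ψ, h'⟩ => ⟨φ.trans ψ, h.trans h'⟩ }

/-- The isomorphism class `[(P, γ, V)]`. -/
def cls (X : MarkedPoset) : Quotient setoid := Quotient.mk setoid X

/-- The empty triple. -/
def empty : MarkedPoset where
  carrier := Empty
  label := fun x => x.elim
  label_injective := fun x => x.elim
  marked := ∅
  marked_subset := Set.empty_subset _

theorem sum_covBy_inl {P Q : Type*} [PartialOrder P] [PartialOrder Q] {a b : P} :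
    (Sum.inl a : P ⊕ Q) ⋖ Sum.inl b ↔ a ⋖ b := by
  constructor
  · intro h
    exact ⟨Sum.inl_lt_inl_iff.1 h.1, fun c h1 h2 =>
      h.2 (Sum.inl_lt_inl_iff.2 h1) (Sum.inl_lt_inl_iff.2 h2)⟩
  · intro h
    refine ⟨Sum.inl_lt_inl_iff.2 h.1, ?_⟩
    rintro (c | c) h1 h2
    · exact h.2 (Sum.inl_lt_inl_iff.1 h1) (Sum.inl_lt_inl_iff.1 h2)
    · exact Sum.not_inl_lt_inr h1

theorem sum_covBy_inr {P Q : Type*} [PartialOrder P] [PartialOrder Q] {a b : Q} :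
    (Sum.inr a : P ⊕ Q) ⋖ Sum.inr b ↔ a ⋖ b := by
  constructor
  · intro h
    exact ⟨Sum.inr_lt_inr_iff.1 h.1, fun c h1 h2 =>
      h.2 (Sum.inr_lt_inr_iff.2 h1) (Sum.inr_lt_inr_iff.2 h2)⟩
  · intro h
    refine ⟨Sum.inr_lt_inr_iff.2 h.1, ?_⟩
    rintro (c | c) h1 h2
    · exact Sum.not_inr_lt_inl h1
    · exact h.2 (Sum.inr_lt_inr_iff.1 h1) (Sum.inr_lt_inr_iff.1 h2)

/-- The labeling `γ ⊔ δ` of a disjoint union: `γ - max γ` on `P` and `δ - min δ + 1` on `Q`. -/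
noncomputable def sumLabel {P Q : Type*} (γ : P → ℤ) (δ : Q → ℤ) : P ⊕ Q → ℤ :=
  Sum.elim (fun s => γ s - ⨆ x, γ x) fun s => δ s - (⨅ x, δ x) + 1

/-- The disjoint union of triples. -/
noncomputable def union (X Y : MarkedPoset) : MarkedPoset where
  carrier := X.carrier ⊕ Y.carrier
  label := sumLabel X.label Y.label
  label_injective := by
    have h1 : ∀ s, X.label s ≤ ⨆ x, X.label x := fun s =>
      le_ciSup (Set.finite_range X.label).bddAbove s
    have h2 : ∀ s, ⨅ x, Y.label x ≤ Y.label s := fun s =>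
      ciInf_le (Set.finite_range Y.label).bddBelow s
    rintro (a | a) (b | b) h <;> simp only [sumLabel, Sum.elim_inl, Sum.elim_inr] at h
    · rw [X.label_injective (by linarith : X.label a = X.label b)]
    · linarith [h1 a, h2 b]
    · linarith [h1 b, h2 a]
    · rw [Y.label_injective (by linarith : Y.label a = Y.label b)]
  marked := Sum.inl '' X.marked ∪ Sum.inr '' Y.marked
  marked_subset := by
    rintro _ (⟨v, hv, rfl⟩ | ⟨v, hv, rfl⟩)
    · refine ⟨?_, ?_⟩
      · rintro (x | x) hx
        · have := (X.marked_subset hv).1 x (sum_covBy_inl.1 hx)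
          simpa [sumLabel] using this
        · exact (Sum.not_inr_lt_inl hx.1).elim
      · rintro (x | x) hx
        · have := (X.marked_subset hv).2 x (sum_covBy_inl.1 hx)
          simpa [sumLabel] using this
        · exact (Sum.not_inl_lt_inr hx.1).elim
    · refine ⟨?_, ?_⟩
      · rintro (x | x) hx
        · exact (Sum.not_inl_lt_inr hx.1).elim
        · have := (Y.marked_subset hv).1 x (sum_covBy_inr.1 hx)
          simpa [sumLabel] using this
      · rintro (x | x) hx
        · exact (Sum.not_inr_lt_inl hx.1).elim
        · have := (Y.marked_subset hv).2 x (sum_covBy_inr.1 hx)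
          simpa [sumLabel] using this

theorem image_sumMap {P Q P' Q' : Type*} (f : P → P') (g : Q → Q') (S : Set P) (T : Set Q) :
    Sum.map f g '' (Sum.inl '' S ∪ Sum.inr '' T) =
      Sum.inl '' (f '' S) ∪ Sum.inr '' (g '' T) := by
  simp [Set.image_union, Set.image_image]

theorem union_congr {X X' Y Y' : MarkedPoset} (hX : X ≈ X') (hY : Y ≈ Y') :
    X.union Y ≈ X'.union Y' := by
  obtain ⟨φ, h⟩ := hX
  obtain ⟨ψ, h'⟩ := hY
  let e : (X.union Y).carrier ≃o (X'.union Y').carrier := OrderIso.sumCongr φ ψ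
  refine ⟨e, ?_, ?_⟩
  · rintro (a | a) (b | b) hab
    · have := h.1 a b (sum_covBy_inl.1 hab)
      change sumLabel X.label Y.label (Sum.inl a) > sumLabel X.label Y.label (Sum.inl b) ↔
        sumLabel X'.label Y'.label (Sum.inl (φ a)) > sumLabel X'.label Y'.label (Sum.inl (φ b))
      simpa [sumLabel] using this
    · exact (Sum.not_inl_lt_inr hab.1).elim
    · exact (Sum.not_inr_lt_inl hab.1).elim
    · have := h'.1 a b (sum_covBy_inr.1 hab)
      change sumLabel X.label Y.label (Sum.inr a) > sumLabel X.label Y.label (Sum.inr b) ↔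
        sumLabel X'.label Y'.label (Sum.inr (ψ a)) > sumLabel X'.label Y'.label (Sum.inr (ψ b))
      simpa [sumLabel] using this
  · change e '' (Sum.inl '' X.marked ∪ Sum.inr '' Y.marked) =
      Sum.inl '' X'.marked ∪ Sum.inr '' Y'.marked
    rw [← h.2, ← h'.2]
    exact image_sumMap φ ψ _ _

theorem covBy_coe_iff {P : Type*} [PartialOrder P] {S : Set P} (hS : S.OrdConnected) {a b : S} :
    (a : P) ⋖ b ↔ a ⋖ b :=
  Set.OrdConnected.apply_covBy_apply_iff (OrderEmbedding.subtype (· ∈ S))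
    (by simpa using hS)

/-- The triple `(S, γ|_S, V ∩ S)` for a convex subset `S` of `P` (convexity ensures that the elements
of `V ∩ S` are valleys of `S`). -/
def restrict (X : MarkedPoset) (S : Set X.carrier) (hS : S.OrdConnected) : MarkedPoset where
  carrier := S
  label := fun s => X.label s
  label_injective := fun _ _ h => Subtype.ext (X.label_injective h)
  marked := {s | (s : X.carrier) ∈ X.marked}
  marked_subset := fun _ hv =>
    ⟨fun _ hx => (X.marked_subset hv).1 _ ((covBy_coe_iff hS).2 hx),
      fun _ hy => (X.marked_subset hv).2 _ ((covBy_coe_iff hS).2 hy)⟩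

theorem restrict_congr {X Y : MarkedPoset} {φ : X.carrier ≃o Y.carrier} (h : IsIso X Y φ)
    (S : Set X.carrier) (hS : S.OrdConnected) (S' : Set Y.carrier) (hS' : S'.OrdConnected)
    (hSS' : S' = φ '' S) : X.restrict S hS ≈ Y.restrict S' hS' := by
  subst hSS'
  let e : S ≃o φ '' S :=
    { toEquiv := φ.toEquiv.image S
      map_rel_iff' := φ.map_rel_iff' }
  refine ⟨e, fun s t hst => h.1 _ _ ((covBy_coe_iff hS).2 hst), ?_⟩
  ext ⟨y, s, hs, rfl⟩
  constructor
  · rintro ⟨⟨z, hz⟩, hzm, hzy⟩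
    have hzs : φ z = φ s := congrArg Subtype.val hzy
    change φ s ∈ Y.marked
    rw [← hzs, ← h.2]
    exact ⟨z, hzm, rfl⟩
  · intro hy
    change φ s ∈ Y.marked at hy
    rw [← h.2] at hy
    obtain ⟨z, hz, hzs⟩ := hy
    rw [φ.injective hzs] at hz
    exact ⟨⟨s, hs⟩, hz, rfl⟩

/-- The pairs `(S, T)` indexing the coproduct: `S` is a lower set, `T` is an upper set,
`P = S ∪ T`, and `S ∩ T` is an antichain. -/
structure IsSplitting {P : Type*} [PartialOrder P] (S T : Set P) : Prop where
  lower : IsLowerSet S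
  upper : IsUpperSet T
  union_eq : S ∪ T = Set.univ
  antichain : IsAntichain (· ≤ ·) (S ∩ T)

theorem IsSplitting.image {P Q : Type*} [PartialOrder P] [PartialOrder Q] (φ : P ≃o Q)
    {S T : Set P} (h : IsSplitting S T) : IsSplitting (φ '' S) (φ '' T) where
  lower := h.lower.image φ
  upper := h.upper.image φ
  union_eq := by rw [← Set.image_union, h.union_eq, Set.image_univ_of_surjective φ.surjective]
  antichain := by
    rw [← Set.image_inter φ.injective]
    exact h.antichain.image φ fun _ _ h => φ.le_iff_le.1 h

/-- The value `∑ β^{|S ∩ T|} [(S, γ, V ∩ S)] ⊗ [(T, γ, V ∩ T)]` of the coproduct at `[(P, γ, V)]`. -/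
noncomputable def coproduct (X : MarkedPoset) :
    CompletedTensor Zbeta (Quotient setoid) (Quotient setoid) :=
  ∑ᶠ p : {p : Set X.carrier × Set X.carrier // IsSplitting p.1 p.2},
    beta ^ (p.1.1 ∩ p.1.2).ncard • ctmul Zbeta
      (LCModule.pseudobasis Zbeta (Quotient setoid → Zbeta)
        (X.restrict p.1.1 p.2.lower.ordConnected).cls)
      (LCModule.pseudobasis Zbeta (Quotient setoid → Zbeta)
        (X.restrict p.1.2 p.2.upper.ordConnected).cls)

theorem coproduct_congr {X Y : MarkedPoset} (h : X ≈ Y) : X.coproduct = Y.coproduct := by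
  classical
  obtain ⟨φ, h⟩ := h
  let e : {p : Set X.carrier × Set X.carrier // IsSplitting p.1 p.2} ≃
      {p : Set Y.carrier × Set Y.carrier // IsSplitting p.1 p.2} :=
    { toFun := fun p => ⟨(φ '' p.1.1, φ '' p.1.2), p.2.image φ⟩
      invFun := fun p => ⟨(φ.symm '' p.1.1, φ.symm '' p.1.2), p.2.image φ.symm⟩
      left_inv := fun p => by
        apply Subtype.ext; apply Prod.ext <;> simp [← Set.image_comp]
      right_inv := fun p => by
        apply Subtype.ext; apply Prod.ext <;> simp [← Set.image_comp] }
  refine finsum_eq_of_bijective e e.bijective fun p => ?_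
  have h1 := Quotient.sound (s := setoid) (restrict_congr h p.1.1 p.2.lower.ordConnected
    (e p).1.1 (e p).2.lower.ordConnected rfl)
  have h2 := Quotient.sound (s := setoid) (restrict_congr h p.1.2 p.2.upper.ordConnected
    (e p).1.2 (e p).2.upper.ordConnected rfl)
  have h3 : ((e p).1.1 ∩ (e p).1.2).ncard = (p.1.1 ∩ p.1.2).ncard := by
    change (φ '' p.1.1 ∩ φ '' p.1.2).ncard = _
    rw [← Set.image_inter φ.injective, Set.ncard_image_of_injective _ φ.injective]
  simp only [cls]
  rw [h1, h2, h3]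

theorem strictMono_iff_covBy (X : MarkedPoset) :
    StrictMono X.label ↔ ∀ s t, s ⋖ t → X.label s < X.label t := by
  classical
  have := Fintype.ofFinite X.carrier
  have : LocallyFiniteOrder X.carrier := Fintype.toLocallyFiniteOrder
  exact strictMono_iff_forall_covBy X.label

open Classical in
/-- The value of `ζ_<` at `[(P, γ, V)]`. -/
noncomputable def zetaLT (X : MarkedPoset) : PowerSeries Zbeta :=
  if ∀ s t, s < t → X.label s < X.label t then PowerSeries.X ^ Nat.card X.carrier else 0

open Classical in
/-- The value of `ζ̄_>` at `[(P, γ, V)]`. -/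
noncomputable def zetaGT (X : MarkedPoset) : PowerSeries Zbeta :=
  if X.marked = ∅ ∧ ∀ s t, s ⋖ t → X.label s > X.label t then PowerSeries.X ^ Nat.card X.carrier
  else 0

theorem card_congr {X Y : MarkedPoset} (h : X ≈ Y) : Nat.card X.carrier = Nat.card Y.carrier :=
  Nat.card_congr h.choose.toEquiv

theorem IsIso.label_lt_iff {X Y : MarkedPoset} {φ : X.carrier ≃o Y.carrier} (h : IsIso X Y φ)
    {s t : X.carrier} (hst : s ⋖ t) :
    X.label s < X.label t ↔ Y.label (φ s) < Y.label (φ t) := by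
  have h1 : X.label s ≠ X.label t := fun h => hst.1.ne (X.label_injective h)
  have h2 : Y.label (φ s) ≠ Y.label (φ t) := fun h =>
    hst.1.ne (φ.injective (Y.label_injective h))
  have := h.1 s t hst
  omega

theorem zetaLT_congr {X Y : MarkedPoset} (h : X ≈ Y) : X.zetaLT = Y.zetaLT := by
  have key : ∀ {X Y : MarkedPoset}, X ≈ Y → (∀ s t, s < t → X.label s < X.label t) →
      ∀ s t, s < t → Y.label s < Y.label t := by
    intro X Y ⟨φ, h⟩ hX
    have := (strictMono_iff_covBy Y).2 fun s t hst => by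
      have h1 : φ.symm s ⋖ φ.symm t := (apply_covBy_apply_iff φ.symm).2 hst
      simpa using (h.label_lt_iff h1).1 (hX _ _ h1.1)
    exact fun s t hst => this hst
  have h1 : (∀ s t, s < t → X.label s < X.label t) ↔ ∀ s t, s < t → Y.label s < Y.label t :=
    ⟨key h, key (Setoid.symm h)⟩
  rw [zetaLT, zetaLT, card_congr h]
  congr 1
  exact propext h1

theorem zetaGT_congr {X Y : MarkedPoset} (h : X ≈ Y) : X.zetaGT = Y.zetaGT := by
  have key : ∀ {X Y : MarkedPoset}, X ≈ Y →
      (X.marked = ∅ ∧ ∀ s t, s ⋖ t → X.label s > X.label t) →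
      (Y.marked = ∅ ∧ ∀ s t, s ⋖ t → Y.label s > Y.label t) := by
    intro X Y ⟨φ, h⟩ hX
    refine ⟨by rw [← h.2, hX.1, Set.image_empty], fun s t hst => ?_⟩
    have h1 : φ.symm s ⋖ φ.symm t := (apply_covBy_apply_iff φ.symm).2 hst
    simpa using (h.1 _ _ h1).1 (hX.2 _ _ h1)
  have h1 := Iff.intro (key h) (key (Setoid.symm h))
  rw [zetaGT, zetaGT, card_congr h]
  congr 1
  exact propext h1

end MarkedPoset

/-- The isomorphism classes of triples `(P, γ, V)`. -/
abbrev MarkedPosetClass : Type 1 := Quotient MarkedPoset.setoid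

namespace MarkedPosetClass

/-- The number of elements of a poset in the class. -/
noncomputable def size : MarkedPosetClass → ℕ :=
  Quotient.lift (fun X => Nat.card X.carrier) fun _ _ h => MarkedPoset.card_congr h

/-- Disjoint union of classes. -/
noncomputable def union (c d : MarkedPosetClass) : MarkedPosetClass :=
  Quotient.liftOn₂ c d (fun X Y => (X.union Y).cls) fun _ _ _ _ h h' =>
    Quotient.sound (MarkedPoset.union_congr h h')

/-- The coproduct on classes. -/
noncomputable def coproduct (c : MarkedPosetClass) :
    CompletedTensor Zbeta MarkedPosetClass MarkedPosetClass :=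
  Quotient.lift MarkedPoset.coproduct (fun _ _ h => MarkedPoset.coproduct_congr h) c

/-- The values of `ζ_<` on classes. -/
noncomputable def zetaLT (c : MarkedPosetClass) : PowerSeries Zbeta :=
  Quotient.lift MarkedPoset.zetaLT (fun _ _ h => MarkedPoset.zetaLT_congr h) c

/-- The values of `ζ̄_>` on classes. -/
noncomputable def zetaGT (c : MarkedPosetClass) : PowerSeries Zbeta :=
  Quotient.lift MarkedPoset.zetaGT (fun _ _ h => MarkedPoset.zetaGT_congr h) c

/-- There are only finitely many classes of a given size. -/
theorem finite_size_eq (n : ℕ) : {c : MarkedPosetClass | c.size = n}.Finite := by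
  have hrep : ∀ c : {c : MarkedPosetClass // c.size = n},
      ∃ (X : MarkedPoset) (_ : Fin n ≃ X.carrier), X.cls = c.1 := by
    rintro ⟨c, hc⟩
    obtain ⟨X, rfl⟩ := Quotient.exists_rep c
    exact ⟨X, (Finite.equivFinOfCardEq hc).symm, rfl⟩
  choose X e hX using hrep
  let F : {c : MarkedPosetClass // c.size = n} →
      (Set (Fin n × Fin n)) × (Set (Fin n × Fin n)) × Set (Fin n) := fun c =>
    ({p | e c p.1 ≤ e c p.2}, {p | (X c).label (e c p.1) > (X c).label (e c p.2)},
      {i | e c i ∈ (X c).marked})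
  have hF : Function.Injective F := by
    intro c d hcd
    simp only [F, Prod.mk.injEq, Set.ext_iff, Set.mem_ofPred_eq, Prod.forall] at hcd
    obtain ⟨h1, h2, h3⟩ := hcd
    let φ : (X c).carrier ≃o (X d).carrier :=
      { toEquiv := (e c).symm.trans (e d)
        map_rel_iff' := fun {a b} => by
          have := h1 ((e c).symm a) ((e c).symm b)
          simpa using this.symm }
    have hφ : MarkedPoset.IsIso (X c) (X d) φ := by
      refine ⟨fun s t _ => ?_, ?_⟩
      · have := h2 ((e c).symm s) ((e c).symm t)
        simp only [Equiv.apply_symm_apply] at this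
        exact this
      · ext y
        have := h3 ((e d).symm y)
        rw [Equiv.apply_symm_apply] at this
        rw [← this]
        constructor
        · rintro ⟨x, hx, rfl⟩
          simpa [φ] using hx
        · intro hy
          exact ⟨_, hy, by simp [φ]⟩
    apply Subtype.ext
    rw [← hX c, ← hX d]
    exact Quotient.sound ⟨φ, hφ⟩
  exact Set.finite_coe_iff.1 (Finite.of_injective F hF)

theorem finite_size_le (n : ℕ) : {c : MarkedPosetClass | c.size ≤ n}.Finite := by
  have : {c : MarkedPosetClass | c.size ≤ n} = ⋃ k ∈ Finset.range (n + 1), {c | c.size = k} := by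
    ext c; simp
  rw [this]
  exact Set.Finite.biUnion (Finset.finite_toSet _) fun k _ => finite_size_eq k

theorem size_union (c d : MarkedPosetClass) : (c.union d).size = c.size + d.size := by
  induction c using Quotient.inductionOn with | _ X
  induction d using Quotient.inductionOn with | _ Y
  exact Nat.card_sum

theorem size_le_of_coproduct_ne_zero {c p q : MarkedPosetClass} (h : c.coproduct (p, q) ≠ 0) :
    c.size ≤ p.size + q.size := by
  classical
  induction c using Quotient.inductionOn with | _ X
  change X.coproduct (p, q) ≠ 0 at h
  have := Fintype.ofFinite {p : Set X.carrier × Set X.carrier // MarkedPoset.IsSplitting p.1 p.2}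
  rw [MarkedPoset.coproduct, finsum_eq_sum_of_fintype, Finset.sum_apply] at h
  obtain ⟨s, -, hs⟩ := Finset.exists_ne_zero_of_sum_ne_zero h
  rw [Pi.smul_apply, ctmul, LCModule.coordinates_pseudobasis, LCModule.coordinates_pseudobasis] at hs
  split_ifs at hs with h1 h2
  · change p = _ at h1
    change q = _ at h2
    rw [h1, h2]
    change Nat.card X.carrier ≤ Nat.card s.1.1 + Nat.card s.1.2
    have := Set.ncard_union_le s.1.1 s.1.2
    rw [s.2.union_eq, Set.ncard_univ] at this
    exact this
  all_goals simp at hs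

theorem size_eq_of_zetaLT_ne_zero {c : MarkedPosetClass} {n : ℕ}
    (h : PowerSeries.coeff n c.zetaLT ≠ 0) : c.size = n := by
  induction c using Quotient.inductionOn with | _ X
  change PowerSeries.coeff n X.zetaLT ≠ 0 at h
  rw [MarkedPoset.zetaLT] at h
  split_ifs at h
  · rw [PowerSeries.coeff_X_pow] at h
    by_contra hn
    exact h (if_neg fun h => hn h.symm)
  · simp at h

theorem size_eq_of_zetaGT_ne_zero {c : MarkedPosetClass} {n : ℕ}
    (h : PowerSeries.coeff n c.zetaGT ≠ 0) : c.size = n := by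
  induction c using Quotient.inductionOn with | _ X
  change PowerSeries.coeff n X.zetaGT ≠ 0 at h
  rw [MarkedPoset.zetaGT] at h
  split_ifs at h
  · rw [PowerSeries.coeff_X_pow] at h
    by_contra hn
    exact h (if_neg fun h => hn h.symm)
  · simp at h

end MarkedPosetClass

/-- The linearly compact `ℤ[β]`-module with pseudobasis the isomorphism classes `[(P, γ, V)]`. -/
abbrev MLPosetPlus : Type 1 := MarkedPosetClass → Zbeta

/-- The Hopf structure maps on `MLPosetPlus`, the continuous linear maps with the given values on
isomorphism classes. -/
noncomputable def mlposetHopf : LCHopfData Zbeta MarkedPosetClass MLPosetPlus where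
  mul := lcExtend (fun p : MarkedPosetClass × MarkedPosetClass =>
      LCModule.pseudobasis Zbeta MLPosetPlus (p.1.union p.2)) <| by
    intro r
    refine ((MarkedPosetClass.finite_size_le r.size).prod
      (MarkedPosetClass.finite_size_le r.size)).subset fun p hp => ?_
    have h : r = p.1.union p.2 := by
      by_contra h
      exact hp ((LCModule.coordinates_pseudobasis _ r).trans (if_neg h))
    have h1 := MarkedPosetClass.size_union p.1 p.2
    rw [← h] at h1
    exact ⟨by simp only [Set.mem_ofPred_eq]; omega, by simp only [Set.mem_ofPred_eq]; omega⟩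
  unit := LinearMap.toSpanSingleton Zbeta MLPosetPlus
    (LCModule.pseudobasis Zbeta MLPosetPlus MarkedPoset.empty.cls)
  comul := lcExtend MarkedPosetClass.coproduct <| by
    rintro ⟨p, q⟩
    exact (MarkedPosetClass.finite_size_le (p.size + q.size)).subset fun c hc =>
      MarkedPosetClass.size_le_of_coproduct_ne_zero hc
  counit := LinearMap.proj MarkedPoset.empty.cls

/-- `ζ_<`. -/
noncomputable def zetaLess : MLPosetPlus →ₗ[Zbeta] PowerSeries Zbeta :=
  lcExtend MarkedPosetClass.zetaLT fun n =>
    (MarkedPosetClass.finite_size_eq n).subset fun _ hc =>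
      MarkedPosetClass.size_eq_of_zetaLT_ne_zero hc

/-- `ζ̄_>`. -/
noncomputable def zetaGreaterBar : MLPosetPlus →ₗ[Zbeta] PowerSeries Zbeta :=
  lcExtend MarkedPosetClass.zetaGT fun n =>
    (MarkedPosetClass.finite_size_eq n).subset fun _ hc =>
      MarkedPosetClass.size_eq_of_zetaGT_ne_zero hc

/-- `ζ_{>|<} = ζ̄_> * ζ_<`. -/
noncomputable def zetaGreaterLess : MLPosetPlus →ₗ[Zbeta] PowerSeries Zbeta :=
  mlposetHopf.convolution zetaGreaterBar zetaLess

/-! ### Enriched set-valued `P`-partitions -/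

/-- The marked alphabet `1' < 1 < 2' < 2 < ⋯`; the letter `i'` is `(i, false)` and the letter `i` is
`(i, true)`. -/
abbrev MarkedLetter : Type := ℕ+ ×ₗ Bool

/-- `|i'| = |i| = i`. -/
def MarkedLetter.abs (m : MarkedLetter) : ℕ+ := (ofLex m).1

/-- The letter is one of `1, 2, 3, …`. -/
def MarkedLetter.IsUnprimed (m : MarkedLetter) : Prop := (ofLex m).2 = true

/-- `σ` is an element of `ℰ(P, γ, V)`: an enriched set-valued `(P, γ)`-partition such that
`σ(v) ⊆ {1, 2, 3, …}` for all `v ∈ V`. -/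
structure IsEnrichedPartition {P : Type*} [PartialOrder P] (γ : P → ℤ) (V : Set P)
    (σ : P → Finset MarkedLetter) : Prop where
  nonempty : ∀ s, (σ s).Nonempty
  /-- `max σ(s) ≤ min σ(t)` -/
  le : ∀ s t, s ⋖ t → ∀ a ∈ σ s, ∀ b ∈ σ t, a ≤ b
  unprimed : ∀ s t, s ⋖ t → γ s < γ t → ∀ a ∈ σ s ∩ σ t, a.IsUnprimed
  primed : ∀ s t, s ⋖ t → γ s > γ t → ∀ a ∈ σ s ∩ σ t, ¬ a.IsUnprimed
  marked : ∀ v ∈ V, ∀ a ∈ σ v, a.IsUnprimed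

/-- The exponent of the monomial `x^σ = ∏_{s ∈ P} ∏_{i ∈ σ(s)} x_{|i|}`. -/
noncomputable def partitionWeight {P : Type*} [Fintype P] (σ : P → Finset MarkedLetter) : ℕ+ →₀ ℕ :=
  ∑ s, ∑ m ∈ σ s, Finsupp.single m.abs 1

/-- The enriched set-valued weight enumerator
`Ω^{(β)}(P, γ, V) = ∑_{σ ∈ ℰ(P, γ, V)} β^{|σ| - |P|} x^σ`, where `|σ| = ∑_{s ∈ P} |σ(s)| ≥ |P|`. -/
noncomputable def enrichedEnumerator {P : Type*} [PartialOrder P] [Fintype P] (γ : P → ℤ)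
    (V : Set P) : MvPowerSeries ℕ+ Zbeta :=
  fun u => ∑ᶠ (σ : P → Finset MarkedLetter)
    (_ : IsEnrichedPartition γ V σ ∧ partitionWeight σ = u),
      beta ^ (∑ s, (σ s).card - Fintype.card P)

/-- Each monomial is the weight of only finitely many `σ`. -/
theorem finite_partitionWeight_eq {P : Type*} [Fintype P] (u : ℕ+ →₀ ℕ) :
    {σ : P → Finset MarkedLetter | partitionWeight σ = u}.Finite := by
  classical
  let S : Finset MarkedLetter :=
    (u.support ×ˢ (Finset.univ : Finset Bool)).map (toLex (α := ℕ+ × Bool)).toEmbedding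
  refine (Set.Finite.pi' fun _ : P => S.powerset.finite_toSet).subset ?_
  rintro σ rfl s
  simp only [Finset.mem_coe, Finset.mem_powerset]
  intro m hm
  have hm' : (ofLex m).1 ∈ (partitionWeight σ).support := by
    rw [Finsupp.mem_support_iff, partitionWeight, Finsupp.finsetSum_apply]
    have h1 : (∑ m ∈ σ s, Finsupp.single m.abs 1 : ℕ+ →₀ ℕ) (ofLex m).1 ≠ 0 := by
      rw [Finsupp.finsetSum_apply]
      have := Finset.single_le_sum (f := fun m' : MarkedLetter =>
        (Finsupp.single m'.abs 1 : ℕ+ →₀ ℕ) (ofLex m).1) (fun _ _ => Nat.zero_le _) hm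
      simp only [MarkedLetter.abs, Finsupp.single_eq_same] at this
      exact (Nat.lt_of_lt_of_le Nat.zero_lt_one this).ne'
    have := Finset.single_le_sum (f := fun s =>
      (∑ m ∈ σ s, Finsupp.single m.abs 1 : ℕ+ →₀ ℕ) (ofLex m).1) (fun _ _ => Nat.zero_le _)
      (Finset.mem_univ s)
    exact (Nat.lt_of_lt_of_le (Nat.pos_of_ne_zero h1) this).ne'
  simp only [S, Finset.mem_map, Finset.mem_product, Finset.mem_univ, and_true]
  exact ⟨ofLex m, hm', rfl⟩

/-- The pseudobasis element `[(P, γ, V)]`. -/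
noncomputable def posetClass {P : Type} [PartialOrder P] [Finite P] (γ : P → ℤ)
    (hγ : Function.Injective γ) (V : Set P) (hV : V ⊆ valleys γ) : MLPosetPlus :=
  LCModule.pseudobasis Zbeta MLPosetPlus (MarkedPoset.cls ⟨P, γ, hγ, V, hV⟩)

/-- The map `φ` takes `[(P, γ, V)]` to `Ω^{(β)}(P, γ, V)` for all `(P, γ, V)`. -/
def MapsToEnrichedEnumerator (φ : MLPosetPlus →ₗ[Zbeta] MQSym Zbeta) : Prop :=
  ∀ (P : Type) [PartialOrder P] [Fintype P] (γ : P → ℤ) (hγ : Function.Injective γ)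
    (V : Set P) (hV : V ⊆ valleys γ),
    (φ (posetClass γ hγ V hV) : MvPowerSeries ℕ+ Zbeta) = enrichedEnumerator γ V

/-! ### Continuous linear maps between linearly compact modules -/

section LCContinuity

variable {R : Type*} [CommRing R] {I J K L : Type*}
variable {B B' C C' : Type*} [AddCommGroup B] [Module R B] [LCModule R I B]
  [AddCommGroup B'] [Module R B'] [LCModule R J B']
  [AddCommGroup C] [Module R C] [LCModule R K C]
  [AddCommGroup C'] [Module R C'] [LCModule R L C']

/-! A linear map between LC-modules is continuous exactly when each output coordinate depends on
finitely many input coordinates (`lcContinuous_iff`). Continuous maps are therefore determined by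
their values on the pseudobasis, and identities between them can be checked there.

The Hopf axioms are proved on the dual side. The dual of the poset module is the free module on
isomorphism classes. Its product, the transpose of Δ, is convolution of finitely supported functions
over the splittings (S, T), weighted by β^{|S ∩ T|}. Its coproduct is the transpose of disjoint
union. Associativity holds because splitting the lower part again and splitting the upper part again
both amount to choosing a triple of subsets (`sum_splitting_low_eq_sum_splitting_upp`). The
bialgebra law holds because a splitting of P ⊔ Q is a pair of splittings. The dual of mQSym is the
free algebra on generators H_n with H_n ↦ ∑ H_a ⊗ H_b (`nsymComul_pack`). In both duals the
coproduct does not raise total size and the basis elements of size zero are scalars. Hence ηε - id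
is locally nilpotent for convolution, and its geometric series is the antipode
(`IsConnectedBasis.hopfAlgebra`).

The core of the theorem is a cutting argument. Fix a lower set L of letters. Given an enriched
partition σ, let S consist of the s for which σ(s) meets L, and T of those for which it meets the
complement. The inequalities max σ(s) ≤ min σ(t) make (S, T) a splitting, and σ is recovered from
its pieces σ ∩ L on S and σ ∖ L on T. The total number of letters is additive while |S| + |T| = |P|
+ |S ∩ T|, so Ω(P) = ∑ β^{|S ∩ T|} Ω_L(S) Ω_{Lᶜ}(T) (`enumerator_univ_eq_sum`). Cutting between two
groups of variables turns coefficients of Ω into convolutions. This yields compatibility with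
coproducts and, after iteration, quasisymmetry. Cutting between i' and i leaves only the constant
partitions {i'} and {i} at a power of x_i, and these are counted by ζ̄_> and ζ_<, so the
one-variable coefficients of Ω are ζ_{>|<}. Products are respected because no covers join the two
summands of a disjoint union.

For uniqueness, the counit fixes the coefficient of M_∅, the equation for ζ fixes that of M_(n), and
the coproduct reduces longer compositions to shorter ones (`IsCombinatorialLCHopfMorphism.eq`). -/

@[simp]
theorem LCModule.coordinates_pi (f : I → R) : LCModule.coordinates R f = f := rfl

/-- Subtracting the part of `b` supported on a finite set `F` kills the coordinates in `F`. -/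
theorem coordinates_sub_sum (b : B) (F : Finset I) {i : I} (hi : i ∈ F) :
    LCModule.coordinates R
      (b - ∑ j ∈ F, LCModule.coordinates R b j • LCModule.pseudobasis R B j) i = 0 := by
  classical
  rw [map_sub, map_sum, Pi.sub_apply, Finset.sum_apply, Finset.sum_eq_single i]
  · simp [LCModule.coordinates_pseudobasis]
  · intro j _ hj
    simp [LCModule.coordinates_pseudobasis, hj.symm]
  · exact fun h => (h hi).elim

/-- If a coordinate of a linear map only depends on the coordinates in the finite set `F`, it is
the corresponding finite linear combination of coordinates. -/
theorem coordinates_apply_eq_sum {f : B →ₗ[R] C} {k : K} {F : Finset I}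
    (hF : ∀ b, (∀ i ∈ F, LCModule.coordinates R b i = 0) → LCModule.coordinates R (f b) k = 0)
    (b : B) :
    LCModule.coordinates R (f b) k = ∑ i ∈ F, LCModule.coordinates R b i *
      LCModule.coordinates R (f (LCModule.pseudobasis R B i)) k := by
  have h := hF _ fun i hi => coordinates_sub_sum b F hi
  rw [map_sub, map_sub, Pi.sub_apply, sub_eq_zero] at h
  rw [h]
  simp

/-- A linear map between linearly compact modules is continuous if and only if each of its
coordinates only depends on finitely many coordinates. -/
theorem lcContinuous_iff {f : B →ₗ[R] C} :
    LCContinuous f ↔ ∀ k, ∃ F : Finset I, ∀ b, (∀ i ∈ F, LCModule.coordinates R b i = 0) →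
      LCModule.coordinates R (f b) k = 0 := by
  let tR : TopologicalSpace R := ⊥
  have : DiscreteTopology R := ⟨rfl⟩
  let tB : TopologicalSpace B := LCModule.topology R B
  let tC : TopologicalSpace C := LCModule.topology R C
  have hcB : Continuous (LCModule.coordinates R : B → I → R) := continuous_induced_dom
  have hcC : Continuous (LCModule.coordinates R : C → K → R) := continuous_induced_dom
  constructor
  · intro hf k
    have hf' : Continuous f := hf
    have h1 : Continuous fun x : I → R =>
        LCModule.coordinates R (f ((LCModule.coordinates R).symm x)) k := by
      refine (continuous_apply k).comp (hcC.comp (hf'.comp ?_))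
      exact continuous_induced_rng.2 (by convert continuous_id; ext; simp)
    -- The vectors whose image has vanishing `k`-th coordinate form an open neighbourhood of 0 in
    -- the product. It contains a box constraining only finitely many coordinates, and every vector
    -- that is zero on those lies in the box.
    have h2 := (isOpen_discrete {(0 : R)}).preimage h1
    obtain ⟨F, u, hu, hF⟩ := isOpen_pi_iff.1 h2 0 (by simp)
    refine ⟨F, fun b hb => ?_⟩
    have := @hF (LCModule.coordinates R b) fun i hi => by
      rw [hb i hi]
      exact (hu i hi).2
    simpa using this
  · intro h
    refine continuous_induced_rng.2 (continuous_pi fun k => ?_)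
    obtain ⟨F, hF⟩ := h k
    have h1 : (fun b : B => LCModule.coordinates R (f b) k) = fun b => ∑ i ∈ F,
        LCModule.coordinates R b i *
          LCModule.coordinates R (f (LCModule.pseudobasis R B i)) k :=
      funext fun b => coordinates_apply_eq_sum hF b
    change Continuous fun b : B => LCModule.coordinates R (f b) k
    rw [h1]
    exact continuous_finsetSum _ fun i _ => ((continuous_apply i).comp hcB).mul continuous_const

/-- Continuous linear maps are determined by their values on the pseudobasis. -/
theorem LCContinuous.ext {f g : B →ₗ[R] C} (hf : LCContinuous f) (hg : LCContinuous g)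
    (h : ∀ i, f (LCModule.pseudobasis R B i) = g (LCModule.pseudobasis R B i)) : f = g := by
  classical
  refine LinearMap.ext fun b => (LCModule.coordinates R : C ≃ₗ[R] (K → R)).injective ?_
  funext k
  obtain ⟨F, hF⟩ := lcContinuous_iff.1 hf k
  obtain ⟨G, hG⟩ := lcContinuous_iff.1 hg k
  rw [coordinates_apply_eq_sum (F := F ∪ G) fun b hb => hF b fun i hi =>
      hb i (Finset.mem_union_left _ hi),
    coordinates_apply_eq_sum (F := F ∪ G) fun b hb => hG b fun i hi =>
      hb i (Finset.mem_union_right _ hi)]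
  simp only [h]

theorem LCContinuous.comp {g : B' →ₗ[R] C} {f : B →ₗ[R] B'} (hg : LCContinuous g)
    (hf : LCContinuous f) : LCContinuous (g ∘ₗ f) :=
  @Continuous.comp _ _ _ (LCModule.topology R B) (LCModule.topology R B') (LCModule.topology R C)
    _ _ hg hf

theorem cmap_apply (f : B →ₗ[R] C) (g : B' →ₗ[R] C') (T : CompletedTensor R I J) (k : K) (l : L) :
    cmap f g T (k, l) = LCModule.coordinates R
      (f ((LCModule.coordinates R).symm fun i => LCModule.coordinates R
        (g ((LCModule.coordinates R).symm fun j => T (i, j))) l)) k := rfl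

/-- If coordinate `k` of `f` depends on `F` and coordinate `l` of `g` on `G`, then coordinate `(k,
l)` of the tensor product depends on `F ×ˢ G`. -/
theorem LCContinuous.cmap {f : B →ₗ[R] C} {g : B' →ₗ[R] C'} (hf : LCContinuous f)
    (hg : LCContinuous g) : LCContinuous (cmap f g) := by
  rw [lcContinuous_iff] at *
  rintro ⟨k, l⟩
  obtain ⟨F, hF⟩ := hf k
  obtain ⟨G, hG⟩ := hg l
  refine ⟨F ×ˢ G, fun T hT => ?_⟩
  rw [LCModule.coordinates_pi, cmap_apply]
  refine hF _ fun i hi => ?_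
  rw [LinearEquiv.apply_symm_apply]
  refine hG _ fun j hj => ?_
  rw [LinearEquiv.apply_symm_apply]
  exact hT (i, j) (Finset.mem_product.2 ⟨hi, hj⟩)

theorem ctmul_pseudobasis (i : I) (j : J) :
    ctmul R (LCModule.pseudobasis R B i) (LCModule.pseudobasis R B' j) =
      LCModule.pseudobasis R (CompletedTensor R I J) (i, j) := by
  classical
  funext ⟨k, l⟩
  have h := LCModule.coordinates_pseudobasis (R := R) (B := CompletedTensor R I J) (i, j) (k, l)
  rw [LCModule.coordinates_pi] at h
  rw [h, ctmul, LCModule.coordinates_pseudobasis, LCModule.coordinates_pseudobasis]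
  simp only [Prod.mk.injEq]
  split_ifs <;> simp_all

/-- Continuous linear maps on a completed tensor product are determined by their values on tensors
of pseudobasis elements. -/
theorem LCContinuous.ext_tensor {f g : CompletedTensor R I J →ₗ[R] C} (hf : LCContinuous f)
    (hg : LCContinuous g)
    (h : ∀ i j, f (ctmul R (LCModule.pseudobasis R B i) (LCModule.pseudobasis R B' j)) =
      g (ctmul R (LCModule.pseudobasis R B i) (LCModule.pseudobasis R B' j))) : f = g :=
  hf.ext hg fun p => by simpa only [ctmul_pseudobasis] using h p.1 p.2

@[simp]
theorem LCModule.coordinates_powerSeries (f : PowerSeries R) (n : ℕ) :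
    LCModule.coordinates R f n = PowerSeries.coeff n f := rfl

theorem coeff_powerSeriesMul (T : CompletedTensor R ℕ ℕ) (n : ℕ) :
    PowerSeries.coeff n (powerSeriesMul R T) =
      ∑ p ∈ Finset.HasAntidiagonal.antidiagonal n, T p := by
  simp [powerSeriesMul]

theorem powerSeriesMul_continuous : LCContinuous (powerSeriesMul R) := by
  rw [lcContinuous_iff]
  refine fun n => ⟨Finset.HasAntidiagonal.antidiagonal n, fun T hT => ?_⟩
  rw [LCModule.coordinates_powerSeries, coeff_powerSeriesMul]
  exact Finset.sum_eq_zero hT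

end LCContinuity

/-! ### Antipodes of connected bialgebras -/

section Antipode

open TensorProduct WithConv Coalgebra

variable {R A I : Type*} [CommRing R] [Ring A] [Bialgebra R A]

variable (R A) in
/-- The difference `ηε - id` in the convolution algebra. -/
noncomputable def unitSubId : WithConv (A →ₗ[R] A) := 1 - toConv LinearMap.id

/-- A basis of a bialgebra is connected with respect to a size function if the coproduct is
compatible with sizes, and basis elements of size zero are scalars. -/
structure IsConnectedBasis (e : Module.Basis I R A) (size : I → ℕ) : Prop where
  comul_mem : ∀ k, comul (R := R) (e k) ∈
    Submodule.span R {t : A ⊗[R] A | ∃ i j, size i + size j ≤ size k ∧ t = e i ⊗ₜ[R] e j}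
  scalar : ∀ i, size i = 0 → algebraMap R A (counit (R := R) (e i)) = e i

namespace IsConnectedBasis

variable {e : Module.Basis I R A} {size : I → ℕ}

/-- A convolution product at `e k` passes through the coproduct of `e k`, so it only sees tensors `e
i ⊗ e j` of total size at most that of `k`. -/
theorem convMul_congr (h : IsConnectedBasis e size) {f f' g g' : WithConv (A →ₗ[R] A)} (k : I)
    (hfg : ∀ i j, size i + size j ≤ size k → f (e i) * g (e j) = f' (e i) * g' (e j)) :
    (f * g) (e k) = (f' * g') (e k) := by
  rw [LinearMap.convMul_apply, LinearMap.convMul_apply]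
  refine LinearMap.eqOn_span (f := LinearMap.mul' R A ∘ₗ TensorProduct.map f.ofConv g.ofConv)
    (g := LinearMap.mul' R A ∘ₗ TensorProduct.map f'.ofConv g'.ofConv) ?_ (h.comul_mem k)
  rintro _ ⟨i, j, hij, rfl⟩
  simpa using hfg i j hij

/-- Local nilpotence: `unitSubId` kills basis elements of size zero, so in `unitSubId * unitSubId ^
m` a surviving left factor has positive size and leaves a strictly smaller size for the right one.
-/
theorem pow_apply_eq_zero (h : IsConnectedBasis e size) (m : ℕ) (k : I) (hk : size k < m) :
    (unitSubId R A ^ m : WithConv (A →ₗ[R] A)) (e k) = 0 := by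
  induction m generalizing k with
  | zero => omega
  | succ m ih =>
    have : (0 : WithConv (A →ₗ[R] A)) (e k) = 0 := rfl
    -- Zero is written as the convolution `0 * 0` so that `convMul_congr` compares the two products
    -- factor by factor.
    rw [pow_succ', ← this, ← zero_mul (0 : WithConv (A →ₗ[R] A))]
    refine h.convMul_congr k fun i j hij => ?_
    by_cases hi : size i = 0
    · have : unitSubId R A (e i) = 0 := by
        change (1 : WithConv (A →ₗ[R] A)) (e i) - e i = 0
        rw [LinearMap.convOne_apply, h.scalar i hi, sub_self]
      rw [this, zero_mul]
      exact (zero_mul _).symm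
    · rw [ih j (by omega), mul_zero]
      exact (zero_mul _).symm

/-- The convolution inverse of the identity, `∑ (ηε - id)^m`. -/
noncomputable def convInv (e : Module.Basis I R A) (size : I → ℕ) : WithConv (A →ₗ[R] A) :=
  toConv (e.constr ℕ fun i => ∑ m ∈ Finset.range (size i + 1),
    (unitSubId R A ^ m : WithConv (A →ₗ[R] A)) (e i))

theorem sum_apply {ι : Type*} (s : Finset ι) (f : ι → WithConv (A →ₗ[R] A)) (a : A) :
    (∑ i ∈ s, f i) a = ∑ i ∈ s, f i a := by
  classical
  induction s using Finset.induction_on with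
  | empty => rfl
  | insert i s hi ih => rw [Finset.sum_insert hi, Finset.sum_insert hi, ← ih]; rfl

/-- The geometric series may be cut off at any bound beyond the size. A single truncation then
serves all tensor factors occurring in the coproduct of one basis element. -/
theorem convInv_apply (h : IsConnectedBasis e size) {N : ℕ} {i : I} (hi : size i ≤ N) :
    convInv e size (e i) =
      (∑ m ∈ Finset.range (N + 1), unitSubId R A ^ m : WithConv (A →ₗ[R] A)) (e i) := by
  rw [sum_apply]
  have h1 : convInv e size (e i) = ∑ m ∈ Finset.range (size i + 1),
    (unitSubId R A ^ m : WithConv (A →ₗ[R] A)) (e i) := by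
    simp [convInv]
  rw [h1]
  refine Finset.sum_subset (by simpa using hi) fun m _ hm => h.pow_apply_eq_zero m i ?_
  simp at hm
  omega

/-- With `id = 1 - unitSubId`, the truncated geometric series telescopes to `1 - unitSubId ^ (size k
+ 1)`, whose last term vanishes at `e k`. -/
theorem convInv_mul (h : IsConnectedBasis e size) : convInv e size * toConv LinearMap.id = 1 := by
  refine WithConv.ofConv_injective (e.ext fun k => ?_)
  change (convInv e size * toConv LinearMap.id : WithConv (A →ₗ[R] A)) (e k) = (1 : WithConv (A →ₗ[R] A)) (e k)
  rw [h.convMul_congr (f' := ∑ m ∈ Finset.range (size k + 1),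
      unitSubId R A ^ m)
    (g' := toConv LinearMap.id) k
    fun i j hij => by rw [h.convInv_apply (by omega : size i ≤ size k)],
    show toConv LinearMap.id = 1 - unitSubId R A from (sub_sub_cancel _ _).symm,
    geom_sum_mul_neg]
  change (1 : WithConv (A →ₗ[R] A)) (e k) -
    (unitSubId R A ^ (size k + 1) : WithConv (A →ₗ[R] A)) (e k) = _
  rw [h.pow_apply_eq_zero _ k (Nat.lt_succ_self _), sub_zero]

theorem mul_convInv (h : IsConnectedBasis e size) : toConv LinearMap.id * convInv e size = 1 := by
  refine WithConv.ofConv_injective (e.ext fun k => ?_)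
  change (toConv LinearMap.id * convInv e size : WithConv (A →ₗ[R] A)) (e k) = (1 : WithConv (A →ₗ[R] A)) (e k)
  rw [h.convMul_congr (g' := ∑ m ∈ Finset.range (size k + 1),
      unitSubId R A ^ m)
    (f' := toConv LinearMap.id) k
    fun i j hij => by rw [h.convInv_apply (by omega : size j ≤ size k)],
    show toConv LinearMap.id = 1 - unitSubId R A from (sub_sub_cancel _ _).symm,
    mul_neg_geom_sum]
  change (1 : WithConv (A →ₗ[R] A)) (e k) -
    (unitSubId R A ^ (size k + 1) : WithConv (A →ₗ[R] A)) (e k) = _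
  rw [h.pow_apply_eq_zero _ k (Nat.lt_succ_self _), sub_zero]

/-- A bialgebra with a connected basis is a Hopf algebra. -/
@[reducible]
noncomputable def hopfAlgebra (h : IsConnectedBasis e size) : HopfAlgebra R A where
  antipode := (convInv e size).ofConv
  mul_antipode_rTensor_comul := congrArg WithConv.ofConv h.convInv_mul
  mul_antipode_lTensor_comul := congrArg WithConv.ofConv h.mul_convInv

end IsConnectedBasis

end Antipode

/-! ### Adjointness checked on a basis -/

section Pairing

open TensorProduct Coalgebra

/-- Reading the pairing as a linear functional of `a` lets adjointness be deduced from its validity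
on basis vectors. -/
theorem lcPairing_eq_constr {R : Type*} [CommRing R] {I A B : Type*} [AddCommGroup A] [Module R A]
    (e : Module.Basis I R A) [AddCommGroup B] [Module R B] [LCModule R I B] (a : A) (b : B) :
    lcPairing e a b = e.constr R (LCModule.coordinates R b) a := by
  rw [lcPairing, Module.Basis.constr_apply]
  rfl

/-- A linearly compact module is an LC-Hopf algebra if its structure maps are dual to those of a
bialgebra with a connected basis. -/
theorem LCHopfData.isLCHopfAlgebra_of_basis.{u, v, w} {R : Type u} [CommRing R] {I : Type v}
    {B : Type w} [AddCommGroup B] [Module R B] [LCModule R I B] (H : LCHopfData R I B)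
    {A : Type (max u v)} [Ring A] [Bialgebra R A] (e : Module.Basis I R A) {size : I → ℕ}
    (he : IsConnectedBasis e size)
    (hmul : ∀ i T, LCModule.coordinates R (H.mul T) i =
      (e.tensorProduct e).constr R T (Coalgebra.comul (R := R) (e i)))
    (hunit : ∀ i, LCModule.coordinates R (H.unit 1) i = Coalgebra.counit (R := R) (e i))
    (hcomul : ∀ i j b, H.comul b (i, j) = e.constr R (LCModule.coordinates R b) (e i * e j))
    (hcounit : ∀ b, H.counit b = e.constr R (LCModule.coordinates R b) 1) :
    H.IsLCHopfAlgebra := by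
  refine ⟨A, inferInstance, he.hopfAlgebra, e, fun a T => ?_, fun a r => ?_, fun a a' b => ?_,
    fun b => ?_⟩
  · rw [lcPairing_eq_constr, lcPairing_eq_constr]
    have : e.constr R (LCModule.coordinates R (H.mul T)) =
        (e.tensorProduct e).constr R T ∘ₗ Coalgebra.comul (R := R) :=
      e.ext fun i => by simpa using hmul i T
    exact LinearMap.congr_fun this a
  · rw [lcPairing_eq_constr]
    have : e.constr R (LCModule.coordinates R (H.unit r)) = r • Coalgebra.counit (R := R) := by
      refine e.ext fun i => ?_
      have h : H.unit r = r • H.unit 1 := by rw [← map_smul, smul_eq_mul, mul_one]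
      simp [h, hunit i]
    rw [this, LinearMap.smul_apply, smul_eq_mul, mul_comm]
  · rw [lcPairing_eq_constr, lcPairing_eq_constr]
    have : (TensorProduct.mk R A A).compr₂
          ((e.tensorProduct e).constr R (LCModule.coordinates R (H.comul b))) =
        (LinearMap.mul R A).compr₂ (e.constr R (LCModule.coordinates R b)) := by
      refine e.ext fun i => e.ext fun j => ?_
      have h := (e.tensorProduct e).constr_basis R (LCModule.coordinates R (H.comul b)) (i, j)
      rw [Module.Basis.tensorProduct_apply] at h
      exact h.trans (hcomul i j b)
    exact LinearMap.congr_fun (LinearMap.congr_fun this a) a'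
  · rw [lcPairing_eq_constr, hcounit]

end Pairing

/-! ### The LC-Hopf algebra of quasisymmetric power series -/

/-! ### Packed exponents and decompositions of exponents -/

section Pack

variable {σ : Type*} [LinearOrder σ]

theorem pack_zero : pack (0 : σ →₀ ℕ) = [] := by simp [pack]

theorem pack_single (i : σ) {n : ℕ} (hn : n ≠ 0) :
    pack (Finsupp.single i n) = [n.toPNat'] := by
  rw [pack, Finsupp.support_single _ hn, Finset.sort_singleton]
  simp

/-- When every variable of `u` precedes every variable of `v`, the sorted support of the sum is the
concatenation of the sorted supports. This links addition of exponents to concatenation of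
compositions. -/
theorem pack_add {u v : σ →₀ ℕ} (h : ∀ a ∈ u.support, ∀ b ∈ v.support, a < b) :
    pack (u + v) = pack u ++ pack v := by
  have hd : Disjoint u.support v.support :=
    Finset.disjoint_left.2 fun a ha hb => (h a ha a hb).false
  have hs : (u + v).support.sort (· ≤ ·) =
      u.support.sort (· ≤ ·) ++ v.support.sort (· ≤ ·) := by
    refine List.Perm.eq_of_pairwise' (r := (· ≤ ·)) (Finset.pairwise_sort _ _) ?_ ?_
    · rw [List.pairwise_append]
      refine ⟨Finset.pairwise_sort _ _, Finset.pairwise_sort _ _, fun a ha b hb => ?_⟩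
      rw [Finset.mem_sort] at ha hb
      exact (h a ha b hb).le
    · rw [List.perm_ext_iff_of_nodup (Finset.sort_nodup _ _)]
      · intro a
        rw [List.mem_append, Finset.mem_sort, Finset.mem_sort, Finset.mem_sort,
          Finsupp.support_add_eq hd, Finset.mem_union]
      · rw [List.nodup_append]
        refine ⟨Finset.sort_nodup _ _, Finset.sort_nodup _ _, fun a ha b hb => ?_⟩
        rw [Finset.mem_sort] at ha hb
        exact (h a ha b hb).ne
  rw [pack, hs, List.map_append, pack, pack]
  congr 1
  · refine List.map_congr_left fun a ha => ?_
    rw [Finset.mem_sort] at ha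
    have := Finsupp.notMem_support_iff.1 (Finset.disjoint_left.1 hd ha)
    simp [this]
  · refine List.map_congr_left fun a ha => ?_
    rw [Finset.mem_sort] at ha
    have := Finsupp.notMem_support_iff.1 (Finset.disjoint_right.1 hd ha)
    simp [this]

theorem sum_pack (u : σ →₀ ℕ) : ((pack u).map PNat.val).sum = u.degree := by
  induction u using Finsupp.induction_on_min with
  | zero => simp [pack_zero]
  | single_add a b f h hb ih =>
    rw [pack_add (fun c hc d hd => by
      rw [Finsupp.support_single _ hb, Finset.mem_singleton] at hc
      exact hc ▸ h d hd), List.map_append, List.sum_append, ih, map_add, pack_single _ hb]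
    simp [Nat.pos_of_ne_zero hb]

/-- A decomposition of an exponent is chosen variable by variable, so over disjoint supports the
choices for `u` and for `v` are independent. -/
theorem Finsupp.sum_antidiagonal_add {M : Type*} [AddCommMonoid M] {u v : σ →₀ ℕ}
    (h : Disjoint u.support v.support) (F : (σ →₀ ℕ) × (σ →₀ ℕ) → M) :
    ∑ p ∈ Finset.HasAntidiagonal.antidiagonal (u + v), F p =
      ∑ p ∈ Finset.HasAntidiagonal.antidiagonal u,
        ∑ q ∈ Finset.HasAntidiagonal.antidiagonal v, F (p + q) := by
  rw [← Finset.sum_product']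
  symm
  have key : ∀ {p q : (σ →₀ ℕ) × (σ →₀ ℕ)}, p.1 + p.2 = u → q.1 + q.2 = v → ∀ x,
      (x ∈ u.support → q.1 x = 0 ∧ q.2 x = 0) ∧ (x ∉ u.support → p.1 x = 0 ∧ p.2 x = 0) := by
    rintro p q rfl rfl x
    constructor
    · intro hx
      simpa using Finsupp.notMem_support_iff.1 (Finset.disjoint_left.1 h hx)
    · intro hx
      simpa using Finsupp.notMem_support_iff.1 hx
  refine Finset.sum_bij (fun x _ => x.1 + x.2) ?_ ?_ ?_ fun _ _ => rfl
  · rintro ⟨p, q⟩ hpq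
    simp only [Finset.mem_product, Finset.HasAntidiagonal.mem_antidiagonal] at hpq ⊢
    rw [← hpq.1, ← hpq.2, Prod.fst_add, Prod.snd_add]
    abel
  · rintro ⟨p, q⟩ hpq ⟨p', q'⟩ hpq' he
    simp only [Finset.mem_product, Finset.HasAntidiagonal.mem_antidiagonal] at hpq hpq'
    have h1 : ∀ x, p.1 x + q.1 x = p'.1 x + q'.1 x := fun x =>
      DFunLike.congr_fun (congrArg Prod.fst he) x
    have h2 : ∀ x, p.2 x + q.2 x = p'.2 x + q'.2 x := fun x =>
      DFunLike.congr_fun (congrArg Prod.snd he) x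
    have k := key hpq.1 hpq.2
    have k' := key hpq'.1 hpq'.2
    refine Prod.ext (Prod.ext ?_ ?_) (Prod.ext ?_ ?_) <;> ext x <;> have h1 := h1 x <;>
      have h2 := h2 x <;> have k := k x <;> have k' := k' x <;> by_cases hx : x ∈ u.support <;>
      simp only [hx, true_imp_iff, not_true, not_false_iff, false_imp_iff, true_and, and_true]
        at k k' <;> dsimp only <;> omega
  · intro p hp
    rw [Finset.HasAntidiagonal.mem_antidiagonal] at hp
    have hp' : ∀ x, p.1 x + p.2 x = u x + v x := fun x => DFunLike.congr_fun hp x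
    have hu : ∀ x, x ∈ u.support → v x = 0 := fun x hx =>
      Finsupp.notMem_support_iff.1 (Finset.disjoint_left.1 h hx)
    have hv : ∀ x, x ∉ u.support → u x = 0 := fun x hx => Finsupp.notMem_support_iff.1 hx
    -- The part of each component on the variables of `u` goes into the first pair, and everything
    -- else into the second.
    refine ⟨((p.1.filter (· ∈ u.support), p.2.filter (· ∈ u.support)),
      (p.1.filter (· ∉ u.support), p.2.filter (· ∉ u.support))), ?_, ?_⟩
    · simp only [Finset.mem_product, Finset.HasAntidiagonal.mem_antidiagonal]
      constructor <;> ext x <;> by_cases hx : x ∈ u.support <;>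
        simp only [Finsupp.add_apply, Finsupp.filter_apply, hx, not_true, not_false_iff, if_true,
          if_false, hp' x]
      · simp [hu x hx]
      · simp [hv x hx]
      · simp [hu x hx]
      · simp [hv x hx]
    · exact Prod.ext (Finsupp.filter_add_filter_not _ _)
        (Finsupp.filter_add_filter_not _ _)

end Pack

/-- Both sides run over the ordered triples with sum `n`. This is what coassociativity on generators
amounts to. -/
theorem Nat.sum_antidiagonal_assoc {M : Type*} [AddCommMonoid M] (n : ℕ)
    (F : ℕ → ℕ → ℕ → M) :
    ∑ p ∈ Finset.HasAntidiagonal.antidiagonal n, ∑ q ∈ Finset.HasAntidiagonal.antidiagonal p.1, F q.1 q.2 p.2 =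
      ∑ p ∈ Finset.HasAntidiagonal.antidiagonal n, ∑ q ∈ Finset.HasAntidiagonal.antidiagonal p.2, F p.1 q.1 q.2 := by
  rw [Finset.sum_sigma', Finset.sum_sigma']
  refine Finset.sum_bij' (fun x _ => ⟨(x.2.1, x.2.2 + x.1.2), (x.2.2, x.1.2)⟩)
    (fun x _ => ⟨(x.1.1 + x.2.1, x.2.2), (x.1.1, x.2.1)⟩) ?_ ?_ ?_ ?_ ?_
  all_goals
    rintro ⟨⟨a, b⟩, c, d⟩ h
    simp only [Finset.mem_sigma, Finset.HasAntidiagonal.mem_antidiagonal] at h ⊢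
  · obtain ⟨rfl, rfl⟩ := h
    simp [add_assoc]
  · obtain ⟨rfl, rfl⟩ := h
    simp [add_assoc]
  · obtain ⟨-, rfl⟩ := h
    rfl
  · obtain ⟨-, rfl⟩ := h
    rfl

/-! ### Noncommutative symmetric functions -/

section NSym

open TensorProduct

variable (R : Type*) [CommRing R]

/-- The basis of the free algebra on `ℕ+` (the algebra of noncommutative symmetric functions)
consisting of the monomials. -/
noncomputable def nsymBasis : Module.Basis (List ℕ+) R (FreeAlgebra R ℕ+) :=
  (FreeAlgebra.basisFreeMonoid R ℕ+).reindex FreeMonoid.toList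

theorem nsymBasis_apply (α : List ℕ+) :
    nsymBasis R α = (α.map (FreeAlgebra.ι R)).prod := by
  rw [nsymBasis, Module.Basis.reindex_apply]
  simp only [FreeAlgebra.basisFreeMonoid, Module.Basis.map_apply]
  change FreeAlgebra.equivMonoidAlgebraFreeMonoid.symm
    (MonoidAlgebra.single (FreeMonoid.ofList α) (1 : R)) = _
  change MonoidAlgebra.lift R (FreeAlgebra R ℕ+) (FreeMonoid ℕ+) _ _ = _
  rw [MonoidAlgebra.lift_single, one_smul, FreeMonoid.lift_apply]
  rfl

theorem nsymBasis_nil : nsymBasis R [] = 1 := by simp [nsymBasis_apply]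

theorem nsymBasis_append (α α' : List ℕ+) :
    nsymBasis R (α ++ α') = nsymBasis R α * nsymBasis R α' := by
  simp [nsymBasis_apply]

/-- The generator of degree `n`, with the convention that it is `1` for `n = 0`. -/
noncomputable def nsymGen (n : ℕ) : FreeAlgebra R ℕ+ :=
  if n = 0 then 1 else FreeAlgebra.ι R n.toPNat'

theorem nsymBasis_pack_single {σ : Type*} [LinearOrder σ] (i : σ) (n : ℕ) :
    nsymBasis R (pack (Finsupp.single i n)) = nsymGen R n := by
  by_cases hn : n = 0
  · simp [hn, pack_zero, nsymBasis_nil, nsymGen]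
  · simp [pack_single i hn, nsymBasis_apply, nsymGen, hn]

/-- The coproduct of noncommutative symmetric functions. -/
noncomputable def nsymComul :
    FreeAlgebra R ℕ+ →ₐ[R] FreeAlgebra R ℕ+ ⊗[R] FreeAlgebra R ℕ+ :=
  FreeAlgebra.lift R fun n => ∑ p ∈ Finset.HasAntidiagonal.antidiagonal (n : ℕ), nsymGen R p.1 ⊗ₜ nsymGen R p.2

/-- The counit of noncommutative symmetric functions. -/
noncomputable def nsymCounit : FreeAlgebra R ℕ+ →ₐ[R] R :=
  FreeAlgebra.lift R fun _ => 0

/-- The convention `nsymGen R 0 = 1` extends the defining formula to `n = 0`, where it says that 1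
is group-like. Exponents that become zero in a decomposition then need no separate treatment. -/
theorem nsymComul_gen (n : ℕ) : nsymComul R (nsymGen R n) =
    ∑ p ∈ Finset.HasAntidiagonal.antidiagonal n, nsymGen R p.1 ⊗ₜ nsymGen R p.2 := by
  by_cases hn : n = 0
  · subst hn
    simp [nsymGen, Algebra.TensorProduct.one_def]
  · conv_lhs => rw [nsymGen, if_neg hn]
    rw [nsymComul, FreeAlgebra.lift_ι_apply, PNat.toPNat'_coe (Nat.pos_of_ne_zero hn)]

theorem nsymCounit_gen (n : ℕ) : nsymCounit R (nsymGen R n) = if n = 0 then 1 else 0 := by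
  by_cases hn : n = 0 <;> simp [nsymGen, nsymCounit, hn]

theorem ι_eq_nsymGen (n : ℕ+) : FreeAlgebra.ι R n = nsymGen R n := by
  simp [nsymGen]

/-- The bialgebra of noncommutative symmetric functions. -/
@[reducible]
noncomputable def nsymBialgebra : Bialgebra R (FreeAlgebra R ℕ+) :=
  Bialgebra.ofAlgHom (nsymComul R) (nsymCounit R)
    (by
      ext n
      simp only [Function.comp_apply, AlgHom.comp_apply, ι_eq_nsymGen, nsymComul_gen, map_sum,
        Algebra.TensorProduct.map_tmul, AlgHom.id_apply, sum_tmul, tmul_sum]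
      exact Nat.sum_antidiagonal_assoc n fun a b c => nsymGen R a ⊗ₜ (nsymGen R b ⊗ₜ nsymGen R c))
    (by
      ext n
      simp only [Function.comp_apply, AlgHom.comp_apply, ι_eq_nsymGen, nsymComul_gen, map_sum,
        Algebra.TensorProduct.map_tmul, AlgHom.id_apply, nsymCounit_gen]
      rw [Finset.sum_eq_single (0, (n : ℕ))]
      · simp
      · rintro ⟨a, b⟩ hab hne
        rw [if_neg, zero_tmul]
        rintro rfl
        simp_all
      · simp)
    (by
      ext n
      simp only [Function.comp_apply, AlgHom.comp_apply, ι_eq_nsymGen, nsymComul_gen, map_sum,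
        Algebra.TensorProduct.map_tmul, AlgHom.id_apply, nsymCounit_gen]
      rw [Finset.sum_eq_single ((n : ℕ), 0)]
      · simp
      · rintro ⟨a, b⟩ hab hne
        rw [if_neg, tmul_zero]
        rintro rfl
        simp_all
      · simp)

/-- This is the dual form of the multiplication of quasisymmetric series. The coproduct is
multiplicative on words, and each letter of the word of `u` is the exponent of one variable, so
splitting the letters one by one is the same as decomposing `u`. The induction removes the smallest
variable. -/
theorem nsymComul_pack {σ : Type*} [LinearOrder σ] (u : σ →₀ ℕ) :
    nsymComul R (nsymBasis R (pack u)) = ∑ p ∈ Finset.HasAntidiagonal.antidiagonal u,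
      nsymBasis R (pack p.1) ⊗ₜ nsymBasis R (pack p.2) := by
  induction u using Finsupp.induction_on_min with
  | zero => simp [pack_zero, nsymBasis_nil, Algebra.TensorProduct.one_def]
  | single_add a b f h hb ih =>
    have hs : ∀ c ∈ (Finsupp.single a b).support, ∀ d ∈ f.support, c < d := fun c hc d hd => by
      rw [Finsupp.support_single _ hb, Finset.mem_singleton] at hc
      exact hc ▸ h d hd
    have hd : Disjoint (Finsupp.single a b).support f.support :=
      Finset.disjoint_left.2 fun a ha hb => (hs a ha a hb).false
    rw [pack_add hs, nsymBasis_append, map_mul, ih, nsymBasis_pack_single, nsymComul_gen,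
      Finsupp.sum_antidiagonal_add hd, Finsupp.antidiagonal_single, Finset.sum_map,
      Finset.sum_mul_sum]
    refine Finset.sum_congr rfl fun p hp => Finset.sum_congr rfl fun q hq => ?_
    -- Both halves of a decomposition of `f` stay above the variable `a`, also when `a` receives
    -- exponent 0, so `pack_add` applies to each component.
    have hlt : ∀ n : ℕ, ∀ v : σ →₀ ℕ, v ≤ f →
        ∀ c ∈ (Finsupp.single a n).support, ∀ d ∈ v.support, c < d := by
      intro n v hv c hc d hd
      have hc' := Finsupp.support_single_subset hc
      rw [Finset.mem_singleton] at hc'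
      exact hc' ▸ h d (Finsupp.support_mono hv hd)
    rw [Finset.HasAntidiagonal.mem_antidiagonal] at hq
    have h1 : q.1 ≤ f := hq ▸ le_self_add
    have h2 : q.2 ≤ f := hq ▸ le_add_self
    simp only [Function.Embedding.prodMap, Function.Embedding.coeFn_mk, Prod.map, Prod.fst_add,
      Prod.snd_add]
    rw [pack_add (hlt _ _ h1), pack_add (hlt _ _ h2), nsymBasis_append, nsymBasis_append,
      nsymBasis_pack_single, nsymBasis_pack_single, Algebra.TensorProduct.tmul_mul_tmul]

/-- The size of a word is the degree of any exponent that packs to it, and decomposing an exponent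
splits its degree exactly. Parts being positive, only the empty word has size zero. -/
theorem nsymBasis_isConnectedBasis :
    let := nsymBialgebra R
    IsConnectedBasis (nsymBasis R) fun α => (α.map PNat.val).sum := by
  let := nsymBialgebra R
  refine ⟨fun α => ?_, fun α hα => ?_⟩
  · change nsymComul R (nsymBasis R α) ∈ _
    rw [← pack_compositionExponent α, nsymComul_pack]
    refine Submodule.sum_mem _ fun p hp => Submodule.subset_span ⟨pack p.1, pack p.2, ?_, rfl⟩
    rw [Finset.HasAntidiagonal.mem_antidiagonal] at hp
    rw [sum_pack, sum_pack, sum_pack, ← hp, map_add]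
  · cases α with
    | nil => simp [nsymBasis_nil]
    | cons n α => simp at hα

end NSym

/-! ### The structure maps of mQSym and its character -/

section QSym

variable {R : Type*} [CommRing R]

theorem coordinates_mqsym (f : MQSym R) (α : List ℕ+) :
    LCModule.coordinates R f α =
      MvPowerSeries.coeff (compositionExponent α) (f : MvPowerSeries ℕ+ R) := rfl

theorem coeff_mqsym (f : MQSym R) (u : ℕ+ →₀ ℕ) :
    MvPowerSeries.coeff u (f : MvPowerSeries ℕ+ R) = LCModule.coordinates R f (pack u) :=
  coeff_eq_of_mem_MQSym f.2 u

theorem coeff_coordinates_symm (g : List ℕ+ → R) (u : ℕ+ →₀ ℕ) :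
    MvPowerSeries.coeff u (((LCModule.coordinates R).symm g : MQSym R) : MvPowerSeries ℕ+ R) =
      g (pack u) := rfl

theorem coordinates_mqsymMul (T : CompletedTensor R (List ℕ+) (List ℕ+)) (α : List ℕ+) :
    LCModule.coordinates R (mqsymMul R T) α =
      ∑ p ∈ Finset.HasAntidiagonal.antidiagonal (compositionExponent α),
        T (pack p.1, pack p.2) := rfl

theorem coeff_mqsymMul (T : CompletedTensor R (List ℕ+) (List ℕ+)) (u : ℕ+ →₀ ℕ) :
    MvPowerSeries.coeff u (mqsymMul R T : MvPowerSeries ℕ+ R) =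
      ∑ p ∈ Finset.HasAntidiagonal.antidiagonal u, T (pack p.1, pack p.2) := rfl

theorem coordinates_one_mqsym (α : List ℕ+) :
    LCModule.coordinates R (⟨1, one_mem_MQSym R⟩ : MQSym R) α = if α = [] then 1 else 0 := by
  classical
  rw [coordinates_mqsym, MvPowerSeries.coeff_one]
  congr 1
  apply propext
  constructor
  · intro h
    rw [← pack_compositionExponent α, h, pack_zero]
  · rintro rfl
    rfl

theorem coeff_zetaQ (f : MQSym R) (n : ℕ) : PowerSeries.coeff n (zetaQ R f) =
    MvPowerSeries.coeff (Finsupp.single 1 n) (f : MvPowerSeries ℕ+ R) := by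
  simp [zetaQ]

theorem mqsymMul_continuous : LCContinuous (mqsymMul R) := by
  classical
  rw [lcContinuous_iff]
  refine fun α => ⟨(Finset.HasAntidiagonal.antidiagonal (compositionExponent α)).image
    fun p => (pack p.1, pack p.2), fun T hT => ?_⟩
  rw [coordinates_mqsymMul]
  exact Finset.sum_eq_zero fun p hp => hT _ (Finset.mem_image_of_mem _ hp)

theorem mqsymComul_continuous : LCContinuous (mqsymHopf R).comul := by
  rw [lcContinuous_iff]
  exact fun p => ⟨{p.1 ++ p.2}, fun b hb => hb _ (Finset.mem_singleton_self _)⟩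

theorem zetaQ_continuous : LCContinuous (zetaQ R) := by
  rw [lcContinuous_iff]
  refine fun n => ⟨{pack (Finsupp.single (1 : ℕ+) n)}, fun f hf => ?_⟩
  rw [LCModule.coordinates_powerSeries, coeff_zetaQ, coeff_mqsym]
  exact hf _ (Finset.mem_singleton_self _)

/-- The dual Hopf algebra is the free algebra on `ℕ+`: concatenation of words is the transpose of
deconcatenation, and `nsymComul_pack` is the transpose of the multiplication of series. -/
theorem mqsym_isLCHopfAlgebra (R : Type) [CommRing R] : (mqsymHopf R).IsLCHopfAlgebra := by
  let := nsymBialgebra R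
  refine (mqsymHopf R).isLCHopfAlgebra_of_basis (nsymBasis R) (nsymBasis_isConnectedBasis R)
    (fun α T => ?_) (fun α => ?_) (fun α α' b => ?_) fun b => ?_
  · change LCModule.coordinates R (mqsymMul R T) α =
      ((nsymBasis R).tensorProduct (nsymBasis R)).constr R T (nsymComul R (nsymBasis R α))
    rw [coordinates_mqsymMul, ← congrArg (nsymBasis R) (pack_compositionExponent α), nsymComul_pack,
      map_sum]
    refine Finset.sum_congr rfl fun p _ => ?_
    rw [← Module.Basis.tensorProduct_apply, Module.Basis.constr_basis]
  · change LCModule.coordinates R ((1 : R) • (⟨1, one_mem_MQSym R⟩ : MQSym R)) α =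
      nsymCounit R (nsymBasis R α)
    rw [one_smul, coordinates_one_mqsym, nsymBasis_apply]
    cases α <;> simp [nsymCounit]
  · rw [← nsymBasis_append, Module.Basis.constr_basis]
    rfl
  · rw [← nsymBasis_nil, Module.Basis.constr_basis]
    rfl

/-- Multiplicativity comes down to the fact that an exponent supported on the first variable only
decomposes into exponents supported there (`Finsupp.antidiagonal_single`). -/
theorem zetaQ_isCharacter : (mqsymHopf R).IsCharacter (zetaQ R) where
  continuous := zetaQ_continuous
  map_mul := by
    refine LinearMap.ext fun T => PowerSeries.ext fun n => ?_
    rw [LinearMap.comp_apply, LinearMap.comp_apply, coeff_zetaQ, coeff_powerSeriesMul]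
    change MvPowerSeries.coeff _ (mqsymMul R T : MvPowerSeries ℕ+ R) = _
    rw [coeff_mqsymMul, Finsupp.antidiagonal_single, Finset.sum_map]
    refine Finset.sum_congr rfl fun p _ => ?_
    rw [cmap_apply, LCModule.coordinates_powerSeries, coeff_zetaQ, coeff_coordinates_symm,
      LCModule.coordinates_powerSeries, coeff_zetaQ, coeff_coordinates_symm]
    rfl
  map_unit r := by
    refine PowerSeries.ext fun n => ?_
    change PowerSeries.coeff n (zetaQ R (r • (⟨1, one_mem_MQSym R⟩ : MQSym R))) = _
    classical
    rw [coeff_zetaQ]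
    change MvPowerSeries.coeff _ (r • (1 : MvPowerSeries ℕ+ R)) = _
    rw [MvPowerSeries.coeff_smul, MvPowerSeries.coeff_one]
    simp [PowerSeries.coeff_C]
  constantCoeff f := by
    rw [← PowerSeries.coeff_zero_eq_constantCoeff_apply, coeff_zetaQ, coeff_mqsym,
      Finsupp.single_zero, pack_zero]
    rfl

end QSym

/-! ### Splittings of posets -/

namespace MarkedPoset

theorem IsIso.cls_eq {X Y : MarkedPoset} {φ : X.carrier ≃o Y.carrier} (h : IsIso X Y φ) :
    X.cls = Y.cls :=
  Quotient.sound (s := setoid) ⟨φ, h⟩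

/-- The pairs indexing the coproduct. -/
abbrev Splitting (X : MarkedPoset) : Type :=
  {p : Set X.carrier × Set X.carrier // IsSplitting p.1 p.2}

noncomputable instance (X : MarkedPoset) : Fintype X.Splitting := Fintype.ofFinite _

namespace Splitting

variable {X : MarkedPoset} (p : X.Splitting)

/-- The lower part of a splitting. -/
def low : MarkedPoset := X.restrict p.1.1 p.2.lower.ordConnected

/-- The upper part of a splitting. -/
def upp : MarkedPoset := X.restrict p.1.2 p.2.upper.ordConnected

/-- The number of elements common to both parts. -/
noncomputable def overlap : ℕ := (p.1.1 ∩ p.1.2).ncard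

/-- Inclusion–exclusion. Through this identity the overlaps in disjoint unions and in iterated
splittings are found by counting parts instead of by computing intersections. -/
theorem card_low_add_card_upp :
    Nat.card p.low.carrier + Nat.card p.upp.carrier = Nat.card X.carrier + p.overlap := by
  change Nat.card p.1.1 + Nat.card p.1.2 = _
  rw [Nat.card_coe_set_eq, Nat.card_coe_set_eq, overlap, ← Set.ncard_union_add_ncard_inter,
    p.2.union_eq, Set.ncard_univ]

end Splitting

theorem restrict_univ (X : MarkedPoset) (h : (Set.univ : Set X.carrier).OrdConnected) :
    (X.restrict Set.univ h).cls = X.cls := by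
  let φ : (X.restrict Set.univ h).carrier ≃o X.carrier := OrderIso.Set.univ
  refine IsIso.cls_eq (φ := φ) ⟨fun _ _ _ => Iff.rfl, ?_⟩
  ext x
  exact ⟨fun ⟨y, hy, hyx⟩ => hyx ▸ hy, fun hx => ⟨⟨x, trivial⟩, hx, rfl⟩⟩

theorem ordConnected_image_coe {P : Type*} [PartialOrder P] {S : Set P} (hS : S.OrdConnected)
    {S' : Set S} (hS' : S'.OrdConnected) : (Subtype.val '' S').OrdConnected := by
  refine ⟨?_⟩
  rintro _ ⟨a, ha, rfl⟩ _ ⟨b, hb, rfl⟩ c hc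
  exact ⟨⟨c, hS.out a.2 b.2 hc⟩, hS'.out ha hb hc, rfl⟩

theorem restrict_restrict (X : MarkedPoset) (S : Set X.carrier) (hS : S.OrdConnected)
    (S' : Set (X.restrict S hS).carrier) (hS' : S'.OrdConnected)
    (h : (Subtype.val '' S' : Set X.carrier).OrdConnected) :
    ((X.restrict S hS).restrict S' hS').cls = (X.restrict (Subtype.val '' S') h).cls := by
  let φ : ((X.restrict S hS).restrict S' hS').carrier ≃o (X.restrict (Subtype.val '' S') h).carrier :=
    { toEquiv := Equiv.Set.image (Subtype.val : S → X.carrier) S' Subtype.val_injective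
      map_rel_iff' := Iff.rfl }
  refine IsIso.cls_eq (φ := φ) ⟨fun _ _ _ => Iff.rfl, ?_⟩
  ext ⟨_, x, hx, rfl⟩
  constructor
  · rintro ⟨y, hy, hyx⟩
    have h1 : y.1.1 = x.1 :=
      congrArg (fun z : (Subtype.val '' S' : Set X.carrier) => (z : X.carrier)) hyx
    change x.1 ∈ X.marked
    rw [← h1]
    exact hy
  · exact fun hm => ⟨⟨x, hx⟩, hm, rfl⟩

theorem cls_eq_empty_iff (X : MarkedPoset) : X.cls = empty.cls ↔ IsEmpty X.carrier := by
  constructor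
  · intro h
    obtain ⟨φ, -⟩ := Quotient.exact (s := setoid) h
    exact φ.toEquiv.isEmpty_congr.2 (inferInstanceAs (IsEmpty Empty))
  · intro h
    have h' : IsEmpty empty.carrier := inferInstanceAs (IsEmpty Empty)
    exact IsIso.cls_eq (φ := ⟨Equiv.equivOfIsEmpty _ _, fun {a} => isEmptyElim a⟩)
      ⟨fun a => isEmptyElim a, by ext a; exact isEmptyElim a⟩

theorem union_empty_cls (X : MarkedPoset) : (X.union empty).cls = X.cls := by
  have h' : IsEmpty empty.carrier := inferInstanceAs (IsEmpty Empty)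
  let φ : X.carrier ≃o (X.union empty).carrier :=
    { toEquiv := (Equiv.sumEmpty X.carrier empty.carrier).symm
      map_rel_iff' := Sum.inl_le_inl_iff }
  refine (IsIso.cls_eq (φ := φ) ⟨fun s t _ => ?_, ?_⟩).symm
  · change _ ↔ sumLabel X.label empty.label (Sum.inl s) > sumLabel X.label empty.label (Sum.inl t)
    simp [sumLabel]
  · change Sum.inl '' X.marked = Sum.inl '' X.marked ∪ Sum.inr '' empty.marked
    rw [Set.eq_empty_of_isEmpty empty.marked, Set.image_empty, Set.union_empty]

theorem empty_union_cls (X : MarkedPoset) : (empty.union X).cls = X.cls := by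
  have h' : IsEmpty empty.carrier := inferInstanceAs (IsEmpty Empty)
  let φ : X.carrier ≃o (empty.union X).carrier :=
    { toEquiv := (Equiv.emptySum empty.carrier X.carrier).symm
      map_rel_iff' := Sum.inr_le_inr_iff }
  refine (IsIso.cls_eq (φ := φ) ⟨fun s t _ => ?_, ?_⟩).symm
  · change _ ↔ sumLabel empty.label X.label (Sum.inr s) > sumLabel empty.label X.label (Sum.inr t)
    simp [sumLabel]
  · change Sum.inr '' X.marked = Sum.inl '' empty.marked ∪ Sum.inr '' X.marked
    rw [Set.eq_empty_of_isEmpty empty.marked, Set.image_empty, Set.empty_union]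

theorem sumLabel_inl_lt {P Q : Type*} (γ : P → ℤ) (δ : Q → ℤ) (s t : P) :
    sumLabel γ δ (Sum.inl s) < sumLabel γ δ (Sum.inl t) ↔ γ s < γ t := by simp [sumLabel]

theorem sumLabel_inr_lt {P Q : Type*} (γ : P → ℤ) (δ : Q → ℤ) (s t : Q) :
    sumLabel γ δ (Sum.inr s) < sumLabel γ δ (Sum.inr t) ↔ δ s < δ t := by simp [sumLabel]

/-- The shifts in the labels depend on the bracketing, but an isomorphism only compares labels along
covers, and a cover lies inside a single summand, where every shift is constant. -/
theorem union_assoc_cls (X Y Z : MarkedPoset) :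
    ((X.union Y).union Z).cls = (X.union (Y.union Z)).cls := by
  let φ : ((X.union Y).union Z).carrier ≃o (X.union (Y.union Z)).carrier :=
    OrderIso.sumAssoc X.carrier Y.carrier Z.carrier
  refine IsIso.cls_eq (φ := φ) ⟨?_, ?_⟩
  · rintro ((s | s) | s) ((t | t) | t) hst
    · exact ((sumLabel_inl_lt _ Z.label _ _).trans (sumLabel_inl_lt _ _ _ _)).trans
        (sumLabel_inl_lt X.label (Y.union Z).label t s).symm
    · exact (Sum.not_inl_lt_inr (Sum.inl_lt_inl_iff.1 hst.1)).elim
    · exact (Sum.not_inl_lt_inr hst.1).elim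
    · exact (Sum.not_inr_lt_inl (Sum.inl_lt_inl_iff.1 hst.1)).elim
    · exact ((sumLabel_inl_lt _ Z.label _ _).trans (sumLabel_inr_lt _ _ _ _)).trans
        ((sumLabel_inr_lt X.label (Y.union Z).label (Sum.inl t) (Sum.inl s)).trans
          (sumLabel_inl_lt _ Z.label _ _)).symm
    · exact (Sum.not_inl_lt_inr hst.1).elim
    · exact (Sum.not_inr_lt_inl hst.1).elim
    · exact (Sum.not_inr_lt_inl hst.1).elim
    · exact (sumLabel_inr_lt (X.union Y).label _ _ _).trans
        ((sumLabel_inr_lt X.label (Y.union Z).label (Sum.inr t) (Sum.inr s)).trans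
          (sumLabel_inr_lt Y.label _ _ _)).symm
  · change Equiv.sumAssoc _ _ _ '' (Sum.inl '' (Sum.inl '' X.marked ∪ Sum.inr '' Y.marked) ∪
      Sum.inr '' Z.marked) = Sum.inl '' X.marked ∪
        Sum.inr '' (Sum.inl '' Y.marked ∪ Sum.inr '' Z.marked)
    simp [Set.image_union, Set.image_image, Set.union_assoc]

/-- A subset of a disjoint union is the disjoint union of its two parts. -/
def sumPreimage {P Q : Type*} [PartialOrder P] [PartialOrder Q] (S : Set (P ⊕ Q)) :
    (Sum.inl ⁻¹' S : Set P) ⊕ (Sum.inr ⁻¹' S : Set Q) ≃o S where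
  toFun := Sum.elim (fun a => ⟨Sum.inl a, a.2⟩) fun a => ⟨Sum.inr a, a.2⟩
  invFun := fun x => match x with
    | ⟨Sum.inl a, h⟩ => Sum.inl ⟨a, h⟩
    | ⟨Sum.inr a, h⟩ => Sum.inr ⟨a, h⟩
  left_inv := by rintro (a | a) <;> rfl
  right_inv := by rintro ⟨a | a, h⟩ <;> rfl
  map_rel_iff' := by
    rintro (a | a) (b | b)
    · exact Sum.inl_le_inl_iff.trans (Sum.inl_le_inl_iff (a := a) (b := b)).symm
    · exact iff_of_false Sum.not_inl_le_inr Sum.not_inl_le_inr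
    · exact iff_of_false Sum.not_inr_le_inl Sum.not_inr_le_inl
    · exact Sum.inr_le_inr_iff.trans (Sum.inr_le_inr_iff (a := a) (b := b)).symm

/-- The normalizing maxima and minima are taken over different sets on the two sides. Comparisons
along covers are unaffected, because each summand is merely translated. -/
theorem restrict_union (X Y : MarkedPoset) (S : Set (X.carrier ⊕ Y.carrier))
    (hS : S.OrdConnected) (hl : (Sum.inl ⁻¹' S : Set X.carrier).OrdConnected)
    (hr : (Sum.inr ⁻¹' S : Set Y.carrier).OrdConnected) :
    ((X.restrict (Sum.inl ⁻¹' S) hl).union (Y.restrict (Sum.inr ⁻¹' S) hr)).cls =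
      ((X.union Y).restrict S hS).cls := by
  let φ : ((X.restrict (Sum.inl ⁻¹' S) hl).union (Y.restrict (Sum.inr ⁻¹' S) hr)).carrier ≃o
    ((X.union Y).restrict S hS).carrier := sumPreimage S
  refine IsIso.cls_eq (φ := φ) ⟨?_, ?_⟩
  · rintro (s | s) (t | t) hst
    · exact (sumLabel_inl_lt _ (Y.restrict _ hr).label _ _).trans
        (sumLabel_inl_lt X.label Y.label (Subtype.val t) (Subtype.val s)).symm
    · exact (Sum.not_inl_lt_inr hst.1).elim
    · exact (Sum.not_inr_lt_inl hst.1).elim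
    · exact (sumLabel_inr_lt (X.restrict _ hl).label _ _ _).trans
        (sumLabel_inr_lt X.label Y.label (Subtype.val t) (Subtype.val s)).symm
  · ext ⟨x | x, hx⟩
    · constructor
      · rintro ⟨y | y, hy, hyx⟩
        · obtain ⟨z, hz, hzy⟩ | ⟨z, hz, hzy⟩ := hy
          · obtain rfl := Sum.inl_injective hzy
            obtain rfl := Sum.inl_injective (congrArg Subtype.val hyx)
            exact Or.inl ⟨_, hz, rfl⟩
          · cases hzy
        · cases congrArg Subtype.val hyx
      · rintro (⟨z, hz, hzx⟩ | ⟨z, hz, hzx⟩)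
        · obtain rfl := Sum.inl_injective hzx
          exact ⟨Sum.inl ⟨z, hx⟩, Or.inl ⟨⟨z, hx⟩, hz, rfl⟩, rfl⟩
        · cases hzx
    · constructor
      · rintro ⟨y | y, hy, hyx⟩
        · cases congrArg Subtype.val hyx
        · obtain ⟨z, hz, hzy⟩ | ⟨z, hz, hzy⟩ := hy
          · cases hzy
          · obtain rfl := Sum.inr_injective hzy
            obtain rfl := Sum.inr_injective (congrArg Subtype.val hyx)
            exact Or.inr ⟨_, hz, rfl⟩
      · rintro (⟨z, hz, hzx⟩ | ⟨z, hz, hzx⟩)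
        · cases hzx
        · obtain rfl := Sum.inr_injective hzx
          exact ⟨Sum.inr ⟨z, hx⟩, Or.inr ⟨⟨z, hx⟩, hz, rfl⟩, rfl⟩

theorem isSplitting_sum_iff {P Q : Type*} [PartialOrder P] [PartialOrder Q] {S T : Set (P ⊕ Q)} :
    IsSplitting S T ↔ IsSplitting (Sum.inl ⁻¹' S) (Sum.inl ⁻¹' T) ∧
      IsSplitting (Sum.inr ⁻¹' S) (Sum.inr ⁻¹' T) := by
  constructor
  · intro h
    refine ⟨⟨fun a b hab ha => h.lower (Sum.inl_le_inl_iff.2 hab) ha,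
      fun a b hab ha => h.upper (Sum.inl_le_inl_iff.2 hab) ha, ?_,
      fun a ha b hb hab hle => h.antichain ha hb (by simpa using hab) (Sum.inl_le_inl_iff.2 hle)⟩,
      ⟨fun a b hab ha => h.lower (Sum.inr_le_inr_iff.2 hab) ha,
      fun a b hab ha => h.upper (Sum.inr_le_inr_iff.2 hab) ha, ?_,
      fun a ha b hb hab hle => h.antichain ha hb (by simpa using hab) (Sum.inr_le_inr_iff.2 hle)⟩⟩
    · rw [← Set.preimage_union, h.union_eq, Set.preimage_univ]
    · rw [← Set.preimage_union, h.union_eq, Set.preimage_univ]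
  · rintro ⟨h, h'⟩
    refine ⟨?_, ?_, ?_, ?_⟩
    · rintro (a | a) (b | b) hab ha
      · exact h.lower (Sum.inl_le_inl_iff.1 hab) ha
      · exact (Sum.not_inr_le_inl hab).elim
      · exact (Sum.not_inl_le_inr hab).elim
      · exact h'.lower (Sum.inr_le_inr_iff.1 hab) ha
    · rintro (a | a) (b | b) hab ha
      · exact h.upper (Sum.inl_le_inl_iff.1 hab) ha
      · exact (Sum.not_inl_le_inr hab).elim
      · exact (Sum.not_inr_le_inl hab).elim
      · exact h'.upper (Sum.inr_le_inr_iff.1 hab) ha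
    · refine Set.eq_univ_of_forall ?_
      rintro (a | a)
      · exact (Set.ext_iff.1 h.union_eq a).2 trivial
      · exact (Set.ext_iff.1 h'.union_eq a).2 trivial
    · rintro (a | a) ha (b | b) hb hab hle
      · exact h.antichain ha hb (fun he => hab (by rw [he])) (Sum.inl_le_inl_iff.1 hle)
      · exact (Sum.not_inl_le_inr hle).elim
      · exact (Sum.not_inr_le_inl hle).elim
      · exact h'.antichain ha hb (fun he => hab (by rw [he])) (Sum.inr_le_inr_iff.1 hle)

theorem preimage_inl_union {P Q : Type*} (S : Set P) (T : Set Q) :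
    (Sum.inl ⁻¹' (Sum.inl '' S ∪ Sum.inr '' T) : Set P) = S := by ext; simp

theorem preimage_inr_union {P Q : Type*} (S : Set P) (T : Set Q) :
    (Sum.inr ⁻¹' (Sum.inl '' S ∪ Sum.inr '' T) : Set Q) = T := by ext; simp

/-- Splittings of a disjoint union are pairs of splittings. -/
def unionSplittingEquiv (X Y : MarkedPoset) : (X.union Y).Splitting ≃ X.Splitting × Y.Splitting where
  toFun p := ⟨⟨(Sum.inl ⁻¹' p.1.1, Sum.inl ⁻¹' p.1.2), (isSplitting_sum_iff.1 p.2).1⟩,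
    ⟨(Sum.inr ⁻¹' p.1.1, Sum.inr ⁻¹' p.1.2), (isSplitting_sum_iff.1 p.2).2⟩⟩
  invFun q := ⟨(Sum.inl '' q.1.1.1 ∪ Sum.inr '' q.2.1.1, Sum.inl '' q.1.1.2 ∪ Sum.inr '' q.2.1.2), by
    refine isSplitting_sum_iff.2 ⟨?_, ?_⟩
    · exact (congrArg₂ IsSplitting (preimage_inl_union _ _) (preimage_inl_union _ _)).mpr q.1.2
    · exact (congrArg₂ IsSplitting (preimage_inr_union _ _) (preimage_inr_union _ _)).mpr q.2.2⟩
  left_inv p := Subtype.ext (Prod.ext (Set.image_preimage_inl_union_image_preimage_inr _)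
    (Set.image_preimage_inl_union_image_preimage_inr _))
  right_inv q := Prod.ext
    (Subtype.ext (Prod.ext (preimage_inl_union _ _) (preimage_inl_union _ _)))
    (Subtype.ext (Prod.ext (preimage_inr_union _ _) (preimage_inr_union _ _)))

variable {X Y : MarkedPoset} (p : (X.union Y).Splitting)

theorem low_unionSplitting : p.low.cls =
    ((unionSplittingEquiv X Y p).1.low.union (unionSplittingEquiv X Y p).2.low).cls :=
  (restrict_union X Y _ _ _ _).symm

theorem upp_unionSplitting : p.upp.cls =
    ((unionSplittingEquiv X Y p).1.upp.union (unionSplittingEquiv X Y p).2.upp).cls :=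
  (restrict_union X Y _ _ _ _).symm

theorem overlap_unionSplitting : p.overlap =
    (unionSplittingEquiv X Y p).1.overlap + (unionSplittingEquiv X Y p).2.overlap := by
  have h := p.card_low_add_card_upp
  have h1 := (unionSplittingEquiv X Y p).1.card_low_add_card_upp
  have h2 := (unionSplittingEquiv X Y p).2.card_low_add_card_upp
  have h3 : Nat.card p.low.carrier = Nat.card (_ ⊕ _) :=
    card_congr (Quotient.exact (s := setoid) (low_unionSplitting p))
  have h4 : Nat.card p.upp.carrier = Nat.card (_ ⊕ _) :=
    card_congr (Quotient.exact (s := setoid) (upp_unionSplitting p))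
  have h5 : Nat.card (X.union Y).carrier = Nat.card X.carrier + Nat.card Y.carrier := Nat.card_sum
  rw [Nat.card_sum] at h3 h4
  omega

end MarkedPoset

namespace MarkedPoset

/-! ### Convolution of functions on isomorphism classes -/

section Convolution

variable {K : Type*} [CommRing K]

/-- The convolution product with parameter `b` of functions of isomorphism classes, evaluated
at `X`. -/
noncomputable def convolve (b : K) (f g : MarkedPosetClass → K) (X : MarkedPoset) : K :=
  ∑ p : X.Splitting, b ^ p.overlap * (f p.low.cls * g p.upp.cls)

/-- Isomorphic posets have the same splittings. -/
def splittingEquiv {X Y : MarkedPoset} (φ : X.carrier ≃o Y.carrier) :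
    X.Splitting ≃ Y.Splitting where
  toFun p := ⟨(φ '' p.1.1, φ '' p.1.2), p.2.image φ⟩
  invFun p := ⟨(φ.symm '' p.1.1, φ.symm '' p.1.2), p.2.image φ.symm⟩
  left_inv p := by apply Subtype.ext; apply Prod.ext <;> simp [← Set.image_comp]
  right_inv p := by apply Subtype.ext; apply Prod.ext <;> simp [← Set.image_comp]

theorem convolve_congr (b : K) (f g : MarkedPosetClass → K) {X Y : MarkedPoset} (h : X ≈ Y) :
    convolve b f g X = convolve b f g Y := by
  obtain ⟨φ, h⟩ := h
  refine Fintype.sum_equiv (splittingEquiv φ) _ _ fun p => ?_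
  have h1 : p.low.cls = (splittingEquiv φ p).low.cls :=
    Quotient.sound (s := setoid) (restrict_congr h p.1.1 p.2.lower.ordConnected
      _ (splittingEquiv φ p).2.lower.ordConnected rfl)
  have h2 : p.upp.cls = (splittingEquiv φ p).upp.cls :=
    Quotient.sound (s := setoid) (restrict_congr h p.1.2 p.2.upper.ordConnected
      _ (splittingEquiv φ p).2.upper.ordConnected rfl)
  have h3 : p.overlap = (splittingEquiv φ p).overlap := by
    change _ = (φ '' p.1.1 ∩ φ '' p.1.2).ncard
    rw [← Set.image_inter φ.injective, Set.ncard_image_of_injective _ φ.injective]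
    rfl
  rw [h1, h2, h3]

end Convolution

/-! ### Iterated splittings and coassociativity -/

/-- The triples indexing the iterated coproduct. -/
structure IsTriple {P : Type*} [PartialOrder P] (A B C : Set P) : Prop where
  lower : IsLowerSet A
  lower' : IsLowerSet (A ∪ B)
  ordConnected : B.OrdConnected
  upper' : IsUpperSet (B ∪ C)
  upper : IsUpperSet C
  union_eq : A ∪ B ∪ C = Set.univ
  antichain : IsAntichain (· ≤ ·) (A ∩ (B ∪ C))
  antichain' : IsAntichain (· ≤ ·) ((A ∪ B) ∩ C)

/-- The triples indexing the iterated coproduct of `X`. -/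
abbrev Triple (X : MarkedPoset) : Type :=
  {t : Set X.carrier × Set X.carrier × Set X.carrier // IsTriple t.1 t.2.1 t.2.2}

noncomputable instance (X : MarkedPoset) : Fintype X.Triple := Fintype.ofFinite _

namespace Triple

variable {X : MarkedPoset} (t : X.Triple)

/-- The lower part. -/
def fst : MarkedPoset := X.restrict t.1.1 t.2.lower.ordConnected

/-- The middle part. -/
def snd : MarkedPoset := X.restrict t.1.2.1 t.2.ordConnected

/-- The upper part. -/
def thd : MarkedPoset := X.restrict t.1.2.2 t.2.upper.ordConnected

/-- The total overlap of the parts. -/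
noncomputable def overlap : ℕ :=
  t.1.1.ncard + t.1.2.1.ncard + t.1.2.2.ncard - Nat.card X.carrier

end Triple

section

variable {P : Type*} [PartialOrder P]

/-- The two conditions that mix the splittings concern `B ∪ T`. An element above `B` either is still
in `S`, where `B` is upward closed, or lies in `T`. A non-maximal element of `A ∩ (B ∪ T)` would
contradict the antichain condition of one of the two splittings. -/
theorem isTriple_of_low {S T : Set P} (h : IsSplitting S T) {A B : Set S} (h' : IsSplitting A B) :
    IsTriple (Subtype.val '' A) (Subtype.val '' B) T := by
  have hAB : (Subtype.val '' A ∪ Subtype.val '' B : Set P) = S := by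
    rw [← Set.image_union, h'.union_eq, Set.image_univ, Subtype.range_coe]
  refine ⟨?_, (by rw [hAB]; exact h.lower), ordConnected_image_coe h.lower.ordConnected h'.upper.ordConnected,
    ?_, h.upper, by rw [hAB]; exact h.union_eq, ?_, by rw [hAB]; exact h.antichain⟩
  · rintro _ b hb ⟨a, ha, rfl⟩
    exact ⟨⟨b, h.lower hb a.2⟩, h'.lower (show (⟨b, h.lower hb a.2⟩ : S) ≤ a from hb) ha, rfl⟩
  · rintro a b hab (⟨a, ha, rfl⟩ | ha)
    · by_cases hb : b ∈ S
      · exact Or.inl ⟨⟨b, hb⟩, h'.upper (show a ≤ ⟨b, hb⟩ from hab) ha, rfl⟩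
      · exact Or.inr (((Set.ext_iff.1 h.union_eq b).2 trivial).resolve_left hb)
    · exact Or.inr (h.upper hab ha)
  · rintro _ ⟨⟨a, ha, rfl⟩, ha'⟩ _ ⟨⟨b, hb, rfl⟩, -⟩ hab hle
    obtain ⟨a', ha', haa⟩ | ha' := ha'
    · obtain rfl := Subtype.val_injective haa
      exact h'.antichain ⟨ha, ha'⟩ ⟨hb, h'.upper (show a' ≤ b from hle) ha'⟩
        (fun he => hab (congrArg _ he)) hle
    · exact h.antichain ⟨a.2, ha'⟩ ⟨b.2, h.upper hle ha'⟩ hab hle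

theorem isTriple_of_upp {S T : Set P} (h : IsSplitting S T) {A B : Set T} (h' : IsSplitting A B) :
    IsTriple S (Subtype.val '' A) (Subtype.val '' B) := by
  have hAB : (Subtype.val '' A ∪ Subtype.val '' B : Set P) = T := by
    rw [← Set.image_union, h'.union_eq, Set.image_univ, Subtype.range_coe]
  refine ⟨h.lower, ?_, ordConnected_image_coe h.upper.ordConnected h'.lower.ordConnected,
    (by rw [hAB]; exact h.upper), ?_, by rw [Set.union_assoc, hAB]; exact h.union_eq, by rw [hAB]; exact h.antichain, ?_⟩
  · rintro a b hab (ha | ⟨a, ha, rfl⟩)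
    · exact Or.inl (h.lower hab ha)
    · by_cases hb : b ∈ T
      · exact Or.inr ⟨⟨b, hb⟩, h'.lower (show (⟨b, hb⟩ : T) ≤ a from hab) ha, rfl⟩
      · exact Or.inl (((Set.ext_iff.1 h.union_eq b).2 trivial).resolve_right hb)
  · rintro _ b hb ⟨a, ha, rfl⟩
    exact ⟨⟨b, h.upper hb a.2⟩, h'.upper (show a ≤ (⟨b, h.upper hb a.2⟩ : T) from hb) ha, rfl⟩
  · rintro _ ⟨-, ⟨a, ha, rfl⟩⟩ _ ⟨hb', ⟨b, hb, rfl⟩⟩ hab hle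
    obtain hb' | ⟨b', hb', hbb⟩ := hb'
    · exact h.antichain ⟨h.lower hle hb', a.2⟩ ⟨hb', b.2⟩ hab hle
    · obtain rfl := Subtype.val_injective hbb
      exact h'.antichain ⟨h'.lower (show a ≤ b' from hle) hb', ha⟩ ⟨hb', hb⟩
        (fun he => hab (congrArg _ he)) hle

theorem IsTriple.left {A B C : Set P} (h : IsTriple A B C) : IsSplitting (A ∪ B) C :=
  ⟨h.lower', h.upper, h.union_eq, h.antichain'⟩

theorem IsTriple.right {A B C : Set P} (h : IsTriple A B C) : IsSplitting A (B ∪ C) :=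
  ⟨h.lower, h.upper', by rw [← Set.union_assoc, h.union_eq], h.antichain⟩

/-- Upward closure of `B` inside `A ∪ B` has to be derived. If `a ∈ B` lies below some `b ∈ A`
outside `B`, then `b ∈ C`, so `a` and `b` are comparable elements of the antichain `A ∩ (B ∪ C)`. -/
theorem IsTriple.left_left {A B C : Set P} (h : IsTriple A B C) :
    IsSplitting ((Subtype.val : ↥(A ∪ B) → P) ⁻¹' A) (Subtype.val ⁻¹' B) := by
  refine ⟨fun a b hab ha => h.lower hab ha, fun a b hab ha => ?_, ?_, ?_⟩
  · by_contra hb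
    have hbA : b.1 ∈ A := b.2.resolve_right hb
    have hbC : b.1 ∈ C := (h.upper' (show a.1 ≤ b.1 from hab) (Or.inl ha)).resolve_left hb
    have hne : a.1 ≠ b.1 := fun he => hb (show b.1 ∈ B from he ▸ ha)
    exact h.antichain ⟨h.lower (show a.1 ≤ b.1 from hab) hbA, Or.inl ha⟩ ⟨hbA, Or.inr hbC⟩ hne hab
  · exact Set.eq_univ_of_forall fun a => a.2
  · rintro a ⟨ha, ha'⟩ b ⟨hb, hb'⟩ hab hle
    exact h.antichain ⟨ha, Or.inl ha'⟩ ⟨hb, Or.inl hb'⟩ (fun he => hab (Subtype.ext he)) hle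

theorem IsTriple.right_right {A B C : Set P} (h : IsTriple A B C) :
    IsSplitting ((Subtype.val : ↥(B ∪ C) → P) ⁻¹' B) (Subtype.val ⁻¹' C) := by
  refine ⟨fun b a hab hb => ?_, fun a b hab ha => h.upper hab ha, ?_, ?_⟩
  · by_contra ha
    have haC : a.1 ∈ C := a.2.resolve_left ha
    have haA : a.1 ∈ A := (h.lower' (show a.1 ≤ b.1 from hab) (Or.inr hb)).resolve_right ha
    have hne : a.1 ≠ b.1 := fun he => ha (show a.1 ∈ B from he ▸ hb)
    exact h.antichain' ⟨Or.inl haA, haC⟩ ⟨Or.inr hb, h.upper (show a.1 ≤ b.1 from hab) haC⟩ hne hab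
  · exact Set.eq_univ_of_forall fun a => a.2
  · rintro a ⟨ha, ha'⟩ b ⟨hb, hb'⟩ hab hle
    exact h.antichain' ⟨Or.inr ha, ha'⟩ ⟨Or.inr hb, hb'⟩ (fun he => hab (Subtype.ext he)) hle

end

variable {X : MarkedPoset}

/-- The triple given by a splitting and a splitting of its lower part. -/
def tripleOfLow (x : Σ p : X.Splitting, p.low.Splitting) : X.Triple :=
  ⟨(Subtype.val '' (show Set x.1.1.1 from x.2.1.1), Subtype.val '' (show Set x.1.1.1 from x.2.1.2),
    x.1.1.2), isTriple_of_low x.1.2 x.2.2⟩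

/-- The triple given by a splitting and a splitting of its upper part. -/
def tripleOfUpp (x : Σ p : X.Splitting, p.upp.Splitting) : X.Triple :=
  ⟨(x.1.1.1, Subtype.val '' (show Set x.1.1.2 from x.2.1.1),
    Subtype.val '' (show Set x.1.1.2 from x.2.1.2)), isTriple_of_upp x.1.2 x.2.2⟩

/-- The outer splitting is recovered as `(A ∪ B, C)`, and the inner one by viewing `A` and `B` as
subsets of `A ∪ B`. -/
theorem tripleOfLow_bijective : Function.Bijective (tripleOfLow (X := X)) := by
  have hunion : ∀ x : Σ p : X.Splitting, p.low.Splitting,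
      (tripleOfLow x).1.1 ∪ (tripleOfLow x).1.2.1 = x.1.1.1 := by
    rintro ⟨⟨⟨S, T⟩, h⟩, ⟨⟨A, B⟩, h'⟩⟩
    change (Subtype.val '' (show Set S from A) ∪ Subtype.val '' (show Set S from B)) = S
    rw [← Set.image_union]
    refine Eq.trans (congrArg _ h'.union_eq) ?_
    exact Set.image_univ.trans Subtype.range_coe
  constructor
  · intro x y hxy
    have h1 : x.1 = y.1 := by
      refine Subtype.ext (Prod.ext ?_ (congrArg (fun t => t.1.2.2) hxy))
      rw [← hunion x, ← hunion y, hxy]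
    obtain ⟨p, q⟩ := x
    obtain ⟨p', q'⟩ := y
    obtain rfl : p = p' := h1
    refine congrArg _ (Subtype.ext (Prod.ext ?_ ?_))
    · exact Set.image_injective.2 Subtype.val_injective (congrArg (fun t => t.1.1) hxy)
    · exact Set.image_injective.2 Subtype.val_injective (congrArg (fun t => t.1.2.1) hxy)
  · rintro ⟨⟨A, B, C⟩, h⟩
    refine ⟨⟨⟨(A ∪ B, C), h.left⟩, ⟨(Subtype.val ⁻¹' A, Subtype.val ⁻¹' B), h.left_left⟩⟩,
      Subtype.ext (Prod.ext ?_ (Prod.ext ?_ rfl))⟩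
    · exact (Subtype.image_preimage_coe _ _).trans (Set.inter_eq_right.2 Set.subset_union_left)
    · exact (Subtype.image_preimage_coe _ _).trans (Set.inter_eq_right.2 Set.subset_union_right)

theorem tripleOfUpp_bijective : Function.Bijective (tripleOfUpp (X := X)) := by
  have hunion : ∀ x : Σ p : X.Splitting, p.upp.Splitting,
      (tripleOfUpp x).1.2.1 ∪ (tripleOfUpp x).1.2.2 = x.1.1.2 := by
    rintro ⟨⟨⟨S, T⟩, h⟩, ⟨⟨A, B⟩, h'⟩⟩
    change (Subtype.val '' (show Set T from A) ∪ Subtype.val '' (show Set T from B)) = T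
    rw [← Set.image_union]
    refine Eq.trans (congrArg _ h'.union_eq) ?_
    exact Set.image_univ.trans Subtype.range_coe
  constructor
  · intro x y hxy
    have h1 : x.1 = y.1 := by
      refine Subtype.ext (Prod.ext (congrArg (fun t => t.1.1) hxy) ?_)
      rw [← hunion x, ← hunion y, hxy]
    obtain ⟨p, q⟩ := x
    obtain ⟨p', q'⟩ := y
    obtain rfl : p = p' := h1
    refine congrArg _ (Subtype.ext (Prod.ext ?_ ?_))
    · exact Set.image_injective.2 Subtype.val_injective (congrArg (fun t => t.1.2.1) hxy)
    · exact Set.image_injective.2 Subtype.val_injective (congrArg (fun t => t.1.2.2) hxy)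
  · rintro ⟨⟨A, B, C⟩, h⟩
    refine ⟨⟨⟨(A, B ∪ C), h.right⟩, ⟨(Subtype.val ⁻¹' B, Subtype.val ⁻¹' C), h.right_right⟩⟩,
      Subtype.ext (Prod.ext rfl (Prod.ext ?_ ?_))⟩
    · exact (Subtype.image_preimage_coe _ _).trans (Set.inter_eq_right.2 Set.subset_union_left)
    · exact (Subtype.image_preimage_coe _ _).trans (Set.inter_eq_right.2 Set.subset_union_right)

/-- The overlap of a triple counts the parts with no reference to the order of splitting. Applying
inclusion–exclusion to both splittings identifies it with the sum of their overlaps, hence with the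
exponent of β in an iterated coproduct. -/
theorem overlap_tripleOfLow (x : Σ p : X.Splitting, p.low.Splitting) :
    (tripleOfLow x).overlap = x.1.overlap + x.2.overlap := by
  have h := x.1.card_low_add_card_upp
  have h' := x.2.card_low_add_card_upp
  have h1 : (tripleOfLow x).1.1.ncard = Nat.card x.2.low.carrier :=
    Set.ncard_image_of_injective _ Subtype.val_injective
  have h2 : (tripleOfLow x).1.2.1.ncard = Nat.card x.2.upp.carrier :=
    Set.ncard_image_of_injective _ Subtype.val_injective
  have h3 : (tripleOfLow x).1.2.2.ncard = Nat.card x.1.upp.carrier := rfl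
  rw [Triple.overlap]
  omega

theorem overlap_tripleOfUpp (x : Σ p : X.Splitting, p.upp.Splitting) :
    (tripleOfUpp x).overlap = x.1.overlap + x.2.overlap := by
  have h := x.1.card_low_add_card_upp
  have h' := x.2.card_low_add_card_upp
  have h1 : (tripleOfUpp x).1.1.ncard = Nat.card x.1.low.carrier := rfl
  have h2 : (tripleOfUpp x).1.2.1.ncard = Nat.card x.2.low.carrier :=
    Set.ncard_image_of_injective _ Subtype.val_injective
  have h3 : (tripleOfUpp x).1.2.2.ncard = Nat.card x.2.upp.carrier :=
    Set.ncard_image_of_injective _ Subtype.val_injective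
  rw [Triple.overlap]
  omega

/-- Sums over iterated splittings do not depend on which part is split again. -/
theorem sum_splitting_low_eq_sum_splitting_upp {M : Type*} [AddCommMonoid M]
    (F : ℕ → MarkedPosetClass → MarkedPosetClass → MarkedPosetClass → M) :
    ∑ p : X.Splitting, ∑ q : p.low.Splitting,
        F (p.overlap + q.overlap) q.low.cls q.upp.cls p.upp.cls =
      ∑ p : X.Splitting, ∑ q : p.upp.Splitting,
        F (p.overlap + q.overlap) p.low.cls q.low.cls q.upp.cls := by
  rw [← Fintype.sum_sigma' (f := fun (p : X.Splitting) (q : p.low.Splitting) =>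
      F (p.overlap + q.overlap) q.low.cls q.upp.cls p.upp.cls),
    ← Fintype.sum_sigma' (f := fun (p : X.Splitting) (q : p.upp.Splitting) =>
      F (p.overlap + q.overlap) p.low.cls q.low.cls q.upp.cls)]
  trans ∑ t : X.Triple, F t.overlap t.fst.cls t.snd.cls t.thd.cls
  · refine Fintype.sum_bijective _ tripleOfLow_bijective _ _ fun x => ?_
    have h1 : x.2.low.cls = (tripleOfLow x).fst.cls := restrict_restrict X _ _ _ _ _
    have h2 : x.2.upp.cls = (tripleOfLow x).snd.cls := restrict_restrict X _ _ _ _ _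
    rw [overlap_tripleOfLow, h1, h2]
    rfl
  · refine (Fintype.sum_bijective _ tripleOfUpp_bijective _ _ fun x => ?_).symm
    have h1 : x.2.low.cls = (tripleOfUpp x).snd.cls := restrict_restrict X _ _ _ _ _
    have h2 : x.2.upp.cls = (tripleOfUpp x).thd.cls := restrict_restrict X _ _ _ _ _
    rw [overlap_tripleOfUpp, h1, h2]
    rfl

end MarkedPoset

/-! ### The convolution algebra of functions on classes -/

namespace MarkedPosetClass

open MarkedPoset

/-- The class of the empty triple. -/
def emptyClass : MarkedPosetClass := MarkedPoset.empty.cls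

theorem size_cls (X : MarkedPoset) : size X.cls = Nat.card X.carrier := rfl

theorem size_eq_zero_iff (c : MarkedPosetClass) : c.size = 0 ↔ c = emptyClass := by
  induction c using Quotient.inductionOn with | _ X
  rw [emptyClass, show (⟦X⟧ : MarkedPosetClass) = X.cls from rfl, cls_eq_empty_iff, size_cls,
    Finite.card_eq_zero_iff]

theorem size_emptyClass : emptyClass.size = 0 := (size_eq_zero_iff _).2 rfl

theorem union_assoc (c d e : MarkedPosetClass) : (c.union d).union e = c.union (d.union e) := by
  induction c using Quotient.inductionOn
  induction d using Quotient.inductionOn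
  induction e using Quotient.inductionOn
  exact union_assoc_cls _ _ _

theorem union_emptyClass (c : MarkedPosetClass) : c.union emptyClass = c := by
  induction c using Quotient.inductionOn
  exact union_empty_cls _

theorem emptyClass_union (c : MarkedPosetClass) : emptyClass.union c = c := by
  induction c using Quotient.inductionOn
  exact empty_union_cls _

theorem union_eq_emptyClass_iff (c d : MarkedPosetClass) :
    c.union d = emptyClass ↔ c = emptyClass ∧ d = emptyClass := by
  rw [← size_eq_zero_iff, size_union, ← size_eq_zero_iff, ← size_eq_zero_iff]
  omega

section Convolution

variable {K : Type*} [CommRing K]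

/-- The convolution product with parameter `b` of functions of isomorphism classes. -/
noncomputable def conv (b : K) (f g : MarkedPosetClass → K) (c : MarkedPosetClass) : K :=
  Quotient.lift (convolve b f g) (fun _ _ h => convolve_congr b f g h) c

theorem conv_cls (b : K) (f g : MarkedPosetClass → K) (X : MarkedPoset) :
    conv b f g X.cls = ∑ p : X.Splitting, b ^ p.overlap * (f p.low.cls * g p.upp.cls) := rfl

theorem conv_assoc (b : K) (f g h : MarkedPosetClass → K) : conv b (conv b f g) h = conv b f (conv b g h) := by
  funext c
  induction c using Quotient.inductionOn with | _ X
  change conv b (conv b f g) h X.cls = conv b f (conv b g h) X.cls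
  have key := X.sum_splitting_low_eq_sum_splitting_upp
    fun n x y z => b ^ n * (f x * (g y * h z))
  simp only [conv_cls, Finset.sum_mul, Finset.mul_sum]
  refine Eq.trans (Finset.sum_congr rfl fun p _ => Finset.sum_congr rfl fun q _ => ?_)
    (key.trans (Finset.sum_congr rfl fun p _ => Finset.sum_congr rfl fun q _ => ?_))
  · ring
  · ring

open Classical in
theorem one_conv (b : K) (f : MarkedPosetClass → K) : conv b (Pi.single emptyClass 1) f = f := by
  funext c
  induction c using Quotient.inductionOn with | _ X
  change conv b _ f X.cls = f X.cls
  -- This is the only splitting with empty lower part, hence the only one contributing.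
  let p₀ : X.Splitting := ⟨(∅, Set.univ), isLowerSet_empty, isUpperSet_univ, Set.empty_union _, by
    rw [Set.empty_inter]; exact Set.pairwise_empty _⟩
  have h1 : p₀.low.cls = emptyClass :=
    (cls_eq_empty_iff _).2 (inferInstanceAs (IsEmpty (∅ : Set X.carrier)))
  have h2 : p₀.upp.cls = X.cls := restrict_univ X _
  have h3 : p₀.overlap = 0 := by simp [Splitting.overlap, p₀]
  rw [conv_cls, Fintype.sum_eq_single p₀, h1, h2, h3]
  · simp
  · intro p hp
    rw [Pi.single_eq_of_ne, zero_mul, mul_zero]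
    intro h
    have h4 : IsEmpty p.1.1 := (cls_eq_empty_iff _).1 h
    have h5 : p.1.1 = ∅ := Set.isEmpty_coe_sort.1 h4
    refine hp (Subtype.ext (Prod.ext h5 ?_))
    have := p.2.union_eq
    rwa [h5, Set.empty_union] at this

open Classical in
theorem conv_one (b : K) (f : MarkedPosetClass → K) : conv b f (Pi.single emptyClass 1) = f := by
  funext c
  induction c using Quotient.inductionOn with | _ X
  change conv b f _ X.cls = f X.cls
  let p₀ : X.Splitting := ⟨(Set.univ, ∅), isLowerSet_univ, isUpperSet_empty, Set.union_empty _, by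
    rw [Set.inter_empty]; exact Set.pairwise_empty _⟩
  have h1 : p₀.upp.cls = emptyClass :=
    (cls_eq_empty_iff _).2 (inferInstanceAs (IsEmpty (∅ : Set X.carrier)))
  have h2 : p₀.low.cls = X.cls := restrict_univ X _
  have h3 : p₀.overlap = 0 := by simp [Splitting.overlap, p₀]
  rw [conv_cls, Fintype.sum_eq_single p₀, h1, h2, h3]
  · simp
  · intro p hp
    rw [Pi.single_eq_of_ne, mul_zero, mul_zero]
    intro h
    have h4 : IsEmpty p.1.2 := (cls_eq_empty_iff _).1 h
    have h5 : p.1.2 = ∅ := Set.isEmpty_coe_sort.1 h4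
    refine hp (Subtype.ext (Prod.ext ?_ h5))
    have := p.2.union_eq
    rwa [h5, Set.union_empty] at this

theorem conv_emptyClass (b : K) (f g : MarkedPosetClass → K) :
    conv b f g emptyClass = f emptyClass * g emptyClass := by
  let p₀ : MarkedPoset.empty.Splitting := ⟨(∅, ∅), isLowerSet_empty, isUpperSet_empty, by
    ext x; exact Empty.elim x, by rw [Set.empty_inter]; exact Set.pairwise_empty _⟩
  have h1 : p₀.low.cls = emptyClass :=
    (cls_eq_empty_iff _).2 (inferInstanceAs (IsEmpty (∅ : Set MarkedPoset.empty.carrier)))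
  have h2 : p₀.upp.cls = emptyClass :=
    (cls_eq_empty_iff _).2 (inferInstanceAs (IsEmpty (∅ : Set MarkedPoset.empty.carrier)))
  have h3 : p₀.overlap = 0 := by simp [Splitting.overlap, p₀]
  rw [emptyClass, conv_cls, Fintype.sum_eq_single p₀, h1, h2, h3]
  · simp [emptyClass]
  · intro p hp
    refine (hp (Subtype.ext (Prod.ext ?_ ?_))).elim <;> ext x <;> exact Empty.elim x

/-- The convolution product at a disjoint union. -/
theorem conv_union (b : K) (f g : MarkedPosetClass → K) (X Y : MarkedPoset) :
    conv b f g (X.union Y).cls = ∑ p : X.Splitting, ∑ q : Y.Splitting,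
      b ^ (p.overlap + q.overlap) * (f (union p.low.cls q.low.cls) *
        g (union p.upp.cls q.upp.cls)) := by
  rw [conv_cls, ← Fintype.sum_prod_type' (f := fun (p : X.Splitting) (q : Y.Splitting) =>
    b ^ (p.overlap + q.overlap) * (f (union p.low.cls q.low.cls) *
        g (union p.upp.cls q.upp.cls)))]
  refine Fintype.sum_equiv (unionSplittingEquiv X Y) _ _ fun p => ?_
  rw [low_unionSplitting, upp_unionSplitting, overlap_unionSplitting]
  rfl

/-- The parts of a splitting cover the poset, so its size is bounded by the sum of theirs. As each
size admits finitely many classes, convolution preserves finite support. -/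
theorem exists_of_conv_ne_zero {b : K} {f g : MarkedPosetClass → K} {c : MarkedPosetClass}
    (h : conv b f g c ≠ 0) : ∃ p q, f p ≠ 0 ∧ g q ≠ 0 ∧ c.size ≤ p.size + q.size := by
  induction c using Quotient.inductionOn with | _ X
  change conv b f g X.cls ≠ 0 at h
  rw [conv_cls] at h
  obtain ⟨p, -, hp⟩ := Finset.exists_ne_zero_of_sum_ne_zero h
  refine ⟨p.low.cls, p.upp.cls, fun h => hp (by rw [h, zero_mul, mul_zero]),
    fun h => hp (by rw [h, mul_zero, mul_zero]), ?_⟩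
  have := p.card_low_add_card_upp
  change Nat.card X.carrier ≤ Nat.card p.low.carrier + Nat.card p.upp.carrier
  omega

theorem finite_conv {b : K} {f g : MarkedPosetClass → K} (hf : (Function.support f).Finite)
    (hg : (Function.support g).Finite) : (Function.support (conv b f g)).Finite := by
  refine Set.Finite.subset (Set.Finite.biUnion (hf.prod hg)
    fun p _ => finite_size_le (p.1.size + p.2.size)) fun c hc => ?_
  obtain ⟨p, q, hp, hq, h⟩ := exists_of_conv_ne_zero hc
  exact Set.mem_biUnion (x := (p, q)) ⟨hp, hq⟩ h

open Classical in
-- The structure constants of Δ are those of convolution on indicator functions. This is what makes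
-- `conv beta` the product dual to Δ.
theorem coproduct_apply (c p q : MarkedPosetClass) : c.coproduct (p, q) =
    conv beta (Pi.single p (1 : Zbeta)) (Pi.single q 1) c := by
  induction c using Quotient.inductionOn with | _ X
  change X.coproduct (p, q) = conv beta _ _ X.cls
  rw [MarkedPoset.coproduct, finsum_eq_sum_of_fintype, conv_cls, Finset.sum_apply]
  refine Finset.sum_congr rfl fun s _ => ?_
  rw [Pi.smul_apply, ctmul, LCModule.coordinates_pseudobasis, LCModule.coordinates_pseudobasis,
    Pi.single_apply, Pi.single_apply]
  simp only [eq_comm (a := p), eq_comm (a := q)]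
  rfl

end Convolution

end MarkedPosetClass

/-! ### The Hopf algebra dual to marked posets -/

/-- The free module on the isomorphism classes of marked posets. -/
def MarkedPosetDual : Type 1 := MarkedPosetClass →₀ Zbeta

namespace MarkedPosetDual

open MarkedPosetClass TensorProduct

/-- The instances are copied selectively: the pointwise product of finitely supported functions must
stay hidden, since multiplication here is convolution. -/
noncomputable instance : AddCommGroup MarkedPosetDual :=
  inferInstanceAs (AddCommGroup (MarkedPosetClass →₀ Zbeta))

noncomputable instance : Module Zbeta MarkedPosetDual :=
  inferInstanceAs (Module Zbeta (MarkedPosetClass →₀ Zbeta))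

instance : FunLike MarkedPosetDual MarkedPosetClass Zbeta :=
  inferInstanceAs (FunLike (MarkedPosetClass →₀ Zbeta) MarkedPosetClass Zbeta)

theorem finite_support (a : MarkedPosetDual) : (Function.support a).Finite :=
  Finsupp.hasFiniteSupport (f := (a : MarkedPosetClass →₀ Zbeta))

theorem add_apply (a b : MarkedPosetDual) (c : MarkedPosetClass) : (a + b) c = a c + b c := rfl

theorem smul_apply (r : Zbeta) (a : MarkedPosetDual) (c : MarkedPosetClass) :
    (r • a) c = r * a c := rfl

theorem zero_apply (c : MarkedPosetClass) : (0 : MarkedPosetDual) c = 0 := rfl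

/-- The basis of isomorphism classes. -/
noncomputable def basis : Module.Basis MarkedPosetClass Zbeta MarkedPosetDual :=
  .ofRepr (LinearEquiv.refl Zbeta (MarkedPosetClass →₀ Zbeta))

theorem basis_repr (a : MarkedPosetDual) (c : MarkedPosetClass) : basis.repr a c = a c := rfl

open Classical in
theorem basis_apply (c d : MarkedPosetClass) : basis c d = (Pi.single c 1 : MarkedPosetClass → Zbeta) d := by
  rw [← basis_repr, Module.Basis.repr_self, Finsupp.single_eq_pi_single]

open Classical in
theorem coe_basis (c : MarkedPosetClass) : (basis c : MarkedPosetClass → Zbeta) = Pi.single c 1 :=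
  funext (basis_apply c)

noncomputable instance : One MarkedPosetDual := ⟨basis emptyClass⟩

theorem one_def : (1 : MarkedPosetDual) = basis emptyClass := rfl

open Classical in
theorem coe_one : ((1 : MarkedPosetDual) : MarkedPosetClass → Zbeta) = Pi.single emptyClass 1 :=
  coe_basis _

noncomputable instance : Mul MarkedPosetDual :=
  ⟨fun a b => Finsupp.ofSupportFinite (conv beta a b) (finite_conv a.finite_support b.finite_support)⟩

theorem coe_mul (a b : MarkedPosetDual) : (↑(a * b) : MarkedPosetClass → Zbeta) = conv beta a b := rfl

theorem mul_apply (a b : MarkedPosetDual) (X : MarkedPoset) : (a * b) X.cls =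
    ∑ p : X.Splitting, beta ^ p.overlap * (a p.low.cls * b p.upp.cls) := rfl

theorem ext {a b : MarkedPosetDual} (h : ∀ X : MarkedPoset, a X.cls = b X.cls) : a = b :=
  DFunLike.ext _ _ fun c => Quotient.inductionOn c h

noncomputable instance : Ring MarkedPosetDual :=
  { (inferInstance : AddCommGroup MarkedPosetDual) with
    mul_assoc := fun a b c => DFunLike.coe_injective (by simp only [coe_mul, conv_assoc])
    one_mul := fun a => DFunLike.coe_injective (by rw [coe_mul, coe_one, one_conv])
    mul_one := fun a => DFunLike.coe_injective (by rw [coe_mul, coe_one, conv_one])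
    left_distrib := fun a b c => ext fun X => by
      simp only [add_apply, mul_apply, ← Finset.sum_add_distrib]
      exact Finset.sum_congr rfl fun _ _ => by ring
    right_distrib := fun a b c => ext fun X => by
      simp only [add_apply, mul_apply, ← Finset.sum_add_distrib]
      exact Finset.sum_congr rfl fun _ _ => by ring
    zero_mul := fun a => ext fun X => by simp [mul_apply, zero_apply]
    mul_zero := fun a => ext fun X => by simp [mul_apply, zero_apply] }

noncomputable instance : Algebra Zbeta MarkedPosetDual :=
  Algebra.ofModule
    (fun r a b => ext fun X => by
      simp only [smul_apply, mul_apply, Finset.mul_sum]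
      exact Finset.sum_congr rfl fun _ _ => by ring)
    (fun r a b => ext fun X => by
      simp only [smul_apply, mul_apply, Finset.mul_sum]
      exact Finset.sum_congr rfl fun _ _ => by ring)

/-- The basis of tensors. -/
noncomputable abbrev basis₂ : Module.Basis (MarkedPosetClass × MarkedPosetClass) Zbeta
    (MarkedPosetDual ⊗[Zbeta] MarkedPosetDual) :=
  basis.tensorProduct basis

theorem basis₂_repr_tmul (a b : MarkedPosetDual) (c d : MarkedPosetClass) :
    basis₂.repr (a ⊗ₜ b) (c, d) = a c * b d := by
  rw [Module.Basis.tensorProduct_repr_tmul_apply, basis_repr, basis_repr, smul_eq_mul, mul_comm]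

theorem finite_support_union (a : MarkedPosetDual) :
    (Function.support fun p : MarkedPosetClass × MarkedPosetClass => a (p.1.union p.2)).Finite := by
  refine Set.Finite.subset (Set.Finite.biUnion a.finite_support
    fun c _ => (finite_size_le c.size).prod (finite_size_le c.size)) fun p hp => ?_
  refine Set.mem_biUnion (x := p.1.union p.2) hp ⟨?_, ?_⟩ <;>
    simp only [Set.mem_ofPred_eq, size_union] <;> omega

/-- The coproduct, dual to the disjoint union. -/
noncomputable def comul :
    MarkedPosetDual →ₗ[Zbeta] MarkedPosetDual ⊗[Zbeta] MarkedPosetDual where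
  toFun a := basis₂.repr.symm (Finsupp.ofSupportFinite _ a.finite_support_union)
  map_add' a b := by
    rw [← map_add]
    congr 1
    ext1 p
    rfl
  map_smul' r a := by
    rw [RingHom.id_apply, ← map_smul]
    congr 1
    ext1 p
    rfl

theorem basis₂_repr_comul (a : MarkedPosetDual) (c d : MarkedPosetClass) :
    basis₂.repr (comul a) (c, d) = a (c.union d) := by
  rw [comul, LinearMap.coe_mk, AddHom.coe_mk, LinearEquiv.apply_symm_apply]
  rfl

/-- The counit, the coefficient of the empty poset. -/
noncomputable def counit : MarkedPosetDual →ₗ[Zbeta] Zbeta where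
  toFun a := a emptyClass
  map_add' _ _ := rfl
  map_smul' _ _ := rfl

theorem counit_apply (a : MarkedPosetDual) : counit a = a emptyClass := rfl

/-- The coalgebra laws are compared coordinatewise in the tensor bases. There coassociativity
becomes associativity of disjoint union, and the counit laws become its unit laws. -/
theorem repr_assoc_tmul (t : MarkedPosetDual ⊗[Zbeta] MarkedPosetDual) (b : MarkedPosetDual)
    (c d e : MarkedPosetClass) :
    (basis.tensorProduct basis₂).repr (TensorProduct.assoc Zbeta _ _ _ (t ⊗ₜ[Zbeta] b)) (c, d, e) =
      basis₂.repr t (c, d) * b e := by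
  induction t using TensorProduct.induction_on with
  | zero => simp
  | add x y hx hy => simp only [add_tmul, map_add, Finsupp.add_apply, hx, hy, add_mul]
  | tmul x y =>
    rw [TensorProduct.assoc_tmul, Module.Basis.tensorProduct_repr_tmul_apply, basis₂_repr_tmul,
      basis₂_repr_tmul, basis_repr, smul_eq_mul]
    ring

theorem repr_assoc_rTensor (t : MarkedPosetDual ⊗[Zbeta] MarkedPosetDual)
    (c d e : MarkedPosetClass) :
    (basis.tensorProduct basis₂).repr (TensorProduct.assoc Zbeta _ _ _
      (comul.rTensor MarkedPosetDual t)) (c, d, e) = basis₂.repr t (c.union d, e) := by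
  induction t using TensorProduct.induction_on with
  | zero => simp
  | add x y hx hy => simp only [map_add, Finsupp.add_apply, hx, hy]
  | tmul x y =>
    rw [LinearMap.rTensor_tmul, repr_assoc_tmul, basis₂_repr_comul, basis₂_repr_tmul]

theorem repr_lTensor (t : MarkedPosetDual ⊗[Zbeta] MarkedPosetDual) (c d e : MarkedPosetClass) :
    (basis.tensorProduct basis₂).repr (comul.lTensor MarkedPosetDual t) (c, d, e) =
      basis₂.repr t (c, d.union e) := by
  induction t using TensorProduct.induction_on with
  | zero => simp
  | add x y hx hy => simp only [map_add, Finsupp.add_apply, hx, hy]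
  | tmul x y =>
    rw [LinearMap.lTensor_tmul, Module.Basis.tensorProduct_repr_tmul_apply, basis₂_repr_comul,
      basis₂_repr_tmul, basis_repr, smul_eq_mul, mul_comm]

theorem lid_rTensor_counit (t : MarkedPosetDual ⊗[Zbeta] MarkedPosetDual) (c : MarkedPosetClass) :
    TensorProduct.lid Zbeta _ (counit.rTensor MarkedPosetDual t) c =
      basis₂.repr t (emptyClass, c) := by
  induction t using TensorProduct.induction_on with
  | zero => simp [zero_apply]
  | add x y hx hy => simp only [map_add, add_apply, Finsupp.add_apply, hx, hy]
  | tmul x y =>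
    rw [LinearMap.rTensor_tmul, TensorProduct.lid_tmul, basis₂_repr_tmul, smul_apply, counit_apply]

theorem rid_lTensor_counit (t : MarkedPosetDual ⊗[Zbeta] MarkedPosetDual) (c : MarkedPosetClass) :
    TensorProduct.rid Zbeta _ (counit.lTensor MarkedPosetDual t) c =
      basis₂.repr t (c, emptyClass) := by
  induction t using TensorProduct.induction_on with
  | zero => simp [zero_apply]
  | add x y hx hy => simp only [map_add, add_apply, Finsupp.add_apply, hx, hy]
  | tmul x y =>
    rw [LinearMap.lTensor_tmul, TensorProduct.rid_tmul, basis₂_repr_tmul, smul_apply, counit_apply,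
      mul_comm]

noncomputable instance : Coalgebra Zbeta MarkedPosetDual where
  comul := comul
  counit := counit
  coassoc := LinearMap.ext fun a => (basis.tensorProduct basis₂).repr.injective <|
    Finsupp.ext fun ⟨c, d, e⟩ => by
      rw [LinearMap.comp_apply, LinearMap.comp_apply, LinearMap.comp_apply, LinearEquiv.coe_coe,
        repr_assoc_rTensor, repr_lTensor, basis₂_repr_comul, basis₂_repr_comul, union_assoc]
  rTensor_counit_comp_comul := LinearMap.ext fun a =>
    (TensorProduct.lid Zbeta MarkedPosetDual).injective <| DFunLike.ext _ _ fun c => by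
      rw [LinearMap.comp_apply, lid_rTensor_counit, basis₂_repr_comul, emptyClass_union]
      simp
  lTensor_counit_comp_comul := LinearMap.ext fun a =>
    (TensorProduct.rid Zbeta MarkedPosetDual).injective <| DFunLike.ext _ _ fun c => by
      rw [LinearMap.comp_apply, rid_lTensor_counit, basis₂_repr_comul, union_emptyClass]
      simp

/-- Multiplication of tensors convolves in each factor separately, so the coordinates run over pairs
of splittings. By `conv_union` this is also the index set for a disjoint union, whence the
multiplicativity of the coproduct. -/
theorem repr_mul (t t' : MarkedPosetDual ⊗[Zbeta] MarkedPosetDual) (X Y : MarkedPoset) :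
    basis₂.repr (t * t') (X.cls, Y.cls) = ∑ p : X.Splitting, ∑ q : Y.Splitting,
      beta ^ (p.overlap + q.overlap) * (basis₂.repr t (p.low.cls, q.low.cls) *
        basis₂.repr t' (p.upp.cls, q.upp.cls)) := by
  induction t using TensorProduct.induction_on with
  | zero => simp
  | add x y hx hy =>
    simp only [add_mul, map_add, Finsupp.add_apply, hx, hy, mul_add, Finset.sum_add_distrib]
  | tmul a b =>
    induction t' using TensorProduct.induction_on with
    | zero => simp
    | add x y hx hy =>
      simp only [map_add, Finsupp.add_apply, hx, hy, mul_add, Finset.sum_add_distrib]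
    | tmul a' b' =>
      simp only [Algebra.TensorProduct.tmul_mul_tmul, basis₂_repr_tmul, mul_apply,
        Finset.sum_mul_sum]
      exact Finset.sum_congr rfl fun p _ => Finset.sum_congr rfl fun q _ => by ring

noncomputable instance : Bialgebra Zbeta MarkedPosetDual :=
  Bialgebra.mk' Zbeta MarkedPosetDual
    (by
      classical
      change (1 : MarkedPosetDual) emptyClass = 1
      rw [coe_one, Pi.single_eq_same])
    (fun {a b} => conv_emptyClass _ a b)
    (by
      classical
      change comul 1 = 1
      refine basis₂.repr.injective (Finsupp.ext fun ⟨c, d⟩ => ?_)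
      rw [basis₂_repr_comul, Algebra.TensorProduct.one_def, basis₂_repr_tmul, coe_one,
        Pi.single_apply, Pi.single_apply, Pi.single_apply]
      simp only [union_eq_emptyClass_iff]
      split_ifs <;> simp_all)
    (fun {a b} => by
      change comul (a * b) = comul a * comul b
      refine basis₂.repr.injective (Finsupp.ext fun ⟨c, d⟩ => ?_)
      induction c using Quotient.inductionOn with | _ X
      induction d using Quotient.inductionOn with | _ Y
      rw [basis₂_repr_comul]
      change (a * b) (X.union Y).cls = basis₂.repr (comul a * comul b) (X.cls, Y.cls)
      rw [repr_mul, coe_mul, conv_union]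
      simp only [basis₂_repr_comul])

/-- The coproduct is dual to disjoint union, under which sizes add, so it splits sizes exactly.
Overlaps keep the product from being graded, but the antipode only requires control of the
coproduct. -/
theorem isConnectedBasis : IsConnectedBasis basis size where
  comul_mem c := by
    classical
    refine Submodule.span_mono ?_ (basis₂.mem_span_repr_support (Coalgebra.comul (basis c)))
    rintro _ ⟨⟨i, j⟩, hij, rfl⟩
    refine ⟨i, j, ?_, Module.Basis.tensorProduct_apply _ _ _ _⟩
    have h : basis₂.repr (comul (basis c)) (i, j) ≠ 0 := Finsupp.mem_support_iff.1 hij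
    rw [basis₂_repr_comul, basis_apply, Pi.single_apply] at h
    rw [← size_union, (ite_ne_right_iff.1 h).1]
  scalar c hc := by
    classical
    obtain rfl := (size_eq_zero_iff c).1 hc
    change algebraMap Zbeta MarkedPosetDual (basis emptyClass emptyClass) = _
    rw [basis_apply, Pi.single_eq_same, map_one, one_def]

end MarkedPosetDual

/-! ### Duality between marked posets and `MarkedPosetDual` -/

theorem finite_coordinates_union_ne_zero (c : MarkedPosetClass) :
    {p : MarkedPosetClass × MarkedPosetClass | LCModule.coordinates Zbeta
      (LCModule.pseudobasis Zbeta MLPosetPlus (p.1.union p.2)) c ≠ 0}.Finite := by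
  refine ((MarkedPosetClass.finite_size_le c.size).prod
    (MarkedPosetClass.finite_size_le c.size)).subset fun p hp => ?_
  have hc : c = p.1.union p.2 := by
    by_contra hc
    exact hp ((LCModule.coordinates_pseudobasis _ c).trans (if_neg hc))
  have h := MarkedPosetClass.size_union p.1 p.2
  rw [← hc] at h
  exact ⟨by simp only [Set.mem_ofPred_eq]; omega, by simp only [Set.mem_ofPred_eq]; omega⟩

theorem finite_coordinates_coproduct_ne_zero (p : MarkedPosetClass × MarkedPosetClass) :
    {c : MarkedPosetClass | LCModule.coordinates Zbeta c.coproduct p ≠ 0}.Finite :=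
  (MarkedPosetClass.finite_size_le (p.1.size + p.2.size)).subset fun _ hc =>
    MarkedPosetClass.size_le_of_coproduct_ne_zero hc

theorem mlposetMul_eq_lcExtend :
    mlposetHopf.mul = lcExtend (fun p : MarkedPosetClass × MarkedPosetClass =>
      LCModule.pseudobasis Zbeta MLPosetPlus (p.1.union p.2)) finite_coordinates_union_ne_zero :=
  rfl

theorem mlposetComul_eq_lcExtend : mlposetHopf.comul =
    lcExtend MarkedPosetClass.coproduct finite_coordinates_coproduct_ne_zero :=
  rfl

/-- A pair contributes to the coordinate at `c` only if its union is `c`, and such pairs are the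
support of the dual coproduct of `c`. The sum over all pairs is thus a finite one. -/
theorem coordinates_mlposetMul
    (T : CompletedTensor Zbeta MarkedPosetClass MarkedPosetClass) (c : MarkedPosetClass) :
    LCModule.coordinates Zbeta (mlposetHopf.mul T) c =
      MarkedPosetDual.basis₂.constr Zbeta T (MarkedPosetDual.comul (MarkedPosetDual.basis c)) := by
  classical
  rw [mlposetMul_eq_lcExtend, coordinates_lcExtend, Module.Basis.constr_apply, Finsupp.sum]
  have h : ∀ p : MarkedPosetClass × MarkedPosetClass,
      LCModule.coordinates Zbeta
        (LCModule.pseudobasis Zbeta MLPosetPlus (p.1.union p.2)) c =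
      MarkedPosetDual.basis₂.repr (MarkedPosetDual.comul (MarkedPosetDual.basis c)) p := by
    rintro ⟨p, q⟩
    rw [MarkedPosetDual.basis₂_repr_comul, LCModule.coordinates_pseudobasis,
      MarkedPosetDual.basis_apply, Pi.single_apply]
    simp only [eq_comm (a := c)]
  simp only [h]
  rw [finsum_eq_sum_of_support_subset _ (s := (MarkedPosetDual.basis₂.repr
    (MarkedPosetDual.comul (MarkedPosetDual.basis c))).support)]
  · exact Finset.sum_congr rfl fun p _ => mul_comm _ _
  · intro p hp
    rw [Finset.mem_coe, Finsupp.mem_support_iff]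
    exact fun h => hp (by simp only [h, mul_zero])

theorem mlposetComul_apply (b : MLPosetPlus) (p q : MarkedPosetClass) :
    mlposetHopf.comul b (p, q) = ∑ᶠ c, b c * c.coproduct (p, q) := by
  rw [mlposetComul_eq_lcExtend]
  exact coordinates_lcExtend _ finite_coordinates_coproduct_ne_zero b (p, q)

theorem mlposet_isLCHopfAlgebra : mlposetHopf.IsLCHopfAlgebra := by
  classical
  refine mlposetHopf.isLCHopfAlgebra_of_basis MarkedPosetDual.basis MarkedPosetDual.isConnectedBasis
    (fun c T => coordinates_mlposetMul T c) (fun c => ?_) (fun p q b => ?_) fun b => ?_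
  · change LCModule.coordinates Zbeta ((1 : Zbeta) •
      LCModule.pseudobasis Zbeta MLPosetPlus MarkedPoset.empty.cls) c =
        MarkedPosetDual.basis c MarkedPosetClass.emptyClass
    rw [one_smul, LCModule.coordinates_pseudobasis, MarkedPosetDual.basis_apply, Pi.single_apply]
    simp only [eq_comm (a := c)]
    rfl
  · rw [mlposetComul_apply, Module.Basis.constr_apply]
    have h : ∀ c : MarkedPosetClass, c.coproduct (p, q) =
        (MarkedPosetDual.basis p * MarkedPosetDual.basis q) c := fun c => by
      rw [MarkedPosetClass.coproduct_apply, MarkedPosetDual.coe_mul, MarkedPosetDual.coe_basis,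
        MarkedPosetDual.coe_basis]
    simp only [h]
    rw [Finsupp.sum, finsum_eq_sum_of_support_subset _ (s := (MarkedPosetDual.basis.repr
      (MarkedPosetDual.basis p * MarkedPosetDual.basis q)).support)]
    · exact Finset.sum_congr rfl fun c _ => mul_comm _ _
    · intro c hc
      rw [Finset.mem_coe, Finsupp.mem_support_iff, MarkedPosetDual.basis_repr]
      exact fun h => hc (by simp only [h, mul_zero])
  · rw [MarkedPosetDual.one_def, Module.Basis.constr_basis]
    rfl

/-! ### The character on marked posets -/

section

variable {R : Type*} [CommRing R] {I K : Type*} {B C : Type*} [AddCommGroup B] [Module R B]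
  [LCModule R I B] [AddCommGroup C] [Module R C] [LCModule R K C]

open Classical in
/-- A coordinate of a continuous map which is a coordinate on the pseudobasis is that coordinate. -/
theorem LCContinuous.coordinates_apply_eq {f : B →ₗ[R] C} (hf : LCContinuous f) {k : K} {i : I}
    (h : ∀ j, LCModule.coordinates R (f (LCModule.pseudobasis R B j)) k = if j = i then 1 else 0)
    (b : B) : LCModule.coordinates R (f b) k = LCModule.coordinates R b i := by
  obtain ⟨F, hF⟩ := lcContinuous_iff.1 hf k
  rw [coordinates_apply_eq_sum (F := insert i F) fun b hb => hF b fun j hj =>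
    hb j (Finset.mem_insert_of_mem hj)]
  simp [h]

end

namespace MarkedPosetClass

open MarkedPoset

/-- The two summands of a disjoint union are incomparable, so the condition on labels decouples, and
cardinalities add. -/
theorem zetaLT_union (c d : MarkedPosetClass) : (c.union d).zetaLT = c.zetaLT * d.zetaLT := by
  induction c using Quotient.inductionOn with | _ X
  induction d using Quotient.inductionOn with | _ Y
  change (X.union Y).zetaLT = X.zetaLT * Y.zetaLT
  have h : (∀ s t : (X.union Y).carrier, s < t → (X.union Y).label s < (X.union Y).label t) ↔
      (∀ s t, s < t → X.label s < X.label t) ∧ ∀ s t, s < t → Y.label s < Y.label t := by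
    constructor
    · intro h
      exact ⟨fun s t hst => (sumLabel_inl_lt X.label Y.label s t).1
          (h (Sum.inl s) (Sum.inl t) (Sum.inl_lt_inl_iff.2 hst)),
        fun s t hst => (sumLabel_inr_lt X.label Y.label s t).1
          (h (Sum.inr s) (Sum.inr t) (Sum.inr_lt_inr_iff.2 hst))⟩
    · rintro ⟨h, h'⟩ (s | s) (t | t) hst
      · exact (sumLabel_inl_lt X.label Y.label s t).2 (h s t (Sum.inl_lt_inl_iff.1 hst))
      · exact (Sum.not_inl_lt_inr hst).elim
      · exact (Sum.not_inr_lt_inl hst).elim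
      · exact (sumLabel_inr_lt X.label Y.label s t).2 (h' s t (Sum.inr_lt_inr_iff.1 hst))
  have hc : Nat.card (X.union Y).carrier = Nat.card X.carrier + Nat.card Y.carrier := Nat.card_sum
  by_cases hX : ∀ s t, s < t → X.label s < X.label t
  · by_cases hY : ∀ s t, s < t → Y.label s < Y.label t
    · rw [show (X.union Y).zetaLT = _ from if_pos (h.2 ⟨hX, hY⟩), show X.zetaLT = _ from if_pos hX,
        show Y.zetaLT = _ from if_pos hY, hc, pow_add]
    · rw [show (X.union Y).zetaLT = _ from if_neg fun hXY => hY (h.1 hXY).2,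
        show Y.zetaLT = _ from if_neg hY, mul_zero]
  · rw [show (X.union Y).zetaLT = _ from if_neg fun hXY => hX (h.1 hXY).1,
      show X.zetaLT = _ from if_neg hX, zero_mul]

theorem zetaGT_union (c d : MarkedPosetClass) : (c.union d).zetaGT = c.zetaGT * d.zetaGT := by
  induction c using Quotient.inductionOn with | _ X
  induction d using Quotient.inductionOn with | _ Y
  change (X.union Y).zetaGT = X.zetaGT * Y.zetaGT
  have h : ((X.union Y).marked = ∅ ∧
        ∀ s t : (X.union Y).carrier, s ⋖ t → (X.union Y).label s > (X.union Y).label t) ↔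
      (X.marked = ∅ ∧ ∀ s t, s ⋖ t → X.label s > X.label t) ∧
        (Y.marked = ∅ ∧ ∀ s t, s ⋖ t → Y.label s > Y.label t) := by
    have hm : (X.union Y).marked = ∅ ↔ X.marked = ∅ ∧ Y.marked = ∅ := by
      change Sum.inl '' X.marked ∪ Sum.inr '' Y.marked = ∅ ↔ _
      simp
    rw [hm]
    constructor
    · rintro ⟨⟨hX, hY⟩, h⟩
      exact ⟨⟨hX, fun s t hst => (sumLabel_inl_lt X.label Y.label t s).1
          (h (Sum.inl s) (Sum.inl t) (sum_covBy_inl.2 hst))⟩,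
        ⟨hY, fun s t hst => (sumLabel_inr_lt X.label Y.label t s).1
          (h (Sum.inr s) (Sum.inr t) (sum_covBy_inr.2 hst))⟩⟩
    · rintro ⟨⟨hX, h⟩, ⟨hY, h'⟩⟩
      refine ⟨⟨hX, hY⟩, ?_⟩
      rintro (s | s) (t | t) hst
      · exact (sumLabel_inl_lt X.label Y.label t s).2 (h s t (sum_covBy_inl.1 hst))
      · exact (Sum.not_inl_lt_inr hst.1).elim
      · exact (Sum.not_inr_lt_inl hst.1).elim
      · exact (sumLabel_inr_lt X.label Y.label t s).2 (h' s t (sum_covBy_inr.1 hst))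
  have hc : Nat.card (X.union Y).carrier = Nat.card X.carrier + Nat.card Y.carrier := Nat.card_sum
  by_cases hX : X.marked = ∅ ∧ ∀ s t, s ⋖ t → X.label s > X.label t
  · by_cases hY : Y.marked = ∅ ∧ ∀ s t, s ⋖ t → Y.label s > Y.label t
    · rw [show (X.union Y).zetaGT = _ from if_pos (h.2 ⟨hX, hY⟩), show X.zetaGT = _ from if_pos hX,
        show Y.zetaGT = _ from if_pos hY, hc, pow_add]
    · rw [show (X.union Y).zetaGT = _ from if_neg fun hXY => hY (h.1 hXY).2,
        show Y.zetaGT = _ from if_neg hY, mul_zero]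
  · rw [show (X.union Y).zetaGT = _ from if_neg fun hXY => hX (h.1 hXY).1,
      show X.zetaGT = _ from if_neg hX, zero_mul]

theorem zetaLT_emptyClass : emptyClass.zetaLT = 1 := by
  change MarkedPoset.empty.zetaLT = 1
  exact (if_pos (fun s => Empty.elim s)).trans
    (by rw [show Nat.card MarkedPoset.empty.carrier = 0 from size_emptyClass, pow_zero])

theorem zetaGT_emptyClass : emptyClass.zetaGT = 1 := by
  change MarkedPoset.empty.zetaGT = 1
  exact (if_pos (⟨rfl, fun s => Empty.elim s⟩)).trans
    (by rw [show Nat.card MarkedPoset.empty.carrier = 0 from size_emptyClass, pow_zero])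

/-- The value of `ζ_{>|<}` on a class. -/
noncomputable def zeta : MarkedPosetClass → PowerSeries Zbeta :=
  conv (PowerSeries.C beta) zetaGT zetaLT

theorem zeta_cls (X : MarkedPoset) : zeta X.cls =
    ∑ p : X.Splitting, PowerSeries.C beta ^ p.overlap * (zetaGT p.low.cls * zetaLT p.upp.cls) := rfl

/-- A convolution of multiplicative functions is multiplicative, because a splitting of a disjoint
union is a pair of splittings with added overlaps. -/
theorem zeta_union (c d : MarkedPosetClass) : zeta (c.union d) = zeta c * zeta d := by
  induction c using Quotient.inductionOn with | _ X
  induction d using Quotient.inductionOn with | _ Y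
  change zeta (X.union Y).cls = zeta X.cls * zeta Y.cls
  rw [zeta, conv_union, conv_cls, conv_cls, Finset.sum_mul_sum]
  refine Finset.sum_congr rfl fun p _ => Finset.sum_congr rfl fun q _ => ?_
  rw [zetaGT_union, zetaLT_union]
  ring

theorem zeta_emptyClass : zeta emptyClass = 1 := by
  rw [zeta, conv_emptyClass, zetaGT_emptyClass, zetaLT_emptyClass, one_mul]

open Classical in
-- A constant term survives only when both parts of the splitting are empty, and the parts cover the
-- poset.
theorem coeff_zero_zeta (c : MarkedPosetClass) :
    PowerSeries.coeff 0 (zeta c) = if c = emptyClass then 1 else 0 := by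
  split_ifs with h
  · rw [h, zeta_emptyClass, PowerSeries.coeff_zero_one]
  · induction c using Quotient.inductionOn with | _ X
    change ¬ X.cls = emptyClass at h
    change PowerSeries.coeff 0 (zeta X.cls) = 0
    rw [zeta_cls, map_sum]
    refine Finset.sum_eq_zero fun p _ => ?_
    rw [PowerSeries.coeff_zero_eq_constantCoeff_apply, map_mul, map_mul]
    by_contra hne
    have h1 : size p.low.cls = 0 := size_eq_of_zetaGT_ne_zero fun h0 => hne (by
      rw [← PowerSeries.coeff_zero_eq_constantCoeff_apply (φ := zetaGT _), h0, zero_mul, mul_zero])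
    have h2 : size p.upp.cls = 0 := size_eq_of_zetaLT_ne_zero fun h0 => hne (by
      rw [← PowerSeries.coeff_zero_eq_constantCoeff_apply (φ := zetaLT _), h0, mul_zero, mul_zero])
    have h3 : size X.cls ≠ 0 := fun h0 => h ((size_eq_zero_iff _).1 h0)
    have := p.card_low_add_card_upp
    rw [size_cls] at h1 h2 h3
    omega

end MarkedPosetClass

/-! ### The character as a continuous linear map -/

theorem zetaLess_eq_lcExtend : zetaLess = lcExtend MarkedPosetClass.zetaLT fun n =>
    (MarkedPosetClass.finite_size_eq n).subset fun _ hc =>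
      MarkedPosetClass.size_eq_of_zetaLT_ne_zero hc := rfl

theorem zetaGreaterBar_eq_lcExtend : zetaGreaterBar = lcExtend MarkedPosetClass.zetaGT fun n =>
    (MarkedPosetClass.finite_size_eq n).subset fun _ hc =>
      MarkedPosetClass.size_eq_of_zetaGT_ne_zero hc := rfl

theorem mlposetMul_continuous : LCContinuous mlposetHopf.mul := by
  rw [mlposetMul_eq_lcExtend]
  exact lcExtend_continuous _ _

theorem mlposetComul_continuous : LCContinuous mlposetHopf.comul := by
  rw [mlposetComul_eq_lcExtend]
  exact lcExtend_continuous _ _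

theorem zetaGreaterLess_continuous : LCContinuous zetaGreaterLess := by
  refine powerSeriesMul_continuous.comp ((LCContinuous.cmap ?_ ?_).comp mlposetComul_continuous)
  · rw [zetaGreaterBar_eq_lcExtend]
    exact lcExtend_continuous _ _
  · rw [zetaLess_eq_lcExtend]
    exact lcExtend_continuous _ _

theorem mlposetMul_pseudobasis (c d : MarkedPosetClass) :
    mlposetHopf.mul (ctmul Zbeta (LCModule.pseudobasis Zbeta MLPosetPlus c)
      (LCModule.pseudobasis Zbeta MLPosetPlus d)) =
      LCModule.pseudobasis Zbeta MLPosetPlus (c.union d) := by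
  rw [mlposetMul_eq_lcExtend, ctmul_pseudobasis, lcExtend_pseudobasis]

theorem mlposetComul_pseudobasis (X : MarkedPoset) :
    mlposetHopf.comul (LCModule.pseudobasis Zbeta MLPosetPlus X.cls) =
      ∑ p : X.Splitting, beta ^ p.overlap •
        ctmul Zbeta (LCModule.pseudobasis Zbeta MLPosetPlus p.low.cls)
          (LCModule.pseudobasis Zbeta MLPosetPlus p.upp.cls) := by
  rw [mlposetComul_eq_lcExtend, lcExtend_pseudobasis, ← finsum_eq_sum_of_fintype]
  rfl

theorem zetaGreaterLess_pseudobasis (c : MarkedPosetClass) :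
    zetaGreaterLess (LCModule.pseudobasis Zbeta MLPosetPlus c) = c.zeta := by
  induction c using Quotient.inductionOn with | _ X
  change zetaGreaterLess (LCModule.pseudobasis Zbeta MLPosetPlus X.cls) =
    MarkedPosetClass.zeta X.cls
  rw [zetaGreaterLess, LCHopfData.convolution, LinearMap.comp_apply, LinearMap.comp_apply,
    mlposetComul_pseudobasis, map_sum, map_sum, MarkedPosetClass.zeta_cls]
  refine Finset.sum_congr rfl fun p _ => ?_
  rw [LinearMap.map_smul, LinearMap.map_smul, cmap_ctmul, powerSeriesMul_ctmul,
    zetaGreaterBar_eq_lcExtend, zetaLess_eq_lcExtend, lcExtend_pseudobasis, lcExtend_pseudobasis,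
    PowerSeries.smul_eq_C_mul, map_pow]

theorem zetaGreaterLess_isCharacter : mlposetHopf.IsCharacter zetaGreaterLess where
  continuous := zetaGreaterLess_continuous
  map_mul := by
    refine LCContinuous.ext_tensor (B := MLPosetPlus) (B' := MLPosetPlus)
      (zetaGreaterLess_continuous.comp mlposetMul_continuous)
      (powerSeriesMul_continuous.comp
        (zetaGreaterLess_continuous.cmap zetaGreaterLess_continuous)) fun c d => ?_
    rw [LinearMap.comp_apply, LinearMap.comp_apply, mlposetMul_pseudobasis, cmap_ctmul,
      powerSeriesMul_ctmul, zetaGreaterLess_pseudobasis, zetaGreaterLess_pseudobasis,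
      zetaGreaterLess_pseudobasis, MarkedPosetClass.zeta_union]
  map_unit r := by
    change zetaGreaterLess (r • LCModule.pseudobasis Zbeta MLPosetPlus
      MarkedPosetClass.emptyClass) = _
    rw [LinearMap.map_smul, zetaGreaterLess_pseudobasis, MarkedPosetClass.zeta_emptyClass,
      PowerSeries.smul_eq_C_mul, mul_one]
    rfl
  constantCoeff b := by
    rw [← PowerSeries.coeff_zero_eq_constantCoeff_apply]
    refine zetaGreaterLess_continuous.coordinates_apply_eq (k := 0)
      (i := MarkedPosetClass.emptyClass) (fun c => ?_) b
    rw [LCModule.coordinates_powerSeries, zetaGreaterLess_pseudobasis,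
      MarkedPosetClass.coeff_zero_zeta]
    congr

/-! ### Generating functions -/

section GenFun

variable {σ R : Type*} [CommRing R] {A B : Type*}

/-- The generating function of a family of weighted elements with exponents `w` and values `v`. -/
noncomputable def genFun (w : A → σ →₀ ℕ) (v : A → R) : MvPowerSeries σ R :=
  fun u => ∑ᶠ x : {x // w x = u}, v x

theorem coeff_genFun (w : A → σ →₀ ℕ) (v : A → R) (u : σ →₀ ℕ) :
    MvPowerSeries.coeff u (genFun w v) = ∑ᶠ x : {x // w x = u}, v x := rfl

theorem genFun_equiv {w : A → σ →₀ ℕ} {v : A → R} {w' : B → σ →₀ ℕ} {v' : B → R} (e : A ≃ B)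
    (hw : ∀ x, w x = w' (e x)) (hv : ∀ x, v x = v' (e x)) : genFun w v = genFun w' v' := by
  funext u
  exact finsum_eq_of_bijective (e.subtypeEquiv fun x => by rw [hw])
    (Equiv.bijective _) fun x => hv x

/-- Pairs are grouped by the weights of their two entries, which gives the Cauchy product. Finite
fibres ensure that no `finsum` takes its default value 0. -/
theorem genFun_prod [DecidableEq σ] {w : A → σ →₀ ℕ} {v : A → R} {w' : B → σ →₀ ℕ} {v' : B → R}
    (hw : ∀ u, Finite {x // w x = u}) (hw' : ∀ u, Finite {x // w' x = u}) :
    genFun (fun x : A × B => w x.1 + w' x.2) (fun x => v x.1 * v' x.2) =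
      genFun w v * genFun w' v' := by
  ext u
  have := fun u => Fintype.ofFinite {x // w x = u}
  have := fun u => Fintype.ofFinite {x // w' x = u}
  let e : {x : A × B // w x.1 + w' x.2 = u} ≃
      Σ p : Finset.HasAntidiagonal.antidiagonal u, {x // w x = p.1.1} × {x // w' x = p.1.2} :=
    { toFun := fun x => ⟨⟨(w x.1.1, w' x.1.2), Finset.HasAntidiagonal.mem_antidiagonal.2 x.2⟩,
        ⟨x.1.1, rfl⟩, ⟨x.1.2, rfl⟩⟩
      invFun := fun y => ⟨(y.2.1.1, y.2.2.1), by
        rw [y.2.1.2, y.2.2.2]; exact Finset.HasAntidiagonal.mem_antidiagonal.1 y.1.2⟩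
      left_inv := fun x => rfl
      right_inv := by
        rintro ⟨⟨⟨a, b⟩, hp⟩, ⟨x, hx⟩, ⟨y, hy⟩⟩
        change w x = a at hx
        change w' y = b at hy
        subst hx hy
        rfl }
  have h : MvPowerSeries.coeff u (genFun (fun x : A × B => w x.1 + w' x.2)
      (fun x => v x.1 * v' x.2)) = ∑ᶠ y : Σ p : Finset.HasAntidiagonal.antidiagonal u,
        {x // w x = p.1.1} × {x // w' x = p.1.2}, v y.2.1.1 * v' y.2.2.1 :=
    finsum_eq_of_bijective e e.bijective fun _ => rfl
  rw [h, finsum_eq_sum_of_fintype, Fintype.sum_sigma, MvPowerSeries.coeff_mul,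
    ← Finset.sum_coe_sort (Finset.HasAntidiagonal.antidiagonal u)]
  refine Finset.sum_congr rfl fun p _ => ?_
  rw [coeff_genFun, coeff_genFun, finsum_eq_sum_of_fintype, finsum_eq_sum_of_fintype,
    Finset.sum_mul_sum, Fintype.sum_prod_type]

theorem genFun_sigma {ι : Type*} [Fintype ι] {A : ι → Type*} {w : ∀ i, A i → σ →₀ ℕ}
    {v : ∀ i, A i → R} (hw : ∀ i u, Finite {x // w i x = u}) (c : ι → R) :
    genFun (fun x : Σ i, A i => w x.1 x.2) (fun x => c x.1 * v x.1 x.2) =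
      ∑ i, MvPowerSeries.C (c i) * genFun (w i) (v i) := by
  ext u
  have := fun i u => Fintype.ofFinite {x // w i x = u}
  let e : {x : Σ i, A i // w x.1 x.2 = u} ≃ Σ i, {x // w i x = u} :=
    { toFun := fun x => ⟨x.1.1, x.1.2, x.2⟩
      invFun := fun y => ⟨⟨y.1, y.2.1⟩, y.2.2⟩
      left_inv := fun x => rfl
      right_inv := fun x => rfl }
  have h : MvPowerSeries.coeff u (genFun (fun x : Σ i, A i => w x.1 x.2)
      (fun x => c x.1 * v x.1 x.2)) = ∑ᶠ y : Σ i, {x // w i x = u}, c y.1 * v y.1 y.2.1 :=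
    finsum_eq_of_bijective e e.bijective fun _ => rfl
  rw [h, finsum_eq_sum_of_fintype, Fintype.sum_sigma, map_sum]
  refine Finset.sum_congr rfl fun i _ => ?_
  rw [MvPowerSeries.coeff_C_mul, coeff_genFun, finsum_eq_sum_of_fintype, Finset.mul_sum]

end GenFun

/-! ### Enriched set-valued partitions -/

/-- The definition only constrains covers. Along a chain of covers the comparison passes through a
letter of each intermediate set, which exists because these sets are nonempty. -/
theorem IsEnrichedPartition.le_of_lt {P : Type*} [PartialOrder P] [Finite P] {γ : P → ℤ}
    {V : Set P} {σ : P → Finset MarkedLetter} (h : IsEnrichedPartition γ V σ) {s t : P}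
    (hst : s < t) : ∀ a ∈ σ s, ∀ b ∈ σ t, a ≤ b := by
  classical
  have := Fintype.ofFinite P
  have : LocallyFiniteOrder P := Fintype.toLocallyFiniteOrder
  rw [lt_iff_transGen_covBy] at hst
  induction hst with
  | single hst => exact h.le _ _ hst
  | tail _ hst ih =>
    intro a ha b hb
    obtain ⟨c, hc⟩ := h.nonempty _
    exact (ih a ha c hc).trans (h.le _ _ hst c hc b hb)

theorem MarkedLetter.abs_le_abs {a b : MarkedLetter} (h : a ≤ b) : a.abs ≤ b.abs :=
  Prod.Lex.monotone_fst a b h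

theorem mem_support_partitionWeight {P : Type*} [Fintype P] {σ : P → Finset MarkedLetter}
    {s : P} {m : MarkedLetter} (hm : m ∈ σ s) : m.abs ∈ (partitionWeight σ).support := by
  have h : Finsupp.single m.abs 1 ≤ partitionWeight σ :=
    (Finset.single_le_sum (f := fun m : MarkedLetter => (Finsupp.single m.abs 1 : ℕ+ →₀ ℕ))
      (fun _ _ => zero_le) hm).trans
    (Finset.single_le_sum (f := fun s => ∑ m ∈ σ s, (Finsupp.single m.abs 1 : ℕ+ →₀ ℕ))
      (fun _ _ => zero_le) (Finset.mem_univ s))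
  have := h m.abs
  rw [Finsupp.single_eq_same] at this
  rw [Finsupp.mem_support_iff]
  omega

theorem degree_partitionWeight {P : Type*} [Fintype P] (σ : P → Finset MarkedLetter) :
    (partitionWeight σ).degree = ∑ s, (σ s).card := by
  rw [partitionWeight, map_sum]
  refine Finset.sum_congr rfl fun s _ => ?_
  rw [map_sum, Finset.card_eq_sum_ones]
  exact Finset.sum_congr rfl fun m _ => Finsupp.degree_single _ _

/-! ### Enumerators over a restricted alphabet -/

namespace MarkedPoset

noncomputable instance (X : MarkedPoset) : Fintype X.carrier := Fintype.ofFinite _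

/-- The elements of `ℰ(P, γ, V)` with letters in `L`. -/
abbrev EnrichedPartition (X : MarkedPoset) (L : Set MarkedLetter) : Type :=
  {σ : X.carrier → Finset MarkedLetter //
    IsEnrichedPartition X.label X.marked σ ∧ ∀ s, ∀ m ∈ σ s, m ∈ L}

namespace EnrichedPartition

variable {X Y : MarkedPoset} {L : Set MarkedLetter}

/-- The exponent of the monomial of `σ`. -/
noncomputable def weight (σ : X.EnrichedPartition L) : ℕ+ →₀ ℕ := partitionWeight σ.1

/-- The exponent `|σ| - |P|` of `β`. -/
noncomputable def excess (σ : X.EnrichedPartition L) : ℕ :=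
  ∑ s, (σ.1 s).card - Fintype.card X.carrier

/-- Ensures that the natural-number subtraction in `excess` is never truncated. -/
theorem card_le_sum (σ : X.EnrichedPartition L) : Fintype.card X.carrier ≤ ∑ s, (σ.1 s).card := by
  rw [Fintype.card_eq_sum_ones]
  exact Finset.sum_le_sum fun s _ => (σ.2.1.nonempty s).card_pos

theorem card_le_degree_weight (σ : X.EnrichedPartition L) :
    Nat.card X.carrier ≤ σ.weight.degree := by
  rw [weight, degree_partitionWeight, Nat.card_eq_fintype_card]
  exact σ.card_le_sum

instance finite_weight_eq (u : ℕ+ →₀ ℕ) : Finite {σ : X.EnrichedPartition L // σ.weight = u} :=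
  have : Finite {σ : X.carrier → Finset MarkedLetter // partitionWeight σ = u} :=
    finite_partitionWeight_eq u
  Finite.of_injective (β := {σ : X.carrier → Finset MarkedLetter // partitionWeight σ = u})
    (fun σ => ⟨σ.1.1, σ.2⟩) fun _ _ h => Subtype.ext (Subtype.ext (congrArg (fun σ => σ.1) h))

/-- Transport along an isomorphism. -/
def congr {φ : X.carrier ≃o Y.carrier} (h : IsIso X Y φ) :
    X.EnrichedPartition L ≃ Y.EnrichedPartition L where
  toFun σ := ⟨fun s => σ.1 (φ.symm s), aux h.symm σ.2⟩
  invFun σ := ⟨fun s => σ.1 (φ s), aux h σ.2⟩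
  left_inv σ := by ext; simp
  right_inv σ := by ext; simp
where
  aux {X Y : MarkedPoset} {φ : X.carrier ≃o Y.carrier} (h : IsIso X Y φ)
      {σ : Y.carrier → Finset MarkedLetter}
      (hσ : IsEnrichedPartition Y.label Y.marked σ ∧ ∀ s, ∀ m ∈ σ s, m ∈ L) :
      IsEnrichedPartition X.label X.marked (fun s => σ (φ s)) ∧ ∀ s, ∀ m ∈ σ (φ s), m ∈ L := by
    have hc : ∀ {s t}, s ⋖ t → φ s ⋖ φ t := (apply_covBy_apply_iff φ).2
    exact ⟨⟨fun s => hσ.1.nonempty _, fun s t hst => hσ.1.le _ _ (hc hst),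
      fun s t hst hlt => hσ.1.unprimed _ _ (hc hst) ((h.label_lt_iff hst).1 hlt),
      fun s t hst hlt => hσ.1.primed _ _ (hc hst) ((h.1 s t hst).1 hlt),
      fun v hv => hσ.1.marked _ (h.2 ▸ Set.mem_image_of_mem φ hv)⟩, fun s => hσ.2 _⟩

end EnrichedPartition

/-- The generating function of the elements of `ℰ(P, γ, V)` with letters in `L`. -/
noncomputable def enumerator (L : Set MarkedLetter) (X : MarkedPoset) : MvPowerSeries ℕ+ Zbeta :=
  genFun (EnrichedPartition.weight (X := X) (L := L)) fun σ => beta ^ σ.excess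

theorem enumerator_congr (L : Set MarkedLetter) {X Y : MarkedPoset} (h : X ≈ Y) :
    X.enumerator L = Y.enumerator L := by
  obtain ⟨φ, h⟩ := h
  refine genFun_equiv (EnrichedPartition.congr h) (fun σ => ?_) fun σ => ?_
  · exact (Equiv.sum_comp φ.symm.toEquiv fun s => ∑ m ∈ σ.1 s, Finsupp.single m.abs 1).symm
  · rw [EnrichedPartition.excess, EnrichedPartition.excess, Fintype.card_congr φ.toEquiv]
    exact congrArg (fun n => beta ^ (n - _))
      (Equiv.sum_comp φ.symm.toEquiv fun s => (σ.1 s).card).symm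

theorem enumerator_univ {P : Type} [PartialOrder P] [Fintype P] (γ : P → ℤ)
    (hγ : Function.Injective γ) (V : Set P) (hV : V ⊆ valleys γ) :
    enumerator Set.univ ⟨P, γ, hγ, V, hV⟩ = enrichedEnumerator γ V := by
  let X : MarkedPoset := ⟨P, γ, hγ, V, hV⟩
  -- `enumerator` sums with the `Fintype` structure derived from finiteness, `enrichedEnumerator`
  -- with the given one. The two are equal, but not by definition.
  have hI : (Fintype.ofFinite X.carrier : Fintype P) = ‹Fintype P› := Subsingleton.elim _ _
  funext u
  rw [enrichedEnumerator, ← finsum_subtype_eq_finsum_cond]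
  have hw : ∀ σ : P → Finset MarkedLetter,
      @partitionWeight P (Fintype.ofFinite X.carrier) σ = partitionWeight σ := fun σ => by rw [hI]
  refine finsum_eq_of_bijective (fun σ => ⟨σ.1.1, σ.1.2.1, (hw _).symm.trans σ.2⟩) ⟨?_, ?_⟩ ?_
  · exact fun σ τ h => Subtype.ext (Subtype.ext (congrArg (fun σ => σ.1) h))
  · exact fun σ => ⟨⟨⟨σ.1, σ.2.1, fun _ _ _ => trivial⟩, (hw _).trans σ.2.2⟩, rfl⟩
  · intro σ
    exact congrArg (fun i => beta ^ ((@Finset.univ P i).sum (fun s => (σ.1.1 s).card) -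
      @Fintype.card P i)) hI

theorem sum_union {M : Type*} [AddCommMonoid M] (X Y : MarkedPoset)
    (f : (X.union Y).carrier → M) : ∑ s, f s = ∑ s, f (Sum.inl s) + ∑ s, f (Sum.inr s) := by
  have hI : (Fintype.ofFinite (X.union Y).carrier : Fintype (X.carrier ⊕ Y.carrier)) =
      instFintypeSum _ _ := Subsingleton.elim _ _
  exact (congrArg (fun i => (@Finset.univ _ i).sum f) hI).trans
    (Fintype.sum_sum_type (α₁ := X.carrier) (α₂ := Y.carrier) f)

/-- Enriched partitions of a disjoint union are pairs of enriched partitions. -/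
def EnrichedPartition.unionEquiv (L : Set MarkedLetter) (X Y : MarkedPoset) :
    (X.union Y).EnrichedPartition L ≃ X.EnrichedPartition L × Y.EnrichedPartition L where
  toFun σ :=
    (⟨fun s => σ.1 (Sum.inl s), ⟨fun s => σ.2.1.nonempty (Sum.inl s),
      fun s t hst => σ.2.1.le (Sum.inl s) (Sum.inl t) (sum_covBy_inl.2 hst),
      fun s t hst hlt => σ.2.1.unprimed (Sum.inl s) (Sum.inl t) (sum_covBy_inl.2 hst)
        ((sumLabel_inl_lt X.label Y.label s t).2 hlt),
      fun s t hst hlt => σ.2.1.primed (Sum.inl s) (Sum.inl t) (sum_covBy_inl.2 hst)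
        ((sumLabel_inl_lt X.label Y.label t s).2 hlt),
      fun v hv => σ.2.1.marked (Sum.inl v) (Or.inl ⟨v, hv, rfl⟩)⟩, fun s => σ.2.2 (Sum.inl s)⟩,
    ⟨fun s => σ.1 (Sum.inr s), ⟨fun s => σ.2.1.nonempty (Sum.inr s),
      fun s t hst => σ.2.1.le (Sum.inr s) (Sum.inr t) (sum_covBy_inr.2 hst),
      fun s t hst hlt => σ.2.1.unprimed (Sum.inr s) (Sum.inr t) (sum_covBy_inr.2 hst)
        ((sumLabel_inr_lt X.label Y.label s t).2 hlt),
      fun s t hst hlt => σ.2.1.primed (Sum.inr s) (Sum.inr t) (sum_covBy_inr.2 hst)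
        ((sumLabel_inr_lt X.label Y.label t s).2 hlt),
      fun v hv => σ.2.1.marked (Sum.inr v) (Or.inr ⟨v, hv, rfl⟩)⟩, fun s => σ.2.2 (Sum.inr s)⟩)
  invFun p := ⟨fun s => Sum.elim p.1.1 p.2.1 s, by
    refine ⟨⟨?_, ?_, ?_, ?_, ?_⟩, ?_⟩
    · rintro (s | s)
      exacts [p.1.2.1.nonempty s, p.2.2.1.nonempty s]
    · rintro (s | s) (t | t) hst
      · exact p.1.2.1.le s t (sum_covBy_inl.1 hst)
      · exact (Sum.not_inl_lt_inr hst.1).elim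
      · exact (Sum.not_inr_lt_inl hst.1).elim
      · exact p.2.2.1.le s t (sum_covBy_inr.1 hst)
    · rintro (s | s) (t | t) hst hlt
      · exact p.1.2.1.unprimed s t (sum_covBy_inl.1 hst)
          ((sumLabel_inl_lt X.label Y.label s t).1 hlt)
      · exact (Sum.not_inl_lt_inr hst.1).elim
      · exact (Sum.not_inr_lt_inl hst.1).elim
      · exact p.2.2.1.unprimed s t (sum_covBy_inr.1 hst)
          ((sumLabel_inr_lt X.label Y.label s t).1 hlt)
    · rintro (s | s) (t | t) hst hlt
      · exact p.1.2.1.primed s t (sum_covBy_inl.1 hst)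
          ((sumLabel_inl_lt X.label Y.label t s).1 hlt)
      · exact (Sum.not_inl_lt_inr hst.1).elim
      · exact (Sum.not_inr_lt_inl hst.1).elim
      · exact p.2.2.1.primed s t (sum_covBy_inr.1 hst)
          ((sumLabel_inr_lt X.label Y.label t s).1 hlt)
    · rintro _ (⟨v, hv, rfl⟩ | ⟨v, hv, rfl⟩)
      exacts [p.1.2.1.marked v hv, p.2.2.1.marked v hv]
    · rintro (s | s)
      exacts [p.1.2.2 s, p.2.2.2 s]⟩
  left_inv σ := by
    apply Subtype.ext
    funext s
    rcases s with s | s <;> rfl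
  right_inv p := rfl

theorem enumerator_union (L : Set MarkedLetter) (X Y : MarkedPoset) :
    (X.union Y).enumerator L = X.enumerator L * Y.enumerator L := by
  classical
  rw [enumerator, enumerator, enumerator,
    ← genFun_prod EnrichedPartition.finite_weight_eq EnrichedPartition.finite_weight_eq]
  refine genFun_equiv (EnrichedPartition.unionEquiv L X Y) (fun σ => sum_union _ _ _) fun σ => ?_
  rw [← pow_add]
  congr 1
  have h := sum_union X Y fun s => (σ.1 s).card
  have h' : Fintype.card (X.union Y).carrier = Fintype.card X.carrier + Fintype.card Y.carrier := by
    rw [← Fintype.card_sum]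
    exact Fintype.card_congr (Equiv.refl _)
  -- Excesses add only because both subtractions are genuine.
  have h1 := (EnrichedPartition.unionEquiv L X Y σ).1.card_le_sum
  have h2 := (EnrichedPartition.unionEquiv L X Y σ).2.card_le_sum
  rw [EnrichedPartition.excess, h, h', EnrichedPartition.excess, EnrichedPartition.excess]
  change Fintype.card X.carrier ≤ ∑ s, (σ.1 (Sum.inl s)).card at h1
  change Fintype.card Y.carrier ≤ ∑ s, (σ.1 (Sum.inr s)).card at h2
  change _ = (∑ s, (σ.1 (Sum.inl s)).card - _) + (∑ s, (σ.1 (Sum.inr s)).card - _)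
  omega

end MarkedPoset

/-! ### Gluing partitions along a splitting -/

namespace MarkedPoset

variable {X : MarkedPoset} {L : Set MarkedLetter}

namespace Splitting

/-- Otherwise both elements would lie in the antichain of common elements. In gluing, this excludes
covers from the upper part to the lower part. -/
theorem notMem_low_of_lt (p : X.Splitting) {s t : X.carrier} (hst : s < t) (hs : s ∈ p.1.2) :
    t ∉ p.1.1 := fun ht =>
  p.2.antichain ⟨p.2.lower hst.le ht, hs⟩ ⟨ht, p.2.upper hst.le hs⟩ hst.ne hst.le

end Splitting

namespace EnrichedPartition

open Classical in
/-- The partition of `X` glued from partitions of the two parts of a splitting. -/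
noncomputable def glue (x : Σ p : X.Splitting, p.low.EnrichedPartition L ×
    p.upp.EnrichedPartition Lᶜ) (s : X.carrier) : Finset MarkedLetter :=
  (if h : s ∈ x.1.1.1 then x.2.1.1 (⟨s, h⟩ : x.1.1.1) else ∅) ∪
    (if h : s ∈ x.1.1.2 then x.2.2.1 (⟨s, h⟩ : x.1.1.2) else ∅)

theorem mem_glue {x : Σ p : X.Splitting, p.low.EnrichedPartition L × p.upp.EnrichedPartition Lᶜ}
    {s : X.carrier} {m : MarkedLetter} : m ∈ glue x s ↔
      (∃ h : s ∈ x.1.1.1, m ∈ x.2.1.1 (⟨s, h⟩ : x.1.1.1)) ∨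
        ∃ h : s ∈ x.1.1.2, m ∈ x.2.2.1 (⟨s, h⟩ : x.1.1.2) := by
  rw [glue, Finset.mem_union]
  refine or_congr ?_ ?_ <;> split_ifs with h <;> simp [h]

/-- Conditions inside one part are inherited, since the parts are convex. Across the parts, a letter
of `L` precedes any letter outside the lower set `L`, and the conditions on common letters are
vacuous because the two alphabets are disjoint. -/
theorem isEnrichedPartition_glue (hL : IsLowerSet L)
    (x : Σ p : X.Splitting, p.low.EnrichedPartition L × p.upp.EnrichedPartition Lᶜ) :
    IsEnrichedPartition X.label X.marked (glue x) where
  nonempty s := by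
    obtain hs | hs : s ∈ x.1.1.1 ∨ s ∈ x.1.1.2 := (Set.ext_iff.1 x.1.2.union_eq s).2 trivial
    · obtain ⟨m, hm⟩ := x.2.1.2.1.nonempty (⟨s, hs⟩ : x.1.1.1)
      exact ⟨m, mem_glue.2 (Or.inl ⟨hs, hm⟩)⟩
    · obtain ⟨m, hm⟩ := x.2.2.2.1.nonempty (⟨s, hs⟩ : x.1.1.2)
      exact ⟨m, mem_glue.2 (Or.inr ⟨hs, hm⟩)⟩
  le s t hst a ha b hb := by
    obtain ⟨hs, ha⟩ | ⟨hs, ha⟩ := mem_glue.1 ha <;> obtain ⟨ht, hb⟩ | ⟨ht, hb⟩ := mem_glue.1 hb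
    · exact x.2.1.2.1.le (⟨s, hs⟩ : x.1.1.1) (⟨t, ht⟩ : x.1.1.1)
        ((covBy_coe_iff x.1.2.lower.ordConnected).1 hst) a ha b hb
    · by_contra hab
      exact x.2.2.2.2 _ b hb (hL (le_of_not_ge hab) (x.2.1.2.2 _ a ha))
    · exact (x.1.notMem_low_of_lt hst.1 hs ht).elim
    · exact x.2.2.2.1.le (⟨s, hs⟩ : x.1.1.2) (⟨t, ht⟩ : x.1.1.2)
        ((covBy_coe_iff x.1.2.upper.ordConnected).1 hst) a ha b hb
  unprimed s t hst hlt a hab := by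
    obtain ⟨ha, hb⟩ := Finset.mem_inter.1 hab
    obtain ⟨hs, ha⟩ | ⟨hs, ha⟩ := mem_glue.1 ha <;> obtain ⟨ht, hb⟩ | ⟨ht, hb⟩ := mem_glue.1 hb
    · exact x.2.1.2.1.unprimed (⟨s, hs⟩ : x.1.1.1) (⟨t, ht⟩ : x.1.1.1)
        ((covBy_coe_iff x.1.2.lower.ordConnected).1 hst) hlt a (Finset.mem_inter.2 ⟨ha, hb⟩)
    · exact (x.2.2.2.2 _ a hb (x.2.1.2.2 _ a ha)).elim
    · exact (x.2.2.2.2 _ a ha (x.2.1.2.2 _ a hb)).elim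
    · exact x.2.2.2.1.unprimed (⟨s, hs⟩ : x.1.1.2) (⟨t, ht⟩ : x.1.1.2)
        ((covBy_coe_iff x.1.2.upper.ordConnected).1 hst) hlt a (Finset.mem_inter.2 ⟨ha, hb⟩)
  primed s t hst hlt a hab := by
    obtain ⟨ha, hb⟩ := Finset.mem_inter.1 hab
    obtain ⟨hs, ha⟩ | ⟨hs, ha⟩ := mem_glue.1 ha <;> obtain ⟨ht, hb⟩ | ⟨ht, hb⟩ := mem_glue.1 hb
    · exact x.2.1.2.1.primed (⟨s, hs⟩ : x.1.1.1) (⟨t, ht⟩ : x.1.1.1)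
        ((covBy_coe_iff x.1.2.lower.ordConnected).1 hst) hlt a (Finset.mem_inter.2 ⟨ha, hb⟩)
    · exact (x.2.2.2.2 _ a hb (x.2.1.2.2 _ a ha)).elim
    · exact (x.2.2.2.2 _ a ha (x.2.1.2.2 _ a hb)).elim
    · exact x.2.2.2.1.primed (⟨s, hs⟩ : x.1.1.2) (⟨t, ht⟩ : x.1.1.2)
        ((covBy_coe_iff x.1.2.upper.ordConnected).1 hst) hlt a (Finset.mem_inter.2 ⟨ha, hb⟩)
  marked v hv a ha := by
    obtain ⟨hs, ha⟩ | ⟨hs, ha⟩ := mem_glue.1 ha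
    · exact x.2.1.2.1.marked (⟨v, hs⟩ : x.1.1.1) hv a ha
    · exact x.2.2.2.1.marked (⟨v, hs⟩ : x.1.1.2) hv a ha

/-- The values are nonempty, so the splitting can be read off from the glued partition by asking
which sets meet `L` and which meet its complement. -/
theorem mem_fst_iff {x : Σ p : X.Splitting, p.low.EnrichedPartition L × p.upp.EnrichedPartition Lᶜ}
    {s : X.carrier} : s ∈ x.1.1.1 ↔ ∃ m ∈ glue x s, m ∈ L := by
  constructor
  · intro hs
    obtain ⟨m, hm⟩ := x.2.1.2.1.nonempty (⟨s, hs⟩ : x.1.1.1)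
    exact ⟨m, mem_glue.2 (Or.inl ⟨hs, hm⟩), x.2.1.2.2 _ m hm⟩
  · rintro ⟨m, hm, hmL⟩
    obtain ⟨hs, hm⟩ | ⟨hs, hm⟩ := mem_glue.1 hm
    · exact hs
    · exact (x.2.2.2.2 _ m hm hmL).elim

theorem mem_snd_iff {x : Σ p : X.Splitting, p.low.EnrichedPartition L × p.upp.EnrichedPartition Lᶜ}
    {s : X.carrier} : s ∈ x.1.1.2 ↔ ∃ m ∈ glue x s, m ∉ L := by
  constructor
  · intro hs
    obtain ⟨m, hm⟩ := x.2.2.2.1.nonempty (⟨s, hs⟩ : x.1.1.2)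
    exact ⟨m, mem_glue.2 (Or.inr ⟨hs, hm⟩), x.2.2.2.2 _ m hm⟩
  · rintro ⟨m, hm, hmL⟩
    obtain ⟨hs, hm⟩ | ⟨hs, hm⟩ := mem_glue.1 hm
    · exact (hmL (x.2.1.2.2 _ m hm)).elim
    · exact hs

/-- Once the splittings agree, the two partitions are recovered by keeping the letters in `L` and
the letters outside `L`. -/
theorem glue_injective : Function.Injective (glue (X := X) (L := L)) := by
  intro x y hxy
  have h1 : x.1 = y.1 := by
    refine Subtype.ext (Prod.ext (Set.ext fun s => ?_) (Set.ext fun s => ?_))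
    · rw [mem_fst_iff, mem_fst_iff, hxy]
    · rw [mem_snd_iff, mem_snd_iff, hxy]
  obtain ⟨p, σ, τ⟩ := x
  obtain ⟨p', σ', τ'⟩ := y
  obtain rfl : p = p' := h1
  have hσ : ∀ {σ : p.low.EnrichedPartition L} {τ : p.upp.EnrichedPartition Lᶜ} (s : p.1.1)
      (m : MarkedLetter), m ∈ σ.1 s ↔ m ∈ glue ⟨p, σ, τ⟩ s.1 ∧ m ∈ L := by
    intro σ τ s m
    rw [mem_glue]
    constructor
    · exact fun h => ⟨Or.inl ⟨s.2, h⟩, σ.2.2 _ m h⟩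
    · rintro ⟨⟨_, h⟩ | ⟨_, h⟩, hm⟩
      · exact h
      · exact (τ.2.2 _ m h hm).elim
  have hτ : ∀ {σ : p.low.EnrichedPartition L} {τ : p.upp.EnrichedPartition Lᶜ} (s : p.1.2)
      (m : MarkedLetter), m ∈ τ.1 s ↔ m ∈ glue ⟨p, σ, τ⟩ s.1 ∧ m ∉ L := by
    intro σ τ s m
    rw [mem_glue]
    constructor
    · exact fun h => ⟨Or.inr ⟨s.2, h⟩, τ.2.2 _ m h⟩
    · rintro ⟨⟨_, h⟩ | ⟨_, h⟩, hm⟩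
      · exact (hm (σ.2.2 _ m h)).elim
      · exact h
  have h2 : σ = σ' := Subtype.ext (funext fun s => Finset.ext fun m =>
    (hσ (τ := τ) s m).trans (by rw [hxy]; exact (hσ s m).symm))
  have h3 : τ = τ' := Subtype.ext (funext fun s => Finset.ext fun m =>
    (hτ (σ := σ) s m).trans (by rw [hxy]; exact (hτ s m).symm))
  rw [h2, h3]

/-- The splitting consists of the elements whose sets meet `L` and those whose sets meet its
complement. If `s < t` were both common to the two parts, a letter of `σ s` outside `L` would be at
most a letter of `σ t` inside the lower set `L`. -/
theorem exists_glue_eq (hL : IsLowerSet L) {σ : X.carrier → Finset MarkedLetter}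
    (hσ : IsEnrichedPartition X.label X.marked σ) :
    ∃ x : Σ p : X.Splitting, p.low.EnrichedPartition L × p.upp.EnrichedPartition Lᶜ,
      glue x = σ := by
  classical
  have hsp : IsSplitting {s | ∃ m ∈ σ s, m ∈ L} {s | ∃ m ∈ σ s, m ∉ L} := by
    refine ⟨?_, ?_, ?_, ?_⟩
    · rintro s t hts ⟨m, hm, hmL⟩
      obtain rfl | hts := hts.eq_or_lt
      · exact ⟨m, hm, hmL⟩
      · obtain ⟨a, ha⟩ := hσ.nonempty t
        exact ⟨a, ha, hL (hσ.le_of_lt hts a ha m hm) hmL⟩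
    · rintro s t hst ⟨m, hm, hmL⟩
      obtain rfl | hst := hst.eq_or_lt
      · exact ⟨m, hm, hmL⟩
      · obtain ⟨a, ha⟩ := hσ.nonempty t
        exact ⟨a, ha, fun haL => hmL (hL (hσ.le_of_lt hst m hm a ha) haL)⟩
    · refine Set.eq_univ_of_forall fun s => ?_
      obtain ⟨a, ha⟩ := hσ.nonempty s
      by_cases haL : a ∈ L
      exacts [Or.inl ⟨a, ha, haL⟩, Or.inr ⟨a, ha, haL⟩]
    · rintro s ⟨-, a, ha, haL⟩ t ⟨⟨b, hb, hbL⟩, -⟩ hne hle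
      exact haL (hL (hσ.le_of_lt (lt_of_le_of_ne hle hne) a ha b hb) hbL)
  let p : X.Splitting := ⟨(_, _), hsp⟩
  have hcl : ∀ {s t : p.1.1}, s ⋖ t → s.1 ⋖ t.1 := (covBy_coe_iff hsp.lower.ordConnected).2
  have hcu : ∀ {s t : p.1.2}, s ⋖ t → s.1 ⋖ t.1 := (covBy_coe_iff hsp.upper.ordConnected).2
  let σ₁ : p.low.EnrichedPartition L := ⟨fun s => {m ∈ σ s.1 | m ∈ L},
    ⟨fun s => by
      obtain ⟨m, hm, hmL⟩ := s.2
      exact ⟨m, Finset.mem_filter.2 ⟨hm, hmL⟩⟩,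
    fun s t hst a ha b hb => hσ.le _ _ (hcl hst) a (Finset.mem_filter.1 ha).1 b
      (Finset.mem_filter.1 hb).1,
    fun s t hst hlt a ha => hσ.unprimed _ _ (hcl hst) hlt a (Finset.mem_inter.2
      ⟨(Finset.mem_filter.1 (Finset.mem_inter.1 ha).1).1,
        (Finset.mem_filter.1 (Finset.mem_inter.1 ha).2).1⟩),
    fun s t hst hlt a ha => hσ.primed _ _ (hcl hst) hlt a (Finset.mem_inter.2
      ⟨(Finset.mem_filter.1 (Finset.mem_inter.1 ha).1).1,
        (Finset.mem_filter.1 (Finset.mem_inter.1 ha).2).1⟩),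
    fun v hv a ha => hσ.marked _ hv a (Finset.mem_filter.1 ha).1⟩,
    fun s m hm => (Finset.mem_filter.1 hm).2⟩
  let σ₂ : p.upp.EnrichedPartition Lᶜ := ⟨fun s => {m ∈ σ s.1 | m ∉ L},
    ⟨fun s => by
      obtain ⟨m, hm, hmL⟩ := s.2
      exact ⟨m, Finset.mem_filter.2 ⟨hm, hmL⟩⟩,
    fun s t hst a ha b hb => hσ.le _ _ (hcu hst) a (Finset.mem_filter.1 ha).1 b
      (Finset.mem_filter.1 hb).1,
    fun s t hst hlt a ha => hσ.unprimed _ _ (hcu hst) hlt a (Finset.mem_inter.2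
      ⟨(Finset.mem_filter.1 (Finset.mem_inter.1 ha).1).1,
        (Finset.mem_filter.1 (Finset.mem_inter.1 ha).2).1⟩),
    fun s t hst hlt a ha => hσ.primed _ _ (hcu hst) hlt a (Finset.mem_inter.2
      ⟨(Finset.mem_filter.1 (Finset.mem_inter.1 ha).1).1,
        (Finset.mem_filter.1 (Finset.mem_inter.1 ha).2).1⟩),
    fun v hv a ha => hσ.marked _ hv a (Finset.mem_filter.1 ha).1⟩,
    fun s m hm => (Finset.mem_filter.1 hm).2⟩
  refine ⟨⟨p, σ₁, σ₂⟩, funext fun s => Finset.ext fun m => mem_glue.trans ⟨?_, fun hm => ?_⟩⟩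
  · rintro (⟨_, hm⟩ | ⟨_, hm⟩)
    exacts [(Finset.mem_filter.1 hm).1, (Finset.mem_filter.1 hm).1]
  · by_cases hmL : m ∈ L
    · exact Or.inl ⟨⟨m, hm, hmL⟩, Finset.mem_filter.2 ⟨hm, hmL⟩⟩
    · exact Or.inr ⟨⟨m, hm, hmL⟩, Finset.mem_filter.2 ⟨hm, hmL⟩⟩

/-- Gluing identifies pairs of partitions of the parts of the splittings of `X` with partitions
of `X`, given a lower set of letters. -/
noncomputable def glueEquiv (hL : IsLowerSet L) :
    (Σ p : X.Splitting, p.low.EnrichedPartition L × p.upp.EnrichedPartition Lᶜ) ≃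
      X.EnrichedPartition Set.univ :=
  Equiv.ofBijective (fun x => ⟨glue x, isEnrichedPartition_glue hL x, fun _ _ _ => trivial⟩)
    ⟨fun _ _ h => glue_injective (congrArg Subtype.val h), fun σ => by
      obtain ⟨x, hx⟩ := exists_glue_eq hL σ.2.1
      exact ⟨x, Subtype.ext hx⟩⟩

theorem sum_glue {M : Type*} [AddCommMonoid M] (f : MarkedLetter → M)
    (x : Σ p : X.Splitting, p.low.EnrichedPartition L × p.upp.EnrichedPartition Lᶜ) :
    ∑ s, ∑ m ∈ glue x s, f m =
      ∑ s, ∑ m ∈ x.2.1.1 s, f m + ∑ s, ∑ m ∈ x.2.2.1 s, f m := by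
  classical
  have h : ∀ s, ∑ m ∈ glue x s, f m =
      (∑ m ∈ if h : s ∈ x.1.1.1 then x.2.1.1 (⟨s, h⟩ : x.1.1.1) else ∅, f m) +
      ∑ m ∈ if h : s ∈ x.1.1.2 then x.2.2.1 (⟨s, h⟩ : x.1.1.2) else ∅, f m := by
    intro s
    rw [glue, Finset.sum_union]
    rw [Finset.disjoint_left]
    intro m hm hm'
    split_ifs at hm hm'
    · exact x.2.2.2.2 _ m hm' (x.2.1.2.2 _ m hm)
    all_goals simp at hm hm'
  rw [Finset.sum_congr rfl fun s _ => h s, Finset.sum_add_distrib]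
  congr 1
  · refine (Fintype.sum_of_injective (fun s : x.1.1.1 => s.1) Subtype.val_injective
      (fun s => ∑ m ∈ x.2.1.1 s, f m) _ ?_ ?_).symm.trans ?_
    · intro s hs
      rw [dif_neg fun h => hs ⟨⟨s, h⟩, rfl⟩, Finset.sum_empty]
    · intro s
      rw [dif_pos s.2]
    -- The sums over the lower part use two propositionally equal `Fintype` structures.
    · exact congrArg (fun i => (@Finset.univ x.1.1.1 i).sum _) (Subsingleton.elim _ _)
  · refine (Fintype.sum_of_injective (fun s : x.1.1.2 => s.1) Subtype.val_injective
      (fun s => ∑ m ∈ x.2.2.1 s, f m) _ ?_ ?_).symm.trans ?_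
    · intro s hs
      rw [dif_neg fun h => hs ⟨⟨s, h⟩, rfl⟩, Finset.sum_empty]
    · intro s
      rw [dif_pos s.2]
    · exact congrArg (fun i => (@Finset.univ x.1.1.2 i).sum _) (Subsingleton.elim _ _)

theorem weight_glueEquiv (hL : IsLowerSet L)
    (x : Σ p : X.Splitting, p.low.EnrichedPartition L × p.upp.EnrichedPartition Lᶜ) :
    (glueEquiv hL x).weight = x.2.1.weight + x.2.2.weight :=
  sum_glue _ x

/-- The source of β^{|S ∩ T|}: the numbers of letters add up exactly, whereas the sizes of the parts
exceed the size of the poset by the overlap. -/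
theorem excess_glueEquiv (hL : IsLowerSet L)
    (x : Σ p : X.Splitting, p.low.EnrichedPartition L × p.upp.EnrichedPartition Lᶜ) :
    (glueEquiv hL x).excess = x.1.overlap + (x.2.1.excess + x.2.2.excess) := by
  have h := sum_glue (fun _ => 1) x
  simp only [← Finset.card_eq_sum_ones] at h
  have h1 := x.2.1.card_le_sum
  have h2 := x.2.2.card_le_sum
  have h3 := x.1.card_low_add_card_upp
  simp only [Nat.card_eq_fintype_card] at h3
  rw [excess, excess, excess, show ∑ s, ((glueEquiv hL x).1 s).card = _ from h]
  omega

end EnrichedPartition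

/-- Enumerators split along lower sets of letters. -/
theorem enumerator_univ_eq_sum (hL : IsLowerSet L) : X.enumerator Set.univ =
    ∑ p : X.Splitting, MvPowerSeries.C (beta ^ p.overlap) *
      (p.low.enumerator L * p.upp.enumerator Lᶜ) := by
  classical
  have h : ∀ p : X.Splitting, p.low.enumerator L * p.upp.enumerator Lᶜ =
      genFun (fun x : p.low.EnrichedPartition L × p.upp.EnrichedPartition Lᶜ =>
        x.1.weight + x.2.weight) fun x => beta ^ x.1.excess * beta ^ x.2.excess := fun p =>
    (genFun_prod EnrichedPartition.finite_weight_eq EnrichedPartition.finite_weight_eq).symm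
  simp only [h]
  rw [← genFun_sigma]
  · refine (genFun_equiv (EnrichedPartition.glueEquiv hL) (fun x => ?_) fun x => ?_).symm
    · rw [EnrichedPartition.weight_glueEquiv]
    · rw [EnrichedPartition.excess_glueEquiv, pow_add, pow_add]
  · intro p u
    refine Set.Finite.subset (Set.Finite.biUnion
      (Finset.finite_toSet (Finset.HasAntidiagonal.antidiagonal u)) (t := fun q =>
        {σ : p.low.EnrichedPartition L | σ.weight = q.1} ×ˢ
          {σ : p.upp.EnrichedPartition Lᶜ | σ.weight = q.2}) fun q _ => ?_) fun x hx => ?_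
    · exact (Set.finite_coe_iff.1 (EnrichedPartition.finite_weight_eq q.1)).prod
        (Set.finite_coe_iff.1 (EnrichedPartition.finite_weight_eq q.2))
    · exact Set.mem_biUnion (x := (x.1.weight, x.2.weight))
        (Finset.HasAntidiagonal.mem_antidiagonal.2 hx) ⟨rfl, rfl⟩

end MarkedPoset

/-! ### Coefficients of enumerators -/

theorem exists_abs_eq_of_mem_support {P : Type*} [Fintype P] {σ : P → Finset MarkedLetter} {i : ℕ+}
    (hi : i ∈ (partitionWeight σ).support) : ∃ s, ∃ m ∈ σ s, m.abs = i := by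
  rw [Finsupp.mem_support_iff, partitionWeight, Finsupp.finsetSum_apply] at hi
  obtain ⟨s, -, hs⟩ := Finset.exists_ne_zero_of_sum_ne_zero hi
  rw [Finsupp.finsetSum_apply] at hs
  obtain ⟨m, hm, hne⟩ := Finset.exists_ne_zero_of_sum_ne_zero hs
  exact ⟨s, m, hm, by_contra fun h => hne (Finsupp.single_eq_of_ne fun h' => h h'.symm)⟩

namespace MarkedPoset

variable {X : MarkedPoset} {L : Set MarkedLetter} {u : ℕ+ →₀ ℕ}

theorem exists_weight_eq_of_coeff_ne_zero (h : MvPowerSeries.coeff u (X.enumerator L) ≠ 0) :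
    ∃ σ : X.EnrichedPartition L, σ.weight = u := by
  by_contra hn
  have : IsEmpty {σ : X.EnrichedPartition L // σ.weight = u} := ⟨fun σ => hn ⟨σ.1, σ.2⟩⟩
  exact h (finsum_of_isEmpty _)

theorem card_le_degree_of_coeff_ne_zero (h : MvPowerSeries.coeff u (X.enumerator L) ≠ 0) :
    Nat.card X.carrier ≤ u.degree := by
  obtain ⟨σ, rfl⟩ := exists_weight_eq_of_coeff_ne_zero h
  exact σ.card_le_degree_weight

theorem exists_mem_of_coeff_ne_zero (h : MvPowerSeries.coeff u (X.enumerator L) ≠ 0) {i : ℕ+}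
    (hi : i ∈ u.support) : ∃ m ∈ L, m.abs = i := by
  obtain ⟨σ, rfl⟩ := exists_weight_eq_of_coeff_ne_zero h
  obtain ⟨s, m, hm, rfl⟩ := exists_abs_eq_of_mem_support hi
  exact ⟨m, σ.2.2 s m hm, rfl⟩

/-- A partition of weight `u` only uses letters whose variable occurs in `u`, so enlarging an
alphabet that already contains all of these changes nothing. -/
theorem coeff_enumerator_eq_univ (hu : ∀ m : MarkedLetter, m.abs ∈ u.support → m ∈ L) :
    MvPowerSeries.coeff u (X.enumerator L) = MvPowerSeries.coeff u (X.enumerator Set.univ) := by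
  refine finsum_eq_of_bijective (fun σ => ⟨⟨σ.1.1, σ.1.2.1, fun _ _ _ => trivial⟩, σ.2⟩)
    ⟨fun σ τ h => Subtype.ext (Subtype.ext (congrArg (fun σ => σ.1.1) h)), fun σ => ?_⟩ fun _ => rfl
  refine ⟨⟨⟨σ.1.1, σ.1.2.1, fun s m hm => hu m ?_⟩, σ.2⟩, rfl⟩
  have h := mem_support_partitionWeight hm
  rwa [show partitionWeight σ.1.1 = u from σ.2] at h

/-- Coefficients at a product of monomials in disjoint intervals of variables. -/
theorem coeff_add_enumerator {u v : ℕ+ →₀ ℕ} (h : ∀ i ∈ u.support, ∀ j ∈ v.support, i < j) :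
    MvPowerSeries.coeff (u + v) (X.enumerator Set.univ) =
      ∑ p : X.Splitting, beta ^ p.overlap *
        (MvPowerSeries.coeff u (p.low.enumerator Set.univ) *
          MvPowerSeries.coeff v (p.upp.enumerator Set.univ)) := by
  classical
  -- A lower set containing both letters of every variable of `u`, and no letter of a variable of
  -- `v`.
  let L : Set MarkedLetter := {m | ∃ i ∈ u.support, m.abs ≤ i}
  have hL : IsLowerSet L := fun a b hba ⟨i, hi, ha⟩ =>
    ⟨i, hi, (MarkedLetter.abs_le_abs hba).trans ha⟩
  rw [enumerator_univ_eq_sum hL, map_sum]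
  refine Finset.sum_congr rfl fun p _ => ?_
  rw [MvPowerSeries.coeff_C_mul, MvPowerSeries.coeff_mul, Finset.sum_eq_single (u, v)]
  · rw [coeff_enumerator_eq_univ (L := L) fun m hm => ⟨m.abs, hm, le_rfl⟩,
      coeff_enumerator_eq_univ (L := Lᶜ)]
    rintro m hm ⟨i, hi, hmi⟩
    exact (h i hi _ hm).not_ge hmi
  -- A nonzero term has `a` vanishing on the variables of `v` and `b` vanishing on those of `u`.
  -- With `a + b = u + v` this forces `(a, b) = (u, v)`.
  · rintro ⟨a, b⟩ hab hne
    rw [Finset.HasAntidiagonal.mem_antidiagonal] at hab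
    by_contra hzero
    have ha : ∀ i, a i ≠ 0 → ∃ j ∈ u.support, i ≤ j := fun i hi => by
      obtain ⟨m, hm, rfl⟩ := exists_mem_of_coeff_ne_zero (left_ne_zero_of_mul hzero)
        (Finsupp.mem_support_iff.2 hi)
      exact hm
    have hb : ∀ i, b i ≠ 0 → u i = 0 := fun i hi => by
      obtain ⟨m, hm, rfl⟩ := exists_mem_of_coeff_ne_zero (right_ne_zero_of_mul hzero)
        (Finsupp.mem_support_iff.2 hi)
      by_contra hu
      exact hm ⟨_, Finsupp.mem_support_iff.2 hu, le_rfl⟩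
    have hv : ∀ i, a i ≠ 0 → v i = 0 := fun i hi => by
      obtain ⟨j, hj, hij⟩ := ha i hi
      by_contra hv
      exact (h j hj i (Finsupp.mem_support_iff.2 hv)).not_ge hij
    have key : ∀ i, a i = u i ∧ b i = v i := fun i => by
      have h1 : a i + b i = u i + v i := DFunLike.congr_fun hab i
      have h2 := hb i
      have h3 := hv i
      omega
    exact hne (Prod.ext (Finsupp.ext fun i => (key i).1) (Finsupp.ext fun i => (key i).2))
  · exact fun hn => (hn (Finset.HasAntidiagonal.mem_antidiagonal.2 rfl)).elim

open Classical in
/-- If only one letter has a given absolute value, there is at most one partition with letters of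
that absolute value. -/
theorem coeff_single_enumerator {m₀ : MarkedLetter} (hm₀ : m₀ ∈ L)
    (h : ∀ m ∈ L, m.abs = m₀.abs → m = m₀) (n : ℕ) :
    MvPowerSeries.coeff (Finsupp.single m₀.abs n) (X.enumerator L) =
      if IsEnrichedPartition X.label X.marked (fun _ => {m₀}) ∧ n = Nat.card X.carrier
      then 1 else 0 := by
  have hσ : ∀ σ : X.EnrichedPartition L, σ.weight = Finsupp.single m₀.abs n →
      σ.1 = fun _ => {m₀} := fun σ hσ => by
    funext s
    refine Finset.eq_singleton_iff_nonempty_unique_mem.2 ⟨σ.2.1.nonempty s, fun m hm => ?_⟩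
    have h1 := mem_support_partitionWeight hm
    rw [show partitionWeight σ.1 = _ from hσ] at h1
    exact h m (σ.2.2 s m hm) (Finset.mem_singleton.1 (Finsupp.support_single_subset h1))
  have hw : partitionWeight (fun _ : X.carrier => {m₀}) =
      Finsupp.single m₀.abs (Nat.card X.carrier) := by
    simp [partitionWeight, Nat.card_eq_fintype_card]
  split_ifs with hc
  · obtain ⟨hE, rfl⟩ := hc
    let σ₀ : X.EnrichedPartition L := ⟨fun _ => {m₀}, hE, fun _ m hm => by
      rwa [Finset.mem_singleton.1 hm]⟩
    refine (finsum_eq_single _ ⟨σ₀, hw⟩ fun σ hne => ?_).trans ?_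
    · exact (hne (Subtype.ext (Subtype.ext (hσ _ σ.2)))).elim
    · simp [EnrichedPartition.excess, σ₀]
  · by_contra hne
    obtain ⟨σ, hσ'⟩ := exists_weight_eq_of_coeff_ne_zero hne
    have h1 := hσ σ hσ'
    refine hc ⟨h1 ▸ σ.2.1, ?_⟩
    have h2 : partitionWeight σ.1 = _ := hσ'
    rw [h1, hw] at h2
    exact (Finsupp.single_injective _ h2).symm

/-- At every cover the two sets share their only letter. It is primed, so an ascent forbids it, and
so does a marked element. -/
theorem isEnrichedPartition_primed_iff (i : ℕ+) :
    IsEnrichedPartition X.label X.marked (fun _ => {(toLex (i, false) : MarkedLetter)}) ↔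
      X.marked = ∅ ∧ ∀ s t, s ⋖ t → X.label s > X.label t := by
  have hp : ¬ MarkedLetter.IsUnprimed (toLex (i, false)) := Bool.false_ne_true
  constructor
  · intro h
    refine ⟨Set.eq_empty_of_forall_notMem fun v hv =>
      hp (h.marked v hv _ (Finset.mem_singleton_self _)), fun s t hst => ?_⟩
    by_contra hlt
    refine hp (h.unprimed s t hst (lt_of_le_of_ne (not_lt.1 hlt)
      fun he => hst.1.ne (X.label_injective he)) _ ?_)
    rw [Finset.inter_self]
    exact Finset.mem_singleton_self _
  · rintro ⟨hm, h⟩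
    refine ⟨fun _ => Finset.singleton_nonempty _, fun s t _ a ha b hb => ?_,
      fun s t hst hlt => (lt_asymm hlt (h s t hst)).elim, fun s t hst hlt a ha => ?_, fun v hv => ?_⟩
    · rw [Finset.mem_singleton.1 ha, Finset.mem_singleton.1 hb]
    · rw [Finset.inter_self] at ha
      rwa [Finset.mem_singleton.1 ha]
    · rw [hm] at hv
      exact hv.elim

/-- The shared letter is now forbidden at descents only. Marked valleys permit unprimed letters,
which is why ζ_< ignores the marking while ζ̄_> does not. -/
theorem isEnrichedPartition_unprimed_iff (i : ℕ+) :
    IsEnrichedPartition X.label X.marked (fun _ => {(toLex (i, true) : MarkedLetter)}) ↔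
      ∀ s t, s < t → X.label s < X.label t := by
  have hp : MarkedLetter.IsUnprimed (toLex (i, true)) := rfl
  constructor
  · intro h
    refine fun s t hst => (strictMono_iff_covBy X).2 (fun s t hst => ?_) hst
    by_contra hlt
    refine h.primed s t hst (lt_of_le_of_ne (not_lt.1 hlt)
      fun he => hst.1.ne' (X.label_injective he)) _ ?_ hp
    rw [Finset.inter_self]
    exact Finset.mem_singleton_self _
  · intro h
    refine ⟨fun _ => Finset.singleton_nonempty _, fun s t _ a ha b hb => ?_,
      fun s t hst hlt a ha => ?_, fun s t hst hlt => (lt_asymm hlt (h s t hst.1)).elim,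
      fun v hv a ha => ?_⟩
    · rw [Finset.mem_singleton.1 ha, Finset.mem_singleton.1 hb]
    · rw [Finset.inter_self] at ha
      rwa [Finset.mem_singleton.1 ha]
    · rwa [Finset.mem_singleton.1 ha]

/-- One-variable coefficients are given by the character. -/
theorem coeff_single_enumerator_univ (i : ℕ+) (n : ℕ) :
    MvPowerSeries.coeff (Finsupp.single i n) (X.enumerator Set.univ) =
      PowerSeries.coeff n (MarkedPosetClass.zeta X.cls) := by
  classical
  -- The cut falls between `i'` and `i`, so each part of a splitting has a single letter of absolute
  -- value `i` available.
  let L : Set MarkedLetter := Set.Iic (toLex (i, false))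
  have h1 : ∀ (Y : MarkedPoset) (a : ℕ), MvPowerSeries.coeff (Finsupp.single i a)
      (Y.enumerator L) = PowerSeries.coeff a Y.zetaGT := by
    intro Y a
    refine (coeff_single_enumerator (L := L) (m₀ := toLex (i, false)) (Set.mem_Iic.2 le_rfl) ?_ a).trans ?_
    · intro m hm hi
      obtain ⟨j, b⟩ := m
      obtain rfl : j = i := hi
      obtain hlt | ⟨-, hle⟩ := (Prod.Lex.le_iff ..).1 (show toLex (j, b) ≤ toLex (j, false) from hm)
      · exact (lt_irrefl _ hlt).elim
      · obtain rfl : b = false := Bool.eq_false_of_le_false hle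
        rfl
    · rw [isEnrichedPartition_primed_iff, zetaGT]
      split_ifs <;> simp_all [PowerSeries.coeff_X_pow]
  have h2 : ∀ (Y : MarkedPoset) (a : ℕ), MvPowerSeries.coeff (Finsupp.single i a)
      (Y.enumerator Lᶜ) = PowerSeries.coeff a Y.zetaLT := by
    intro Y a
    refine (coeff_single_enumerator (L := Lᶜ) (m₀ := toLex (i, true)) ?_ ?_ a).trans ?_
    · intro hm
      obtain hlt | ⟨-, hle⟩ := (Prod.Lex.le_iff ..).1 hm
      · exact lt_irrefl _ hlt
      · exact absurd (show true ≤ false from hle) (by decide)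
    · intro m hm hi
      obtain ⟨j, b⟩ := m
      obtain rfl : j = i := hi
      cases b
      · exact (hm (Set.mem_Iic.2 le_rfl)).elim
      · rfl
    · rw [isEnrichedPartition_unprimed_iff, zetaLT]
      split_ifs <;> simp_all [PowerSeries.coeff_X_pow]
  rw [enumerator_univ_eq_sum (isLowerSet_Iic _), MarkedPosetClass.zeta_cls, map_sum, map_sum]
  refine Finset.sum_congr rfl fun p _ => ?_
  rw [MvPowerSeries.coeff_C_mul, ← map_pow, PowerSeries.coeff_C_mul, MvPowerSeries.coeff_mul,
    PowerSeries.coeff_mul, Finsupp.antidiagonal_single, Finset.sum_map]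
  exact congrArg _ (Finset.sum_congr rfl fun q _ => congrArg₂ _ (h1 _ _) (h2 _ _))

end MarkedPoset

/-! ### Quasisymmetry of the enumerators -/

namespace MarkedPosetClass

open MarkedPoset

/-- The enumerator of a class. -/
noncomputable def enumerator (c : MarkedPosetClass) : MvPowerSeries ℕ+ Zbeta :=
  Quotient.lift (MarkedPoset.enumerator Set.univ) (fun _ _ h => enumerator_congr _ h) c

theorem coeff_add_enumerator {u v : ℕ+ →₀ ℕ} (h : ∀ i ∈ u.support, ∀ j ∈ v.support, i < j)
    (c : MarkedPosetClass) : MvPowerSeries.coeff (u + v) c.enumerator =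
      conv beta (fun c => MvPowerSeries.coeff u c.enumerator)
        (fun c => MvPowerSeries.coeff v c.enumerator) c := by
  induction c using Quotient.inductionOn
  exact MarkedPoset.coeff_add_enumerator h

theorem coeff_single_enumerator (i : ℕ+) (n : ℕ) (c : MarkedPosetClass) :
    MvPowerSeries.coeff (Finsupp.single i n) c.enumerator = PowerSeries.coeff n c.zeta := by
  induction c using Quotient.inductionOn
  exact MarkedPoset.coeff_single_enumerator_univ i n

theorem enumerator_union (c d : MarkedPosetClass) :
    (c.union d).enumerator = c.enumerator * d.enumerator := by
  induction c using Quotient.inductionOn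
  induction d using Quotient.inductionOn
  exact MarkedPoset.enumerator_union _ _ _

theorem size_le_degree_of_coeff_ne_zero {c : MarkedPosetClass} {u : ℕ+ →₀ ℕ}
    (h : MvPowerSeries.coeff u c.enumerator ≠ 0) : c.size ≤ u.degree := by
  induction c using Quotient.inductionOn
  exact card_le_degree_of_coeff_ne_zero h

/-- The coefficients of the enumerator of a class, as a function of the packed exponent. -/
noncomputable def enumeratorCoeff : List ℕ+ → MarkedPosetClass → Zbeta
  | [], c => PowerSeries.coeff 0 c.zeta
  | n :: α, c => conv beta (fun c => PowerSeries.coeff (n : ℕ) c.zeta) (enumeratorCoeff α) c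

/-- Removing the smallest variable repeatedly expresses the coefficient as an iterated convolution
of coefficients of ζ. Only the nonzero exponents and their order enter, which is quasisymmetry. -/
theorem coeff_enumerator (u : ℕ+ →₀ ℕ) :
    ∀ c : MarkedPosetClass, MvPowerSeries.coeff u c.enumerator = enumeratorCoeff (pack u) c := by
  induction u using Finsupp.induction_on_min with
  | zero =>
    intro c
    rw [pack_zero, enumeratorCoeff, ← coeff_single_enumerator 1, Finsupp.single_zero]
  | single_add i n u hi hn ih =>
    intro c
    have h : ∀ a ∈ (Finsupp.single i n).support, ∀ b ∈ u.support, a < b := fun a ha b hb => by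
      rw [Finset.mem_singleton.1 (Finsupp.support_single_subset ha)]
      exact hi b hb
    rw [coeff_add_enumerator h, pack_add h, pack_single i hn, List.singleton_append,
      enumeratorCoeff, funext ih]
    simp only [coeff_single_enumerator]
    simp [Nat.pos_of_ne_zero hn]

/-- The enumerator of a class as a quasisymmetric power series. -/
noncomputable def enumeratorQSym (c : MarkedPosetClass) : MQSym Zbeta :=
  ⟨c.enumerator, mem_MQSym_of_pack (fun α => enumeratorCoeff α c) fun u => coeff_enumerator u c⟩

end MarkedPosetClass

/-! ### The morphism -/

namespace MarkedPosetClass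

theorem coordinates_enumeratorQSym (c : MarkedPosetClass) (u : ℕ+ →₀ ℕ) :
    LCModule.coordinates Zbeta c.enumeratorQSym (pack u) = MvPowerSeries.coeff u c.enumerator :=
  (coeff_mqsym c.enumeratorQSym u).symm

/-- Each element of the poset contributes at least one letter, so the degree of the monomial bounds
the size of the class. -/
theorem finite_coordinates_enumeratorQSym_ne_zero (α : List ℕ+) :
    {c : MarkedPosetClass | LCModule.coordinates Zbeta c.enumeratorQSym α ≠ 0}.Finite := by
  refine (finite_size_le (compositionExponent α).degree).subset fun c hc => ?_
  rw [Set.mem_ofPred_eq, ← pack_compositionExponent α, coordinates_enumeratorQSym] at hc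
  exact size_le_degree_of_coeff_ne_zero hc

/-- By quasisymmetry, `α` and `α'` may be realized by exponents in separated ranges of variables,
where the cutting formula applies. -/
theorem coordinates_append_enumeratorQSym (α α' : List ℕ+) (c : MarkedPosetClass) :
    LCModule.coordinates Zbeta c.enumeratorQSym (α ++ α') =
      conv beta (fun c => LCModule.coordinates Zbeta c.enumeratorQSym α)
        (fun c => LCModule.coordinates Zbeta c.enumeratorQSym α') c := by
  let u := compositionExponent α
  obtain ⟨N, hN⟩ := u.support.exists_le
  -- Shifting by `N`, a bound for the variables of `u`, puts the second exponent entirely above the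
  -- first.
  let f : ℕ+ ↪o ℕ+ := OrderEmbedding.ofStrictMono (fun i => N + i) fun i j h => by simpa using h
  let v := (compositionExponent α').embDomain f.toEmbedding
  have hu : pack u = α := pack_compositionExponent α
  have hv : pack v = α' := (pack_embDomain f _).trans (pack_compositionExponent α')
  have h : ∀ i ∈ u.support, ∀ j ∈ v.support, i < j := fun i hi j hj => by
    obtain ⟨k, -, rfl⟩ := Finset.mem_map.1
      ((Finsupp.support_embDomain f.toEmbedding (compositionExponent α')) ▸ hj)
    exact (hN i hi).trans_lt (PNat.lt_add_right N k)
  rw [← hu, ← hv, ← pack_add h]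
  simp only [coordinates_enumeratorQSym]
  exact coeff_add_enumerator h c

end MarkedPosetClass

/-- The continuous linear map `[(P, γ, V)] ↦ Ω^{(β)}(P, γ, V)`. -/
noncomputable def enumeratorMap : MLPosetPlus →ₗ[Zbeta] MQSym Zbeta :=
  lcExtend MarkedPosetClass.enumeratorQSym
    MarkedPosetClass.finite_coordinates_enumeratorQSym_ne_zero

theorem enumeratorMap_continuous : LCContinuous enumeratorMap :=
  lcExtend_continuous _ _

theorem enumeratorMap_pseudobasis (c : MarkedPosetClass) :
    enumeratorMap (LCModule.pseudobasis Zbeta MLPosetPlus c) = c.enumeratorQSym :=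
  lcExtend_pseudobasis _ _ _

theorem enumeratorMap_mapsToEnrichedEnumerator : MapsToEnrichedEnumerator enumeratorMap := by
  intro P _ _ γ hγ V hV
  rw [posetClass, enumeratorMap_pseudobasis]
  exact MarkedPoset.enumerator_univ γ hγ V hV

theorem eq_enumeratorMap {φ : MLPosetPlus →ₗ[Zbeta] MQSym Zbeta} (hφ : LCContinuous φ)
    (h : MapsToEnrichedEnumerator φ) : φ = enumeratorMap := by
  refine hφ.ext enumeratorMap_continuous fun c => ?_
  induction c using Quotient.inductionOn with | _ X
  exact Subtype.ext ((h X.carrier X.label X.label_injective X.marked X.marked_subset).trans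
    (enumeratorMap_mapsToEnrichedEnumerator X.carrier X.label X.label_injective X.marked
      X.marked_subset).symm)

theorem zetaQ_enumeratorQSym (c : MarkedPosetClass) : zetaQ Zbeta c.enumeratorQSym = c.zeta := by
  ext1 n
  rw [coeff_zetaQ]
  exact MarkedPosetClass.coeff_single_enumerator 1 n c

open Classical in
theorem coordinates_nil_enumeratorQSym (c : MarkedPosetClass) :
    LCModule.coordinates Zbeta c.enumeratorQSym [] =
      if c = MarkedPosetClass.emptyClass then 1 else 0 := by
  rw [← pack_zero (σ := ℕ+), MarkedPosetClass.coordinates_enumeratorQSym,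
    ← Finsupp.single_zero 1, MarkedPosetClass.coeff_single_enumerator,
    MarkedPosetClass.coeff_zero_zeta]

theorem enumerator_emptyClass :
    MarkedPosetClass.emptyClass.enumeratorQSym = ⟨1, one_mem_MQSym Zbeta⟩ := by
  classical
  refine Subtype.ext (MvPowerSeries.ext fun u => ?_)
  rw [MvPowerSeries.coeff_one]
  split_ifs with hu
  · rw [hu, ← Finsupp.single_zero 1]
    refine (MarkedPosetClass.coeff_single_enumerator 1 0 MarkedPosetClass.emptyClass).trans ?_
    rw [MarkedPosetClass.coeff_zero_zeta, if_pos rfl]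
  · by_contra hne
    obtain ⟨σ, rfl⟩ := MarkedPoset.exists_weight_eq_of_coeff_ne_zero (X := MarkedPoset.empty) hne
    exact hu (Finset.sum_eq_zero fun s _ => Empty.elim s)

theorem enumeratorQSym_union (c d : MarkedPosetClass) : (c.union d).enumeratorQSym =
    (mqsymHopf Zbeta).mul (ctmul Zbeta c.enumeratorQSym d.enumeratorQSym) := by
  refine Subtype.ext ?_
  change _ = (mqsymMul Zbeta (ctmul Zbeta c.enumeratorQSym d.enumeratorQSym)).1
  rw [mqsymMul_ctmul]
  exact MarkedPosetClass.enumerator_union c d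

/-- By continuity, compatibility with products, coproducts and ζ is verified on pseudobasis
elements: there it is `enumeratorQSym_union`, the cutting formula between groups of variables, and
the cutting formula between `i'` and `i`. -/
theorem enumeratorMap_isMorphism : IsCombinatorialLCHopfMorphism mlposetHopf zetaGreaterLess
    (mqsymHopf Zbeta) (zetaQ Zbeta) enumeratorMap where
  continuous := enumeratorMap_continuous
  map_mul := by
    refine LCContinuous.ext_tensor (B := MLPosetPlus) (B' := MLPosetPlus)
      (enumeratorMap_continuous.comp mlposetMul_continuous)
      (mqsymMul_continuous.comp
        (enumeratorMap_continuous.cmap enumeratorMap_continuous)) fun c d => ?_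
    rw [LinearMap.comp_apply, LinearMap.comp_apply, mlposetMul_pseudobasis, cmap_ctmul,
      enumeratorMap_pseudobasis, enumeratorMap_pseudobasis, enumeratorMap_pseudobasis,
      enumeratorQSym_union]
  map_unit := by
    refine LinearMap.ext_ring ?_
    change enumeratorMap ((1 : Zbeta) • LCModule.pseudobasis Zbeta MLPosetPlus
      MarkedPosetClass.emptyClass) = (1 : Zbeta) • (⟨1, one_mem_MQSym Zbeta⟩ : MQSym Zbeta)
    rw [one_smul, one_smul, enumeratorMap_pseudobasis, enumerator_emptyClass]
  map_comul := by
    refine (mqsymComul_continuous.comp enumeratorMap_continuous).ext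
      ((enumeratorMap_continuous.cmap enumeratorMap_continuous).comp mlposetComul_continuous)
      fun c => ?_
    induction c using Quotient.inductionOn with | _ X
    change (mqsymHopf Zbeta).comul (enumeratorMap (LCModule.pseudobasis Zbeta MLPosetPlus X.cls)) =
      cmap enumeratorMap enumeratorMap
        (mlposetHopf.comul (LCModule.pseudobasis Zbeta MLPosetPlus X.cls))
    rw [mlposetComul_pseudobasis, enumeratorMap_pseudobasis, map_sum]
    funext p
    rw [Finset.sum_apply]
    refine (MarkedPosetClass.coordinates_append_enumeratorQSym p.1 p.2 X.cls).trans
      (Finset.sum_congr rfl fun s _ => ?_)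
    rw [map_smul, cmap_ctmul, enumeratorMap_pseudobasis, enumeratorMap_pseudobasis]
    rfl
  map_counit := by
    refine LinearMap.ext fun b => ?_
    refine enumeratorMap_continuous.coordinates_apply_eq (k := [])
      (i := MarkedPosetClass.emptyClass) (fun c => ?_) b
    rw [enumeratorMap_pseudobasis, coordinates_nil_enumeratorQSym]
    congr
  comp_zeta := by
    refine (zetaQ_continuous.comp enumeratorMap_continuous).ext zetaGreaterLess_continuous
      fun c => ?_
    rw [LinearMap.comp_apply, enumeratorMap_pseudobasis, zetaQ_enumeratorQSym,
      zetaGreaterLess_pseudobasis]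

/-- A morphism to quasisymmetric power series is determined by its source. -/
theorem IsCombinatorialLCHopfMorphism.eq {R I B : Type*} [CommRing R] [AddCommGroup B] [Module R B]
    [LCModule R I B] {H : LCHopfData R I B} {ζ : B →ₗ[R] PowerSeries R} {φ ψ : B →ₗ[R] MQSym R}
    (hφ : IsCombinatorialLCHopfMorphism H ζ (mqsymHopf R) (zetaQ R) φ)
    (hψ : IsCombinatorialLCHopfMorphism H ζ (mqsymHopf R) (zetaQ R) ψ) : φ = ψ := by
  suffices h : ∀ (α : List ℕ+) (b : B),
      LCModule.coordinates R (φ b) α = LCModule.coordinates R (ψ b) α from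
    LinearMap.ext fun b => (LCModule.coordinates R).injective (funext fun α => h α b)
  have hcomul : ∀ {χ : B →ₗ[R] MQSym R},
      IsCombinatorialLCHopfMorphism H ζ (mqsymHopf R) (zetaQ R) χ → ∀ (α α' : List ℕ+) (b : B),
      LCModule.coordinates R (χ b) (α ++ α') = cmap χ χ (H.comul b) (α, α') :=
    fun hχ α α' b => congrFun (LinearMap.congr_fun hχ.map_comul b) (α, α')
  have hzeta : ∀ {χ : B →ₗ[R] MQSym R},
      IsCombinatorialLCHopfMorphism H ζ (mqsymHopf R) (zetaQ R) χ → ∀ (n : ℕ+) (b : B),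
      LCModule.coordinates R (χ b) [n] = PowerSeries.coeff n (ζ b) := fun {χ} hχ n b => by
    rw [← hχ.comp_zeta, LinearMap.comp_apply, coeff_zetaQ, coeff_mqsym, pack_single 1 n.ne_zero]
    simp
  intro α
  induction α with
  | nil =>
    intro b
    exact (LinearMap.congr_fun hφ.map_counit b).trans (LinearMap.congr_fun hψ.map_counit b).symm
  | cons n α ih =>
    intro b
    -- Deconcatenating `n :: α` as `[n] ++ α` leaves a head coefficient given by ζ and a tail
    -- coefficient covered by the induction hypothesis.
    rw [← List.singleton_append, hcomul hφ, hcomul hψ, cmap_apply, cmap_apply, hzeta hφ, hzeta hψ]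
    simp only [ih]

/-- Each equivalence with `φ = Φ` expresses existence and uniqueness at once. Sharing `Φ` between
them says that the map given by the enumerators is the unique morphism. -/
theorem mainTheorem4 :
    IsCombinatorialLCHopfAlgebra mlposetHopf zetaGreaterLess ∧
    IsCombinatorialLCHopfAlgebra (mqsymHopf Zbeta) (zetaQ Zbeta) ∧
    ∃ Φ : MLPosetPlus →ₗ[Zbeta] MQSym Zbeta,
      (∀ φ : MLPosetPlus →ₗ[Zbeta] MQSym Zbeta,
        (LCContinuous φ ∧ MapsToEnrichedEnumerator φ) ↔ φ = Φ) ∧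
      (∀ φ : MLPosetPlus →ₗ[Zbeta] MQSym Zbeta,
        IsCombinatorialLCHopfMorphism mlposetHopf zetaGreaterLess (mqsymHopf Zbeta) (zetaQ Zbeta) φ
          ↔ φ = Φ) := by
  refine ⟨⟨mlposet_isLCHopfAlgebra, zetaGreaterLess_isCharacter⟩,
    ⟨mqsym_isLCHopfAlgebra Zbeta, zetaQ_isCharacter⟩, enumeratorMap, fun φ => ?_, fun φ => ?_⟩
  · constructor
    · exact fun h => eq_enumeratorMap h.1 h.2
    · rintro rfl
      exact ⟨enumeratorMap_continuous, enumeratorMap_mapsToEnrichedEnumerator⟩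
  · constructor
    · exact fun h => h.eq enumeratorMap_isMorphism
    · rintro rfl
      exact enumeratorMap_isMorphism
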